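/- Let $K$ be an algebraically closed field of characteristic $p>0$ and let $d\ge 2$. Let $X$ be the complete toric variety over $K$ of dimension $d-1$ defined by a complete fan $\Delta$ in $\mathbb{R}^{d-1}$ (with respect to the lattice $\mathbb{Z}^{d-1}$), let $v_1,\dots,v_s$ be the primitive generators of the edges of $\Delta$ and $D_1,\dots,D_s$ the corresponding torus-invariant prime divisors, and let $D=\sum_i a_iD_i$ be a very ample torus-invariant Cartier divisor on $X$. Put $$P_D=\{u\in\mathbb{R}^{d-1} : \langle u,v_i\rangle\ge -a_i \text{ for all } i\}.$$ For $k\ge 1$ let $R_k=K[\chi^{(u,1)} : u\in P_{kD}\cap\mathbb{Z}^{d-1}]$ be the homogeneous coordinate ring of $X$ in the embedding given by $kD$, let $\mathbf{m}_k$ be its graded maximal ideal, and let $$e_{HK}(X,kD)=\lim_{q=p^n\to\infty}\frac{\ell(R_k/\mathbf{m}_k^{[q]})}{q^{d}},\qquad e_0(X,kD)=\lim_{m\to\infty}\frac{d!\,\ell(R_k/\mathbf{m}_k^{m})}{m^{d}}$$ be its Hilbert–Kunz multiplicity and its Hilbert–Samuel multiplicity (where $\mathbf{m}_k^{[q]}$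 is the ideal generated by the $q$-th powers of the elements of $\mathbf{m}_k$); these limits exist. Then the limit $$A(X,D)=\lim_{k\to\infty}\frac{e_{HK}(X,kD)-e_0(X,kD)/d!}{k^{d-2}}$$ exists, and $$e_0(X,D)^{\frac{2-d}{d-1}}\,A(X,D)\;\ge\;\frac{d-1}{d}\,\bigl((d-1)!\bigr)^{\frac{2-d}{d-1}}.$$ Moreover, equality holds if and only if $P_D$ tiles $\mathbb{R}^{d-1}$, that is, for some real $\lambda>0$ one has $\bigcup_{v\in\mathbb{Z}^{d-1}}(v+\lambda P_D)=\mathbb{R}^{d-1}$ and $\dim\bigl[(v+\lambda P_D)\cap(v'+\lambda P_D)\bigr]<d-1$ for all $v\ne v'$ in $\mathbb{Z}^{d-1}$. -/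

import Mathlib

open CategoryTheory AlgebraicGeometry Filter Topology

universe u

namespace ToricPair

/-! ### Hilbert-Kunz and Hilbert-Samuel multiplicities -/

/-- The Frobenius power `I^[q]`: the ideal generated by the `q`-th powers of the elements of `I`. -/
def frobeniusPower {R : Type*} [CommRing R] (I : Ideal R) (q : ℕ) : Ideal R :=
  Ideal.span ((fun x => x ^ q) '' (I : Set R))

/-- The sequence `ℓ(R / I^[q]) / q^d`, `q = p^e`, where `d` is the dimension of the ring `R` of
characteristic `p`. -/
noncomputable def hkSeq {R : Type*} [CommRing R] (p d : ℕ) (I : Ideal R) (e : ℕ) : ℝ :=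
  ((Module.length R (R ⧸ frobeniusPower I (p ^ e))).toNat : ℝ) / ((p : ℝ) ^ e) ^ d

/-- The Hilbert-Kunz multiplicity `e_HK(R, I) = lim ℓ(R / I^[q]) / q^d`, where `d = dim R`. -/
noncomputable def hkMultiplicity {R : Type*} [CommRing R] (p d : ℕ) (I : Ideal R) : ℝ :=
  limUnder atTop (hkSeq p d I)

/-- The sequence `d! ℓ(R / I^m) / m^d`, where `d` is the dimension of the ring `R`. -/
noncomputable def hsSeq {R : Type*} [CommRing R] (d : ℕ) (I : Ideal R) (m : ℕ) : ℝ :=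
  (d.factorial : ℝ) * ((Module.length R (R ⧸ I ^ m)).toNat : ℝ) / (m : ℝ) ^ d

/-- The Hilbert-Samuel multiplicity `e_0(R, I) = lim d! ℓ(R / I^m) / m^d`, where `d = dim R`. -/
noncomputable def hsMultiplicity {R : Type*} [CommRing R] (d : ℕ) (I : Ideal R) : ℝ :=
  limUnder atTop (hsSeq d I)

/-! ### Rational cones and their affine toric varieties

The lattice of one-parameter subgroups is `N = ℤⁿ`, the character lattice is `M = Hom(N, ℤ) = ℤⁿ`,
and the pairing between the two is the dot product. -/

variable {n : ℕ}

/-- The inclusion `ℤⁿ ⊆ ℝⁿ`. -/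
def toReal (v : Fin n → ℤ) : Fin n → ℝ := fun i => (v i : ℝ)

/-- A rational polyhedral cone in `N_ℝ`: generated by finitely many lattice vectors. -/
def IsRational (σ : PointedCone ℝ (Fin n → ℝ)) : Prop :=
  ∃ s : Finset (Fin n → ℤ), σ = PointedCone.hull ℝ (toReal '' (s : Set (Fin n → ℤ)))

/-- A primitive lattice vector: not a proper multiple of another lattice vector. -/
def IsPrimitive (v : Fin n → ℤ) : Prop :=
  ∀ (a : ℤ) (w : Fin n → ℤ), v = a • w → IsUnit a

/-- The monoid `S_σ = σ^∨ ∩ M` of characters that are nonnegative on `σ`. -/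
def chartMonoid (σ : PointedCone ℝ (Fin n → ℝ)) : AddSubmonoid (Fin n → ℤ) where
  carrier := {m | ∀ x ∈ σ, 0 ≤ toReal m ⬝ᵥ x}
  zero_mem' := by
    intro x _
    simp [toReal, dotProduct]
  add_mem' := by
    intro a b ha hb x hx
    have : toReal (a + b) = toReal a + toReal b := by ext i; simp [toReal]
    rw [this, add_dotProduct]
    exact add_nonneg (ha x hx) (hb x hx)

/-- `τ` is a face of `σ`: `τ = σ ∩ m^⊥` for some `m` in `σ^∨`. (For rational cones, which are the
only ones considered, it is no restriction that `m` is taken in the lattice `M`.) -/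
def IsFace (τ σ : PointedCone ℝ (Fin n → ℝ)) : Prop :=
  ∃ m ∈ chartMonoid σ, ∀ x, x ∈ τ ↔ x ∈ σ ∧ toReal m ⬝ᵥ x = 0

theorem chartMonoid_anti {τ σ : PointedCone ℝ (Fin n → ℝ)} (h : τ ≤ σ) :
    chartMonoid σ ≤ chartMonoid τ := fun _ hm x hx => hm x (h hx)

/-- The coordinate ring `K[S_σ]` of the affine toric variety `U_σ`. -/
abbrev ChartRing (K : Type u) [Field K] (σ : PointedCone ℝ (Fin n → ℝ)) : Type u :=
  AddMonoidAlgebra K (chartMonoid σ)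

/-- For a subcone `τ ⊆ σ`, the inclusion `K[S_σ] ⊆ K[S_τ]`. -/
noncomputable def chartRingMap (K : Type u) [Field K] {τ σ : PointedCone ℝ (Fin n → ℝ)}
    (h : τ ≤ σ) : ChartRing K σ →+* ChartRing K τ :=
  AddMonoidAlgebra.mapDomainRingHom K (AddSubmonoid.inclusion (chartMonoid_anti h))

theorem chartRingMap_refl (K : Type u) [Field K] (σ : PointedCone ℝ (Fin n → ℝ)) :
    chartRingMap K (le_refl σ) = RingHom.id _ :=
  AddMonoidAlgebra.mapDomainRingHom_id

theorem chartRingMap_comp (K : Type u) [Field K] {ρ τ σ : PointedCone ℝ (Fin n → ℝ)}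
    (h₁ : ρ ≤ τ) (h₂ : τ ≤ σ) :
    (chartRingMap K h₁).comp (chartRingMap K h₂) = chartRingMap K (h₁.trans h₂) :=
  (AddMonoidAlgebra.mapDomainRingHom_comp _ _).symm

/-- If `τ = σ ∩ m^⊥` is a face of `σ`, then `S_τ` is obtained from `S_σ` by inverting `m`. -/
theorem exists_shift_mem {τ σ : PointedCone ℝ (Fin n → ℝ)} (hσ : IsRational σ)
    {m : Fin n → ℤ} (hm : m ∈ chartMonoid σ)
    (hτ : ∀ x, x ∈ τ ↔ x ∈ σ ∧ toReal m ⬝ᵥ x = 0) {w : Fin n → ℤ} (hw : w ∈ chartMonoid τ) :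
    ∃ k : ℕ, ∀ j : ℕ, k ≤ j → j • m + w ∈ chartMonoid σ := by
  obtain ⟨s, hs⟩ := hσ
  have key (a b : Fin n → ℤ) : toReal a ⬝ᵥ toReal b = ((a ⬝ᵥ b : ℤ) : ℝ) := by
    simp [toReal, dotProduct]
  refine ⟨∑ v ∈ s, (w ⬝ᵥ v).natAbs, fun j hj => ?_⟩
  have gen (v : Fin n → ℤ) (hv : v ∈ s) : 0 ≤ toReal (j • m + w) ⬝ᵥ toReal v := by
    have hvσ : toReal v ∈ σ := by
      rw [hs]; exact Submodule.subset_span ⟨v, hv, rfl⟩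
    have h1 := hm _ hvσ
    have h2 : (w ⬝ᵥ v).natAbs ≤ j :=
      (Finset.single_le_sum (f := fun v => (w ⬝ᵥ v).natAbs) (fun _ _ => Nat.zero_le _) hv).trans hj
    rw [key] at h1 ⊢
    have h1' : 0 ≤ m ⬝ᵥ v := by exact_mod_cast h1
    have e : (j • m + w) ⬝ᵥ v = j * (m ⬝ᵥ v) + w ⬝ᵥ v := by
      rw [add_dotProduct, smul_dotProduct]; simp
    rw [e]
    norm_cast
    rcases h1'.eq_or_lt with h0 | h0
    · have hvτ : toReal v ∈ τ := (hτ _).2 ⟨hvσ, by rw [key, ← h0]; simp⟩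
      have h3 := hw _ hvτ
      rw [key] at h3
      have h3' : 0 ≤ w ⬝ᵥ v := by exact_mod_cast h3
      rw [← h0]; simpa using h3'
    · have : (j : ℤ) ≤ j * (m ⬝ᵥ v) := by nlinarith [Int.natCast_nonneg j]
      omega
  intro x hx
  rw [hs] at hx
  induction hx using Submodule.span_induction with
  | mem x hx => obtain ⟨v, hv, rfl⟩ := hx; exact gen v hv
  | zero => simp
  | add x y _ _ hx hy => rw [dotProduct_add]; exact add_nonneg hx hy
  | smul a x _ hx =>
    have : a • x = (a : ℝ) • x := rfl
    rw [this, dotProduct_smul]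
    exact mul_nonneg a.2 hx

/-- If `τ = σ ∩ m^⊥` is a face of `σ`, then `K[S_τ]` is the localization of `K[S_σ]` at `χ^m`. -/
theorem isLocalization_chartRingMap (K : Type u) [Field K] {τ σ : PointedCone ℝ (Fin n → ℝ)}
    (hσ : IsRational σ) (h : τ ≤ σ) {m : Fin n → ℤ} (hm : m ∈ chartMonoid σ)
    (hτ : ∀ x, x ∈ τ ↔ x ∈ σ ∧ toReal m ⬝ᵥ x = 0) :
    letI := (chartRingMap K h).toAlgebra
    IsLocalization.Away (AddMonoidAlgebra.single (⟨m, hm⟩ : chartMonoid σ) (1 : K) : ChartRing K σ)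
      (ChartRing K τ) := by
  let := (chartRingMap K h).toAlgebra
  have alg (f : ChartRing K σ) : algebraMap (ChartRing K σ) (ChartRing K τ) f =
    chartRingMap K h f := rfl
  have hneg : -m ∈ chartMonoid τ := by
    intro x hx
    have : toReal (-m) = - toReal m := by ext i; simp [toReal]
    rw [this, neg_dotProduct, ((hτ x).1 hx).2, neg_zero]
  have hsing (a : chartMonoid σ) (c : K) : chartRingMap K h (AddMonoidAlgebra.single a c) =
      AddMonoidAlgebra.single (AddSubmonoid.inclusion (chartMonoid_anti h) a) c := by
    simp [chartRingMap]
  have hinj : Function.Injective (chartRingMap K h) :=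
    AddMonoidAlgebra.mapDomain_injective (AddSubmonoid.inclusion_injective (chartMonoid_anti h))
  have hunit : IsUnit (chartRingMap K h
      (AddMonoidAlgebra.single (⟨m, hm⟩ : chartMonoid σ) (1 : K))) := by
    rw [hsing]
    refine IsUnit.of_mul_eq_one (AddMonoidAlgebra.single ⟨-m, hneg⟩ 1) ?_
    rw [AddMonoidAlgebra.single_mul_single, AddMonoidAlgebra.one_def]
    congr 1
    · ext; simp
    · simp
  have hsurj (z : ChartRing K τ) : ∃ k : ℕ, ∃ f : ChartRing K σ, z * (chartRingMap K h
      (AddMonoidAlgebra.single (⟨m, hm⟩ : chartMonoid σ) (1 : K))) ^ k = chartRingMap K h f := by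
    induction z using AddMonoidAlgebra.induction_linear with
    | zero => exact ⟨0, 0, by simp⟩
    | add z₁ z₂ h₁ h₂ =>
      obtain ⟨k₁, f₁, h₁⟩ := h₁
      obtain ⟨k₂, f₂, h₂⟩ := h₂
      refine ⟨k₁ + k₂, f₁ * AddMonoidAlgebra.single (⟨m, hm⟩ : chartMonoid σ) (1 : K) ^ k₂ +
        f₂ * AddMonoidAlgebra.single (⟨m, hm⟩ : chartMonoid σ) (1 : K) ^ k₁, ?_⟩
      rw [map_add, map_mul, map_mul, ← h₁, ← h₂, map_pow, map_pow]
      ring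
    | single w c =>
      obtain ⟨k, hk⟩ := exists_shift_mem hσ hm hτ w.2
      refine ⟨k, AddMonoidAlgebra.single ⟨k • m + w.1, hk k le_rfl⟩ c, ?_⟩
      rw [hsing, hsing, AddMonoidAlgebra.single_pow, AddMonoidAlgebra.single_mul_single]
      congr 1
      · ext; simp [add_comm]
      · simp
  refine ⟨⟨?_, ?_, ?_⟩⟩
  · rintro ⟨_, k, rfl⟩
    rw [alg, map_pow]
    exact hunit.pow k
  · intro z
    obtain ⟨k, f, hf⟩ := hsurj z
    exact ⟨⟨f, ⟨_, k, rfl⟩⟩, by simp only [alg, map_pow]; exact hf⟩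
  · intro x y hxy
    exact ⟨1, by rw [hinj hxy]⟩

/-! ### Fans and toric varieties -/

/-- A fan in `N_ℝ = ℝⁿ`: a finite nonempty collection of strongly convex rational polyhedral cones
that contains the faces of its members, any two of which meet in a common face. (The roles of `σ`
and `τ` in the last field can be exchanged.) -/
structure Fan (n : ℕ) where
  cones : Set (PointedCone ℝ (Fin n → ℝ))
  finite : cones.Finite
  nonempty : cones.Nonempty
  rational : ∀ σ ∈ cones, IsRational σ
  salient : ∀ σ ∈ cones, (σ : ConvexCone ℝ (Fin n → ℝ)).Salient
  face_mem : ∀ σ ∈ cones, ∀ τ, IsFace τ σ → τ ∈ cones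
  inf_isFace : ∀ σ ∈ cones, ∀ τ ∈ cones, IsFace (σ ⊓ τ) σ

namespace Fan

variable (Δ : Fan n)

/-- The cones of the fan, ordered by inclusion. -/
abbrev Cone : Type := {σ : PointedCone ℝ (Fin n → ℝ) // σ ∈ Δ.cones}

/-- The fan is complete: its support is all of `N_ℝ`. -/
def IsComplete : Prop := ∀ x : Fin n → ℝ, ∃ σ ∈ Δ.cones, x ∈ σ

/-- The diagram of the affine toric varieties `U_σ = Spec K[S_σ]`, `σ ∈ Δ`, with the maps
`U_τ → U_σ` for `τ` a face of `σ`. -/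
noncomputable def chartDiagram (K : Type u) [Field K] : Δ.Cone ⥤ Scheme.{u} where
  obj σ := Spec (CommRingCat.of (ChartRing K σ.1))
  map f := Spec.map (CommRingCat.ofHom (chartRingMap K (leOfHom f)))
  map_id σ := by
    rw [← Spec.map_id, chartRingMap_refl]
    rfl
  map_comp f g := by
    rw [← Spec.map_comp, ← CommRingCat.ofHom_comp, chartRingMap_comp]

theorem isFace_of_le {τ σ : Δ.Cone} (h : τ ≤ σ) : IsFace τ.1 σ.1 := by
  have := Δ.inf_isFace σ.1 σ.2 τ.1 τ.2
  rwa [inf_eq_right.2 h] at this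

instance isOpenImmersion_chartDiagram (K : Type u) [Field K] {τ σ : Δ.Cone} (f : τ ⟶ σ) :
    IsOpenImmersion ((Δ.chartDiagram K).map f) := by
  obtain ⟨m, hm, hτ⟩ := Δ.isFace_of_le (leOfHom f)
  let := (chartRingMap K (leOfHom f)).toAlgebra
  have := isLocalization_chartRingMap K (Δ.rational _ σ.2) (leOfHom f) hm hτ
  exact IsOpenImmersion.of_isLocalization (S := ChartRing K τ.1)
    (AddMonoidAlgebra.single (⟨m, hm⟩ : chartMonoid σ.1) (1 : K) : ChartRing K σ.1)

theorem mem_range_chartDiagram_map (K : Type u) [Field K] {τ σ : Δ.Cone} (f : τ ⟶ σ)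
    {m : Fin n → ℤ} (hm : m ∈ chartMonoid σ.1)
    (hτ : ∀ x, x ∈ τ.1 ↔ x ∈ σ.1 ∧ toReal m ⬝ᵥ x = 0)
    (x : PrimeSpectrum (ChartRing K σ.1)) :
    (x : (Δ.chartDiagram K).obj σ) ∈ Set.range ((Δ.chartDiagram K).map f) ↔
      x ∈ PrimeSpectrum.basicOpen
        (AddMonoidAlgebra.single (⟨m, hm⟩ : chartMonoid σ.1) (1 : K) : ChartRing K σ.1) := by
  let := (chartRingMap K (leOfHom f)).toAlgebra
  have := isLocalization_chartRingMap K (Δ.rational _ σ.2) (leOfHom f) hm hτ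
  have h := PrimeSpectrum.localization_away_comap_range (ChartRing K τ.1)
    (AddMonoidAlgebra.single (⟨m, hm⟩ : chartMonoid σ.1) (1 : K) : ChartRing K σ.1)
  exact Set.ext_iff.1 h x

instance isLocallyDirected_chartDiagram (K : Type u) [Field K] :
    (Δ.chartDiagram K ⋙ Scheme.forget).IsLocallyDirected where
  cond {i j k} fi fj xi xj h := by
    obtain ⟨a, ha, hi⟩ := Δ.isFace_of_le (leOfHom fi)
    obtain ⟨b, hb, hj⟩ := Δ.isFace_of_le (leOfHom fj)
    have hab : ∀ x, x ∈ i.1 ⊓ j.1 ↔ x ∈ k.1 ∧ toReal (a + b) ⬝ᵥ x = 0 := by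
      intro x
      have e : toReal (a + b) = toReal a + toReal b := by ext i; simp [toReal]
      rw [Submodule.mem_inf, hi, hj, e, add_dotProduct]
      constructor
      · rintro ⟨⟨h1, h2⟩, -, h3⟩
        exact ⟨h1, by rw [h2, h3, add_zero]⟩
      · rintro ⟨h1, h2⟩
        have := ha x h1
        have := hb x h1
        exact ⟨⟨h1, by linarith⟩, h1, by linarith⟩
    let l : Δ.Cone := ⟨i.1 ⊓ j.1, Δ.face_mem _ k.2 _ ⟨a + b, add_mem ha hb, hab⟩⟩
    let fli : l ⟶ i := homOfLE (inf_le_left : i.1 ⊓ j.1 ≤ i.1)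
    let flj : l ⟶ j := homOfLE (inf_le_right : i.1 ⊓ j.1 ≤ j.1)
    let F := Δ.chartDiagram K
    have h' : F.map fi xi = F.map fj xj := h
    have hmem : F.map fi xi ∈ Set.range (F.map (fli ≫ fi)) := by
      have hi' : F.map fi xi ∈ Set.range (F.map fi) := ⟨_, rfl⟩
      have hj' : F.map fi xi ∈ Set.range (F.map fj) := ⟨_, h'.symm⟩
      have hi'' := (Δ.mem_range_chartDiagram_map K fi ha hi _).1 hi'
      have hj'' := (Δ.mem_range_chartDiagram_map K fj hb hj _).1 hj'
      refine (Δ.mem_range_chartDiagram_map K (fli ≫ fi) (add_mem ha hb) hab _).2 ?_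
      have e : (AddMonoidAlgebra.single (⟨a + b, add_mem ha hb⟩ : chartMonoid k.1) (1 : K) :
          ChartRing K k.1) =
          AddMonoidAlgebra.single ⟨a, ha⟩ 1 * AddMonoidAlgebra.single ⟨b, hb⟩ 1 := by
        rw [AddMonoidAlgebra.single_mul_single]; simp
      rw [e, PrimeSpectrum.basicOpen_mul]
      exact ⟨hi'', hj''⟩
    obtain ⟨y, hy⟩ := hmem
    refine ⟨l, fli, flj, y, ?_, ?_⟩
    · apply (F.map fi).isOpenEmbedding.injective
      rw [← hy, F.map_comp]; rfl
    · apply (F.map fj).isOpenEmbedding.injective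
      rw [← h', ← hy, Subsingleton.elim (fli ≫ fi) (flj ≫ fj), F.map_comp]; rfl

/-- The toric variety `X(Δ)` over `K`: the gluing of the affine toric varieties `U_σ`, `σ ∈ Δ`,
along the open subschemes given by common faces. -/
noncomputable def toricVariety (K : Type u) [Field K] : Scheme.{u} :=
  Limits.colimit (Δ.chartDiagram K)

/-- The open chart `U_σ → X(Δ)`. -/
noncomputable def chartι (K : Type u) [Field K] (σ : Δ.Cone) :
    Spec (CommRingCat.of (ChartRing K σ.1)) ⟶ Δ.toricVariety K :=
  Limits.colimit.ι (Δ.chartDiagram K) σ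

/-! ### Torus-invariant divisors and their polytopes -/

/-- The primitive generators `v_1, …, v_r` of the edges (one-dimensional cones) of the fan. They are
in bijection with the torus-invariant prime divisors `D_1, …, D_r` of `X(Δ)`. -/
def rays : Set (Fin n → ℤ) :=
  {v | IsPrimitive v ∧ PointedCone.hull ℝ {toReal v} ∈ Δ.cones}

/-- The torus-invariant Weil divisors `D = ∑ a_i D_i`, with `a_i = D v_i`. -/
abbrev TDivisor : Type := Δ.rays → ℤ

end Fan

section Divisors

variable {Δ : Fan n}

attribute [local instance] MvPolynomial.gradedAlgebra

/-- The polytope `P_D = {u ∈ M_ℝ | ⟨u, v_i⟩ ≥ -a_i for all i}` of `D = ∑ a_i D_i`. -/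
def polytope (D : Δ.TDivisor) : Set (Fin n → ℝ) :=
  {u | ∀ v : Δ.rays, -(D v : ℝ) ≤ u ⬝ᵥ toReal v.1}

/-- The lattice points `u ∈ P_D ∩ M`; the characters `χ^u` form a basis of `Γ(X, 𝒪(D))`. -/
def latticePoints (D : Δ.TDivisor) : Set (Fin n → ℤ) :=
  {u | toReal u ∈ polytope D}

/-- `D = ∑ a_i D_i` is a Cartier divisor with local data `m`: on `U_σ` it is the principal divisor
of the character `χ^{-m σ}`, that is, `⟨m σ, v_i⟩ = -a_i` for all edges `v_i` of `σ`. -/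
def IsCartierData (D : Δ.TDivisor) (m : Δ.Cone → (Fin n → ℤ)) : Prop :=
  ∀ (σ : Δ.Cone) (v : Δ.rays), toReal v.1 ∈ σ.1 → m σ ⬝ᵥ v.1 = -D v

/-- On `U_σ` the sheaf `𝒪(D)` is generated by `χ^m`, `m = m σ`, and the global section `χ^u` is the
multiple of it by the regular function `χ^{u - m}`. This is the map
`K[Y_u : u ∈ P_D ∩ M] → K[S_σ]`, `Y_u ↦ χ^{u - m}`. -/
noncomputable def chartSections (K : Type u) [Field K] (D : Δ.TDivisor) (σ : Δ.Cone)
    (m : Fin n → ℤ) (hreg : ∀ u ∈ latticePoints D, u - m ∈ chartMonoid σ.1) :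
    MvPolynomial (latticePoints D) K →+* ChartRing K σ.1 :=
  (MvPolynomial.aeval (R := K) fun u : latticePoints D =>
    (AddMonoidAlgebra.single (⟨u.1 - m, hreg u.1 u.2⟩ : chartMonoid σ.1) (1 : K) :
      ChartRing K σ.1)).toRingHom

/-- The same map, with values in the ring of global functions of the scheme `U_σ`. -/
noncomputable def chartGlobalSections (K : Type u) [Field K] (D : Δ.TDivisor) (σ : Δ.Cone)
    (m : Fin n → ℤ) (hreg : ∀ u ∈ latticePoints D, u - m ∈ chartMonoid σ.1) :
    MvPolynomial (latticePoints D) K →+* Γ(Spec (CommRingCat.of (ChartRing K σ.1)), ⊤) :=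
  (Scheme.ΓSpecIso (CommRingCat.of (ChartRing K σ.1))).inv.hom.comp (chartSections K D σ m hreg)

/-- The projective space over `K` with homogeneous coordinates `Y_u`, `u ∈ P_D ∩ M`. -/
noncomputable abbrev projSpace (K : Type u) [Field K] (D : Δ.TDivisor) : Scheme.{u} :=
  Proj (MvPolynomial.homogeneousSubmodule (latticePoints D) K)

/-- `D` is a very ample torus-invariant Cartier divisor: it is Cartier, with local data `m`; its
global sections `χ^u`, `u ∈ P_D ∩ M`, have no common zero (`hbpf`); and the morphism
`φ_D : X(Δ) → ℙ^{r-1}`, `x ↦ (χ^{u_1}(x) : … : χ^{u_r}(x))`, which on the chart `U_σ` is given by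
the regular functions `χ^{u_i - m σ}`, is a closed immersion. The clause `hreg`, that these
functions are regular on `U_σ`, follows from the definition of `P_D`; it makes the chart maps
well-typed. -/
def IsVeryAmple (K : Type u) [Field K] (D : Δ.TDivisor) : Prop :=
  ∃ m : Δ.Cone → (Fin n → ℤ), IsCartierData D m ∧
  ∃ hreg : ∀ σ : Δ.Cone, ∀ u ∈ latticePoints D, u - m σ ∈ chartMonoid σ.1,
  ∃ hbpf : ∀ σ : Δ.Cone,
    (HomogeneousIdeal.irrelevant
      (MvPolynomial.homogeneousSubmodule (latticePoints D) K)).toIdeal.map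
        (chartGlobalSections K D σ (m σ) (hreg σ)) = ⊤,
  ∃ φ : Δ.toricVariety K ⟶ projSpace K D,
    (∀ σ : Δ.Cone, Δ.chartι K σ ≫ φ =
      Proj.fromOfGlobalSections (MvPolynomial.homogeneousSubmodule (latticePoints D) K)
        (chartGlobalSections K D σ (m σ) (hreg σ)) (hbpf σ)) ∧
    IsClosedImmersion φ

/-! ### The homogeneous coordinate ring -/

/-- The submonoid `S ⊆ M × ℤ` generated by the `(u, 1)`, `u ∈ P_D ∩ M`. -/
def coordMonoid (D : Δ.TDivisor) : AddSubmonoid ((Fin n → ℤ) × ℤ) :=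
  AddSubmonoid.closure ((fun u => (u, (1 : ℤ))) '' latticePoints D)

/-- The homogeneous coordinate ring `K[S] = K[χ^(u_1, 1), …, χ^(u_r, 1)]` of `X` in the embedding
by `D`. It is graded by the last coordinate of `M × ℤ` and has dimension `n + 1`. -/
abbrev CoordRing (K : Type u) [Field K] (D : Δ.TDivisor) : Type u :=
  AddMonoidAlgebra K (coordMonoid D)

/-- The graded maximal ideal of the homogeneous coordinate ring, spanned by the monomials of
positive degree. -/
noncomputable def maxIdeal (K : Type u) [Field K] (D : Δ.TDivisor) : Ideal (CoordRing K D) :=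
  Ideal.span {f | ∃ s : coordMonoid D, 0 < s.1.2 ∧ f = AddMonoidAlgebra.single s (1 : K)}

/-- `e_HK(X, D)`: the Hilbert-Kunz multiplicity of the homogeneous coordinate ring, of dimension
`n + 1`, with respect to its graded maximal ideal. -/
noncomputable def eHK (K : Type u) [Field K] (p : ℕ) (D : Δ.TDivisor) : ℝ :=
  hkMultiplicity p (n + 1) (maxIdeal K D)

/-- `e_0(X, D)`: the Hilbert-Samuel multiplicity of the homogeneous coordinate ring, of dimension
`n + 1`, with respect to its graded maximal ideal. -/
noncomputable def e0 (K : Type u) [Field K] (D : Δ.TDivisor) : ℝ :=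
  hsMultiplicity (n + 1) (maxIdeal K D)

end Divisors

/-! ### Tilings -/

/-- A convex set `P ⊆ ℝⁿ` tiles the space by lattice translates: for some `t > 0` the translates
`v + tP`, `v ∈ ℤⁿ`, cover `ℝⁿ`, and any two of them meet in a set whose affine hull has dimension
less than `n`. -/
def TilesSpace (P : Set (Fin n → ℝ)) : Prop :=
  ∃ t : ℝ, 0 < t ∧
    (⋃ v : Fin n → ℤ, (fun x => toReal v + t • x) '' P) = Set.univ ∧
    ∀ v w : Fin n → ℤ, v ≠ w →
      Module.finrank ℝ (vectorSpan ℝ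
        (((fun x => toReal v + t • x) '' P) ∩ ((fun x => toReal w + t • x) '' P))) < n

end ToricPair

open ToricPair

/-!
Let `n = d - 1`, `P = P_D` and `V = vol(P)`. Everything is reduced to volumes of regions attached to
the convex body `P`, and the inequality is the trivial bound `vol(sP) = sⁿ V` for the part of a
fundamental domain of `ℤⁿ` that the lattice translates of `sP` can cover.

*From the geometry to `P`.* Since `X` is complete and the sections `χ^u` have no common zero, every
linear form attains its minimum over `P` at a lattice point (`IsVeryAmple.exists_latticePoint_le`),
so `P` is the convex hull of its lattice points (`IsVeryAmple.polytope_eq_convexHull`). Since the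
morphism to projective space is a monomorphism on a full-dimensional chart, the differences of these
lattice points generate `ℤⁿ` (`IsVeryAmple.exists_closure_sub_eq_top`): if they generated only `L`,
two distinct points of the chart with values in `K[ℤⁿ / L]` would have the same image.

*From lengths to volumes.* The powers and the Frobenius powers of the graded maximal ideal are
spanned by monomials, so the lengths count lattice points (`length_quotient_maxIdeal_pow`,
`length_quotient_frobeniusPower`). As the monoid generated by the `(u, 1)`, `u ∈ kP ∩ ℤⁿ`, contains
a translate of the saturated monoid of the cone `C` over `kP` (`exists_conductor`), the counts are
asymptotic to volumes: `e_0(kD) / d!` is the volume of the part of `C` below height one, and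
`e_HK(kD)` that of the complement in `C` of all translates `(u, 1) + C`. So, after rescaling the last
coordinate, `e_HK(kD) - e_0(kD) / d!` is `1 / k` times the volume of the set of `(y, s)`, `s ≥ 0`,
with `y` in `(k + s)P` but in no `u + sP`, `u ∈ kP ∩ ℤⁿ` (`volume_coneOver_compl`).

*The limit in `k`.* Write `y = ⌊kx⌋ + z` with `z` in the unit cube. If `x` is interior to `P`, then
for large `k` the point `y` lies in `(k + s)P`, and the lattice points of `kP` near `y` are all the
lattice points near `y`; if `x` is outside `P`, so is `y / (k + s)`. Hence the volume, divided by
`kⁿ`, tends to `V · vol(G)`, where `G` is the set of `(z, s)` with `z` in the unit cube but not in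
`ℤⁿ + sP` (`tendsto_volume_excessRegion`). So `A(X, D) = V · vol(G)`, while `e_0(X, D) = n! V`.

*The bound.* The slice of `G` at height `s` has volume at least `1 - sⁿ V`, which is positive for
`s < l = V^(-1/n)`, so that `vol(G) ≥ ∫_0^l (1 - sⁿ V) ds = l n / (n + 1)`. Equality means that for
almost all `s < l` the lattice translates of `sP` do not overlap; then those of `lP` do not overlap
either and, having volume one, they tile (`le_volume_uncoveredRegion`). Substituting `A(X, D)` and
`e_0(X, D)`, all powers of `V` cancel.
-/

namespace ToricPair

variable {n : ℕ} {Δ : Fan n}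

/-! ### Morphisms to projective space -/

/-- Two points of `X` at which all the sections in `A` take the same values have the same image under
the morphism to `Proj A` that the sections define, if some homogeneous section is invertible: the
morphism then factors through one basic open subscheme, where it is given by a ring homomorphism. -/
theorem comp_fromOfGlobalSections_eq {σ A : Type u} [CommRing A] [SetLike σ A]
    [AddSubgroupClass σ A] (𝒜 : ℕ → σ) [GradedRing 𝒜] {X Y : Scheme.{u}} (f : A →+* Γ(X, ⊤))
    (hf : (HomogeneousIdeal.irrelevant 𝒜).toIdeal.map f = ⊤) {r : A} {d : ℕ} (hd : 0 < d)
    (hr : r ∈ 𝒜 d) (hu : IsUnit (f r)) (g₁ g₂ : Y ⟶ X)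
    (h : g₁.appTop.hom.comp f = g₂.appTop.hom.comp f) :
    g₁ ≫ Proj.fromOfGlobalSections 𝒜 f hf = g₂ ≫ Proj.fromOfGlobalSections 𝒜 f hf := by
  have hU : X.basicOpen (f r) = ⊤ := Scheme.basicOpen_of_isUnit X hu
  have hiso : IsIso (X.basicOpen (f r)).ι := by
    rw [hU]; exact inferInstanceAs (IsIso X.topIso.hom)
  have hcov : (X.basicOpen (f r)).ι ≫ Proj.fromOfGlobalSections 𝒜 f hf =
      Proj.toBasicOpenOfGlobalSections 𝒜 f rfl hd hr ≫ Scheme.Opens.ι _ :=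
    (Proj.openCoverOfMapIrrelevantEqTop 𝒜 f hf).ι_glueMorphisms _ _ ⟨d, r, hd, hr⟩
  obtain ⟨k₁, rfl⟩ : ∃ k, g₁ = k ≫ (X.basicOpen (f r)).ι :=
    ⟨g₁ ≫ inv (X.basicOpen (f r)).ι, by simp⟩
  obtain ⟨k₂, rfl⟩ : ∃ k, g₂ = k ≫ (X.basicOpen (f r)).ι :=
    ⟨g₂ ≫ inv (X.basicOpen (f r)).ι, by simp⟩
  rw [Category.assoc, Category.assoc, hcov, ← Category.assoc, ← Category.assoc]
  congr 1
  unfold Proj.toBasicOpenOfGlobalSections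
  simp only [← Category.assoc]
  congr 1
  simp only [CommRingCat.ofHom_comp, Spec.map_comp]
  simp only [← Category.assoc]
  congr 1
  have hmono : Mono (Spec.map (CommRingCat.ofHom (algebraMap A (Localization.Away r)))) := by
    infer_instance
  rw [← cancel_mono (Spec.map (CommRingCat.ofHom (algebraMap A (Localization.Away r))))]
  simp only [Category.assoc, ← Spec.map_comp, ← CommRingCat.ofHom_comp]
  have e1 : (IsLocalization.map (M := .powers r) (T := .powers (f r)) (Localization.Away (f r)) f
      (by rw [← Submonoid.map_le_iff_le_comap, Submonoid.map_powers]) :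
        Localization.Away r →+* Localization.Away (f r)).comp
      (algebraMap A (Localization.Away r)) = (algebraMap _ _).comp f := by
    ext; simp
  rw [e1]
  simp only [CommRingCat.ofHom_comp, Spec.map_comp, basicOpenIsoSpecAway_hom_SpecMap_assoc]
  have h' : ((k₁ ≫ (X.basicOpen (f r)).ι) ≫ X.toSpecΓ) ≫ Spec.map (CommRingCat.ofHom f) =
      ((k₂ ≫ (X.basicOpen (f r)).ι) ≫ X.toSpecΓ) ≫ Spec.map (CommRingCat.ofHom f) := by
    rw [Scheme.toSpecΓ_naturality, Scheme.toSpecΓ_naturality, Category.assoc, Category.assoc,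
      ← Spec.map_comp, ← Spec.map_comp]
    congr 2
    ext1
    exact h
  have hres : ∀ (U : (Spec Γ(X, ⊤)).Opens) (V : X.Opens) (hV : V ≤ X.toSpecΓ ⁻¹ᵁ U) {Z : Scheme.{u}}
      (w : Spec Γ(X, ⊤) ⟶ Z), X.homOfLE hV ≫ X.toSpecΓ ∣_ U ≫ U.ι ≫ w = V.ι ≫ X.toSpecΓ ≫ w := by
    intro U V hV Z w
    rw [morphismRestrict_ι_assoc, Scheme.homOfLE_ι_assoc]
  have h'' : k₁ ≫ (X.basicOpen (f r)).ι ≫ X.toSpecΓ ≫ Spec.map (CommRingCat.ofHom f) =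
      k₂ ≫ (X.basicOpen (f r)).ι ≫ X.toSpecΓ ≫ Spec.map (CommRingCat.ofHom f) := by
    simpa only [Category.assoc] using h'
  rw [← hres (PrimeSpectrum.basicOpen (f r)) _ (Scheme.toSpecΓ_preimage_basicOpen X (f r)).ge] at h''
  simpa [Scheme.isoOfEq_inv] using h''

section ProjectiveEmbedding

attribute [local instance] MvPolynomial.gradedAlgebra

/-- If the map to projective space given by the sections `χ^u` is a monomorphism on `U_σ`, then the
differences `u - m`, where `χ^m` generates `𝒪(D)` on `U_σ`, generate the whole character lattice. -/
theorem closure_sub_eq_top_of_mono (K : Type u) [Field K] (D : Δ.TDivisor) (σ : Δ.Cone)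
    {m : Fin n → ℤ} (hm : m ∈ latticePoints D)
    (hreg : ∀ u ∈ latticePoints D, u - m ∈ chartMonoid σ.1)
    (hbpf : (HomogeneousIdeal.irrelevant
      (MvPolynomial.homogeneousSubmodule (latticePoints D) K)).toIdeal.map
        (chartGlobalSections K D σ m hreg) = ⊤)
    (hmono : Mono (Proj.fromOfGlobalSections
      (MvPolynomial.homogeneousSubmodule (latticePoints D) K)
        (chartGlobalSections K D σ m hreg) hbpf))
    {m₀ : Fin n → ℤ} (hm₀ : m₀ ∈ chartMonoid σ.1)
    (hm₀' : ∀ x ∈ σ.1, toReal m₀ ⬝ᵥ x = 0 → x = 0) :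
    AddSubgroup.closure ((fun u => u - m) '' latticePoints D) = ⊤ := by
  set L := AddSubgroup.closure ((fun u => u - m) '' latticePoints D) with hL
  -- The characters `χ^w ↦ χ^[w]` and `χ^w ↦ 1` of `K[S_σ]` with values in `K[M/L]` have the same
  -- composite with the map to projective space.
  let a : ChartRing K σ.1 →+* AddMonoidAlgebra K ((Fin n → ℤ) ⧸ L) :=
    AddMonoidAlgebra.mapDomainRingHom K ((QuotientAddGroup.mk' L).comp (chartMonoid σ.1).subtype)
  let b : ChartRing K σ.1 →+* AddMonoidAlgebra K ((Fin n → ℤ) ⧸ L) :=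
    AddMonoidAlgebra.mapDomainRingHom K (0 : chartMonoid σ.1 →+ (Fin n → ℤ) ⧸ L)
  have hab : a.comp (chartSections K D σ m hreg) = b.comp (chartSections K D σ m hreg) := by
    apply MvPolynomial.ringHom_ext
    · intro c
      simp [a, b, chartSections, AddMonoidAlgebra.coe_algebraMap]
    · intro u
      have : (QuotientAddGroup.mk (u.1 - m) : (Fin n → ℤ) ⧸ L) = 0 :=
        (QuotientAddGroup.eq_zero_iff _).2 (AddSubgroup.subset_closure ⟨u.1, u.2, rfl⟩)
      simp [a, b, chartSections, -QuotientAddGroup.mk_sub, this]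
  have hone : chartSections K D σ m hreg (MvPolynomial.X ⟨m, hm⟩) = 1 := by
    simp only [chartSections, AlgHom.toRingHom_eq_coe, RingHom.coe_coe, MvPolynomial.aeval_X,
      sub_self, AddMonoidAlgebra.one_def]
    rfl
  have key : Spec.map (CommRingCat.ofHom a) = Spec.map (CommRingCat.ofHom b) := by
    rw [← cancel_mono (Proj.fromOfGlobalSections
      (MvPolynomial.homogeneousSubmodule (latticePoints D) K)
        (chartGlobalSections K D σ m hreg) hbpf)]
    refine comp_fromOfGlobalSections_eq _ _ hbpf one_pos
      (MvPolynomial.isHomogeneous_X K ⟨m, hm⟩) ?_ _ _ ?_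
    · rw [chartGlobalSections, RingHom.comp_apply, hone, map_one]
      exact isUnit_one
    · have nat (g : ChartRing K σ.1 →+* AddMonoidAlgebra K ((Fin n → ℤ) ⧸ L)) :
          (Spec.map (CommRingCat.ofHom g)).appTop.hom.comp (chartGlobalSections K D σ m hreg) =
          (Scheme.ΓSpecIso (CommRingCat.of _)).inv.hom.comp
            (g.comp (chartSections K D σ m hreg)) := by
        have h := congrArg CommRingCat.Hom.hom
          (Scheme.ΓSpecIso_inv_naturality (CommRingCat.ofHom g))
        simp only [CommRingCat.hom_comp, CommRingCat.hom_ofHom] at h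
        rw [chartGlobalSections, ← RingHom.comp_assoc, ← h, RingHom.comp_assoc]
      rw [nat, nat, hab]
  have hab' : a = b := by
    have := Spec.map_injective key
    simpa using congrArg CommRingCat.Hom.hom this
  have hle : ∀ w ∈ chartMonoid σ.1, w ∈ L := by
    intro w hw
    have h := congrArg (fun g => g (AddMonoidAlgebra.single (⟨w, hw⟩ : chartMonoid σ.1) (1 : K)))
      hab'
    simp only [a, b, AddMonoidAlgebra.mapDomainRingHom_apply, AddMonoidAlgebra.mapDomain_single] at h
    have h' := AddMonoidAlgebra.single_left_injective (one_ne_zero (α := K)) h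
    exact (QuotientAddGroup.eq_zero_iff _).1 h'
  rw [eq_top_iff]
  intro w _
  -- `m₀` is interior to the dual cone, so `w + k m₀` lies in `S_σ` for large `k`
  obtain ⟨k, hk⟩ := exists_shift_mem (τ := ⊥) (w := w) (Δ.rational _ σ.2) hm₀
    (fun x => ⟨fun hx => by
      rw [Submodule.mem_bot] at hx
      subst hx
      exact ⟨zero_mem _, by simp⟩, fun hx => by
      rw [Submodule.mem_bot]; exact hm₀' x hx.1 hx.2⟩)
    (fun x hx => by rw [Submodule.mem_bot] at hx; simp [hx])
  have h := L.sub_mem (hle _ (hk k le_rfl)) (L.nsmul_mem (hle _ hm₀) k)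
  simpa using h

end ProjectiveEmbedding

/-! ### Rational cones and their edges -/

theorem toReal_dotProduct (a b : Fin n → ℤ) : toReal a ⬝ᵥ toReal b = ((a ⬝ᵥ b : ℤ) : ℝ) := by
  simp [toReal, dotProduct]

theorem toReal_injective : Function.Injective (toReal : (Fin n → ℤ) → Fin n → ℝ) := by
  intro a b h
  ext i
  have := congrFun h i
  simpa [toReal] using this

@[simp] theorem toReal_zero : toReal (0 : Fin n → ℤ) = 0 := by ext; simp [toReal]

theorem toReal_add (a b : Fin n → ℤ) : toReal (a + b) = toReal a + toReal b := by
  ext; simp [toReal]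

theorem toReal_sub (a b : Fin n → ℤ) : toReal (a - b) = toReal a - toReal b := by
  ext; simp [toReal]

theorem toReal_smul (k : ℤ) (a : Fin n → ℤ) : toReal (k • a) = (k : ℝ) • toReal a := by
  ext; simp [toReal]

theorem toReal_nsmul (k : ℕ) (a : Fin n → ℤ) : toReal (k • a) = (k : ℝ) • toReal a := by
  ext; simp [toReal]

theorem tendsto_floor_mul_div (x : ℝ) :
    Tendsto (fun q : ℕ => (⌊(q : ℝ) * x⌋ : ℝ) / q) atTop (𝓝 x) := by
  have h : Tendsto (fun q : ℕ => x - Int.fract ((q : ℝ) * x) / q) atTop (𝓝 (x - 0)) := by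
    refine tendsto_const_nhds.sub ?_
    refine squeeze_zero (fun q => div_nonneg (Int.fract_nonneg _) (Nat.cast_nonneg _)) (fun q => ?_)
      tendsto_one_div_atTop_nhds_zero_nat
    gcongr
    exact (Int.fract_lt_one _).le
  rw [sub_zero] at h
  refine h.congr' ?_
  filter_upwards [eventually_gt_atTop 0] with q hq
  have hq' : (q : ℝ) ≠ 0 := by positivity
  rw [Int.fract]
  field_simp
  ring

/-- Componentwise integer part. -/
noncomputable def floorVec (x : Fin n → ℝ) : Fin n → ℤ := fun i => ⌊x i⌋

theorem tendsto_floorVec (x : Fin n → ℝ) :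
    Tendsto (fun q : ℕ => (q : ℝ)⁻¹ • toReal (floorVec ((q : ℝ) • x))) atTop (𝓝 x) := by
  rw [tendsto_pi_nhds]
  intro i
  refine (tendsto_floor_mul_div (x i)).congr fun q => ?_
  simp [toReal, floorVec, div_eq_inv_mul]

theorem mem_hull_image_finset {s : Finset (Fin n → ℤ)} {x : Fin n → ℝ} :
    x ∈ PointedCone.hull ℝ (toReal '' (s : Set (Fin n → ℤ))) ↔
      ∃ c : (Fin n → ℤ) → ℝ, (∀ w, 0 ≤ c w) ∧ ∑ w ∈ s, c w • toReal w = x := by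
  rw [PointedCone.hull, Submodule.mem_span_image_finset_iff_exists_fun']
  constructor
  · rintro ⟨c, rfl⟩
    exact ⟨fun w => (c w : ℝ), fun w => (c w).2, rfl⟩
  · rintro ⟨c, hc, rfl⟩
    exact ⟨fun w => ⟨c w, hc w⟩, rfl⟩

theorem mem_chartMonoid_hull {s : Finset (Fin n → ℤ)} {m : Fin n → ℤ} :
    m ∈ chartMonoid (PointedCone.hull ℝ (toReal '' (s : Set (Fin n → ℤ)))) ↔
      ∀ w ∈ s, 0 ≤ m ⬝ᵥ w := by
  constructor
  · intro h w hw
    have := h (toReal w) (Submodule.subset_span ⟨w, hw, rfl⟩)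
    rw [toReal_dotProduct] at this
    exact_mod_cast this
  · intro h x hx
    obtain ⟨c, hc, rfl⟩ := mem_hull_image_finset.1 hx
    rw [dotProduct_sum]
    refine Finset.sum_nonneg fun w hw => ?_
    rw [dotProduct_smul, toReal_dotProduct]
    exact mul_nonneg (hc w) (by exact_mod_cast h w hw)

/-- A linear functional on `ℝⁿ` is the dot product with a vector. -/
theorem exists_dotProduct_eq (f : (Fin n → ℝ) →ₗ[ℝ] ℝ) :
    ∃ g : Fin n → ℝ, ∀ x, f x = g ⬝ᵥ x := by
  refine ⟨fun i => f (Pi.single i 1), fun x => ?_⟩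
  conv_lhs => rw [LinearMap.pi_apply_eq_sum_univ f x]
  simp only [dotProduct, smul_eq_mul]
  refine Finset.sum_congr rfl fun i _ => ?_
  rw [mul_comm]
  congr 2
  ext j
  simp [Pi.single_apply, eq_comm]

/-- An integral form of Gordan's alternative: if no nontrivial nonnegative combination of the
vectors in `s` is a multiple of `v`, then some integral linear form vanishes at `v` and is positive
on `s`. The real form given by separation is approximated by an integral one, which is then
projected to the orthogonal complement of `v`. -/
theorem exists_dotProduct_pos (s : Finset (Fin n → ℤ)) (v : Fin n → ℤ)
    (h : ∀ c : (Fin n → ℤ) → ℝ, (∀ w, 0 ≤ c w) → (∃ w ∈ s, 0 < c w) → ∀ r : ℝ,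
      ∑ w ∈ s, c w • toReal w ≠ r • toReal v) :
    ∃ m : Fin n → ℤ, m ⬝ᵥ v = 0 ∧ ∀ w ∈ s, 0 < m ⬝ᵥ w := by
  classical
  obtain ⟨f, hfv, hf⟩ : ∃ f : Fin n → ℝ, f ⬝ᵥ toReal v = 0 ∧ ∀ w ∈ s, 0 < f ⬝ᵥ toReal w := by
    have hcomp : IsCompact (convexHull ℝ (toReal '' (s : Set (Fin n → ℤ)))) :=
      (s.finite_toSet.image _).isCompact_convexHull (𝕜 := ℝ)
    have hclosed : IsClosed ((ℝ ∙ toReal v : Submodule ℝ (Fin n → ℝ)) : Set (Fin n → ℝ)) :=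
      Submodule.closed_of_finiteDimensional _
    have hdisj : Disjoint (convexHull ℝ (toReal '' (s : Set (Fin n → ℤ))))
        ((ℝ ∙ toReal v : Submodule ℝ (Fin n → ℝ)) : Set (Fin n → ℝ)) := by
      rw [Set.disjoint_left]
      intro x hx hx'
      obtain ⟨r, rfl⟩ := Submodule.mem_span_singleton.1 hx'
      rw [← Finset.coe_image, Finset.mem_convexHull'] at hx
      obtain ⟨c, hc, hc1, hx⟩ := hx
      rw [Finset.sum_image (toReal_injective.injOn)] at hc1 hx
      obtain ⟨w, hw, hw0⟩ : ∃ w ∈ s, 0 < c (toReal w) := by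
        by_contra! hcon
        have := Finset.sum_nonpos hcon
        linarith
      refine h (fun w => |c (toReal w)|) (fun _ => abs_nonneg _) ⟨w, hw, abs_pos.2 hw0.ne'⟩ r ?_
      rw [← hx]
      refine Finset.sum_congr rfl fun w hw => ?_
      rw [abs_of_nonneg (hc _ (Finset.mem_image_of_mem _ hw))]
    obtain ⟨f, a, b, hfa, hab, hfb⟩ := geometric_hahn_banach_compact_closed
      (convex_convexHull ℝ _) hcomp (Submodule.convex _) hclosed hdisj
    obtain ⟨g, hg⟩ := exists_dotProduct_eq f.toLinearMap
    have hg' : ∀ x, f x = g ⬝ᵥ x := hg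
    have hb0 : b < 0 := by simpa using hfb 0 (zero_mem _)
    have hv0 : f (toReal v) = 0 := by
      by_contra hne
      have := hfb ((b / f (toReal v)) • toReal v)
        (Submodule.smul_mem _ _ (Submodule.mem_span_singleton_self _))
      rw [map_smul, smul_eq_mul, div_mul_cancel₀ _ hne] at this
      exact lt_irrefl _ this
    refine ⟨-g, by rw [neg_dotProduct, ← hg', hv0, neg_zero], fun w hw => ?_⟩
    have := hfa (toReal w) (subset_convexHull ℝ _ ⟨w, hw, rfl⟩)
    rw [neg_dotProduct, ← hg']
    linarith
  -- `g ↦ c g - (g · v) v` maps to the complement of `v`, and is `g ↦ g` for `v = 0`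
  set c : ℤ := if v = 0 then 1 else v ⬝ᵥ v with hc
  have hc0 : 0 < c := by
    rw [hc]
    split_ifs with hv
    · exact one_pos
    · exact lt_of_le_of_ne (Finset.sum_nonneg fun i _ => mul_self_nonneg _)
        (fun h => hv (dotProduct_self_eq_zero.1 h.symm))
  have hcv : ∀ g : Fin n → ℤ, (c • g - (g ⬝ᵥ v) • v) ⬝ᵥ v = 0 := by
    intro g
    rw [hc]
    split_ifs with hv
    · simp [hv]
    · rw [sub_dotProduct, smul_dotProduct, smul_dotProduct]
      simp only [smul_eq_mul]
      ring
  have hlim : ∀ w ∈ s, ∀ᶠ q : ℕ in atTop,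
      0 < (c • floorVec ((q : ℝ) • f) - (floorVec ((q : ℝ) • f) ⬝ᵥ v) • v) ⬝ᵥ w := by
    intro w hw
    let F : (Fin n → ℝ) → ℝ := fun g => (c : ℝ) * (g ⬝ᵥ toReal w) -
      (g ⬝ᵥ toReal v) * (toReal v ⬝ᵥ toReal w)
    have hF : Continuous F := by fun_prop
    have hFf : 0 < F f := by
      simp only [F, hfv, zero_mul, sub_zero]
      exact mul_pos (by exact_mod_cast hc0) (hf w hw)
    have h1 := ((hF.tendsto f).comp (tendsto_floorVec f)).eventually (lt_mem_nhds hFf)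
    filter_upwards [h1, eventually_gt_atTop 0] with q h1 hq
    have hq' : (0 : ℝ) < (q : ℝ)⁻¹ := by positivity
    have h2 : F ((q : ℝ)⁻¹ • toReal (floorVec ((q : ℝ) • f))) = (q : ℝ)⁻¹ *
        (((c • floorVec ((q : ℝ) • f) - (floorVec ((q : ℝ) • f) ⬝ᵥ v) • v) ⬝ᵥ w : ℤ) : ℝ) := by
      simp only [F, smul_dotProduct, sub_dotProduct, toReal_dotProduct, smul_eq_mul]
      push_cast
      ring
    have h1' : 0 < F ((q : ℝ)⁻¹ • toReal (floorVec ((q : ℝ) • f))) := h1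
    rw [h2] at h1'
    exact_mod_cast (mul_pos_iff_of_pos_left hq').1 h1'
  obtain ⟨q, hq⟩ := ((Finset.eventually_all s).2 hlim).exists
  exact ⟨_, hcv _, hq⟩

/-- A nonzero lattice vector is a positive multiple of a primitive one. -/
theorem exists_isPrimitive {v : Fin n → ℤ} (hv : v ≠ 0) :
    ∃ g : ℤ, 0 < g ∧ ∃ w, IsPrimitive w ∧ v = g • w := by
  classical
  obtain ⟨i, hi⟩ := Function.ne_iff.1 hv
  obtain ⟨w, hw, hw1⟩ := Finset.extract_gcd v (s := Finset.univ) ⟨i, Finset.mem_univ i⟩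
  refine ⟨Finset.univ.gcd v, ?_, w, ?_, ?_⟩
  · refine lt_of_le_of_ne (Int.nonneg_of_normalize_eq_self Finset.normalize_gcd) ?_
    intro h
    exact hi (by simpa using (Finset.gcd_eq_zero_iff.1 h.symm) i (Finset.mem_univ i))
  · intro a u hu
    rw [isUnit_iff_dvd_one, ← hw1]
    exact Finset.dvd_gcd fun j _ => ⟨u j, by rw [hu]; simp⟩
  · ext j
    simpa using hw j (Finset.mem_univ j)

/-- A strongly convex rational cone is generated by finitely many nonzero lattice vectors each of
which spans a face: an irredundant set of generators has this property. -/
theorem exists_generators_isFace {σ : PointedCone ℝ (Fin n → ℝ)} (hσ : IsRational σ)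
    (hs : (σ : ConvexCone ℝ (Fin n → ℝ)).Salient) :
    ∃ s : Finset (Fin n → ℤ), σ = PointedCone.hull ℝ (toReal '' (s : Set (Fin n → ℤ))) ∧
      (∀ v ∈ s, v ≠ 0) ∧ ∀ v ∈ s, IsFace (PointedCone.hull ℝ {toReal v}) σ := by
  classical
  have hex : ∃ k : ℕ, ∃ s : Finset (Fin n → ℤ), s.card = k ∧
      σ = PointedCone.hull ℝ (toReal '' (s : Set (Fin n → ℤ))) := by
    obtain ⟨s, hs⟩ := hσ
    exact ⟨_, s, rfl, hs⟩
  obtain ⟨s, hcard, hgen⟩ := Nat.find_spec hex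
  -- no generator lies in the cone generated by the others
  have hirr : ∀ v ∈ s, toReal v ∉
      PointedCone.hull ℝ (toReal '' ((s.erase v : Finset _) : Set (Fin n → ℤ))) := by
    intro v hv hmem
    refine Nat.find_min hex (m := (s.erase v).card) ?_ ⟨s.erase v, rfl, ?_⟩
    · rw [← hcard]; exact Finset.card_erase_lt_of_mem hv
    · rw [hgen]
      apply le_antisymm
      · refine Submodule.span_le.2 ?_
        rintro _ ⟨w, hw, rfl⟩
        by_cases hwv : w = v
        · rw [hwv]; exact hmem
        · exact Submodule.subset_span ⟨w, by simpa [hwv] using hw, rfl⟩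
      · exact Submodule.span_mono (Set.image_mono (by simp))
  have hne : ∀ v ∈ s, v ≠ 0 := by
    rintro v hv rfl
    exact hirr 0 hv (by rw [toReal_zero]; exact zero_mem _)
  have hmem : ∀ v ∈ s, toReal v ∈ σ := fun v hv => by
    rw [hgen]; exact Submodule.subset_span ⟨v, hv, rfl⟩
  have hsmul : ∀ (c : ℝ), 0 ≤ c → ∀ x ∈ σ, c • x ∈ σ := fun c hc x hx =>
    σ.smul_mem hc hx
  refine ⟨s, hgen, hne, fun v hv => ?_⟩
  obtain ⟨m, hmv, hm⟩ := exists_dotProduct_pos (s.erase v) v (by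
    rintro c hc ⟨w, hw, hcw⟩ r heq
    rcases lt_or_ge 0 r with hr | hr
    · apply hirr v hv
      refine mem_hull_image_finset.2 ⟨fun w => r⁻¹ * c w, fun w => by have := hc w; positivity, ?_⟩
      simp_rw [mul_smul]
      rw [← Finset.smul_sum, heq, smul_smul, inv_mul_cancel₀ hr.ne', one_smul]
    · have hw' := Finset.mem_of_mem_erase hw
      refine hs (c w • toReal w) (hsmul _ hcw.le _ (hmem w hw')) ?_ ?_
      · rw [Ne, smul_eq_zero, not_or]
        exact ⟨hcw.ne', fun h => hne w hw' (toReal_injective (by rw [h, toReal_zero]))⟩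
      · have : -(c w • toReal w) =
            ∑ u ∈ (s.erase v).erase w, c u • toReal u + (-r) • toReal v := by
          rw [← Finset.add_sum_erase _ _ hw] at heq
          rw [neg_smul, ← heq]
          abel
        rw [this]
        refine σ.add_mem (σ.sum_mem fun u hu => hsmul _ (hc u) _ (hmem u ?_))
          (hsmul _ (by linarith) _ (hmem v hv))
        exact Finset.mem_of_mem_erase (Finset.mem_of_mem_erase hu))
  have hnonneg : ∀ w ∈ s, 0 ≤ m ⬝ᵥ w := fun w hw => by
    by_cases h : w = v
    · rw [h, hmv]
    · exact (hm w (Finset.mem_erase.2 ⟨h, hw⟩)).le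
  refine ⟨m, by rw [hgen]; exact mem_chartMonoid_hull.2 hnonneg, fun x => ⟨fun hx => ?_, ?_⟩⟩
  · obtain ⟨c, rfl⟩ := Submodule.mem_span_singleton.1 hx
    refine ⟨σ.smul_mem c.2 (hmem v hv), ?_⟩
    have : c • toReal v = (c : ℝ) • toReal v := rfl
    rw [this, dotProduct_smul, toReal_dotProduct, hmv]
    simp
  · rintro ⟨hx, hx0⟩
    rw [hgen] at hx
    obtain ⟨c, hc, rfl⟩ := mem_hull_image_finset.1 hx
    rw [dotProduct_sum, Finset.sum_eq_zero_iff_of_nonneg] at hx0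
    · refine Submodule.sum_mem _ fun w hw => ?_
      by_cases h : w = v
      · subst h
        exact Submodule.smul_mem _ (⟨c w, hc w⟩ : {c : ℝ // 0 ≤ c})
          (Submodule.subset_span rfl)
      · have h1 := hx0 w hw
        have h2 := hm w (Finset.mem_erase.2 ⟨h, hw⟩)
        rw [dotProduct_smul, toReal_dotProduct, smul_eq_mul, mul_eq_zero] at h1
        rcases h1 with h1 | h1
        · simp [h1]
        · exact absurd h1 (by exact_mod_cast h2.ne')
    · intro w hw
      rw [dotProduct_smul, toReal_dotProduct, smul_eq_mul]
      exact mul_nonneg (hc w) (by exact_mod_cast hnonneg w hw)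

/-- The cones of a fan are generated by the rays of the fan that they contain. -/
theorem Fan.exists_rays_generate (Δ : Fan n) (σ : Δ.Cone) :
    ∃ s : Finset (Fin n → ℤ), (∀ v ∈ s, v ∈ Δ.rays) ∧
      σ.1 = PointedCone.hull ℝ (toReal '' (s : Set (Fin n → ℤ))) := by
  classical
  obtain ⟨s, hgen, hne, hface⟩ :=
    exists_generators_isFace (Δ.rational _ σ.2) (Δ.salient _ σ.2)
  have hp : ∀ v : s, ∃ w, IsPrimitive w ∧ ∃ g : ℤ, 0 < g ∧ v.1 = g • w := fun v => by
    obtain ⟨g, hg, w, hw, h⟩ := exists_isPrimitive (hne v.1 v.2)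
    exact ⟨w, hw, g, hg, h⟩
  choose w hw g hg hgw using hp
  have hsub : ∀ v : s, toReal v.1 ∈ PointedCone.hull ℝ {toReal (w v)} := fun v => by
    have h := hgw v
    have e : toReal v.1 = (⟨(g v : ℝ), by exact_mod_cast (hg v).le⟩ : {c : ℝ // 0 ≤ c}) •
        toReal (w v) := by
      rw [congrArg toReal h, toReal_smul]; rfl
    rw [e]
    exact Submodule.smul_mem _ _ (Submodule.subset_span rfl)
  have hsub' : ∀ v : s, toReal (w v) ∈ PointedCone.hull ℝ {toReal v.1} := fun v => by
    have h := hgw v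
    have hg0 : (0 : ℝ) < g v := by exact_mod_cast hg v
    have e : toReal (w v) = (⟨(g v : ℝ)⁻¹, by positivity⟩ : {c : ℝ // 0 ≤ c}) •
        toReal v.1 := by
      rw [congrArg toReal h, toReal_smul]
      change _ = (g v : ℝ)⁻¹ • ((g v : ℝ) • toReal (w v))
      rw [smul_smul, inv_mul_cancel₀ hg0.ne', one_smul]
    rw [e]
    exact Submodule.smul_mem _ _ (Submodule.subset_span rfl)
  refine ⟨Finset.univ.image w, ?_, ?_⟩
  · intro u hu
    obtain ⟨v, -, rfl⟩ := Finset.mem_image.1 hu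
    refine ⟨hw v, ?_⟩
    have e : PointedCone.hull ℝ {toReal (w v)} = PointedCone.hull ℝ {toReal v.1} :=
      le_antisymm (Submodule.span_le.2 (Set.singleton_subset_iff.2 (hsub' v)))
        (Submodule.span_le.2 (Set.singleton_subset_iff.2 (hsub v)))
    rw [e]
    exact Δ.face_mem _ σ.2 _ (hface v.1 v.2)
  · rw [hgen]
    apply le_antisymm
    · refine Submodule.span_le.2 ?_
      rintro _ ⟨v, hv, rfl⟩
      refine Submodule.span_mono ?_ (hsub ⟨v, hv⟩)
      rw [Set.singleton_subset_iff]
      exact ⟨_, by simp, rfl⟩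
    · refine Submodule.span_le.2 ?_
      rintro _ ⟨u, hu, rfl⟩
      obtain ⟨v, -, rfl⟩ := Finset.mem_image.1 (Finset.mem_coe.1 hu)
      refine Submodule.span_mono ?_ (hsub' v)
      rw [Set.singleton_subset_iff]
      exact ⟨_, v.2, rfl⟩

/-- The origin is a face of a strongly convex rational cone. -/
theorem exists_supporting_zero {σ : PointedCone ℝ (Fin n → ℝ)} (hσ : IsRational σ)
    (hs : (σ : ConvexCone ℝ (Fin n → ℝ)).Salient) :
    ∃ m ∈ chartMonoid σ, ∀ x ∈ σ, toReal m ⬝ᵥ x = 0 → x = 0 := by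
  classical
  obtain ⟨s, hgen, hne, -⟩ := exists_generators_isFace hσ hs
  have hmem : ∀ v ∈ s, toReal v ∈ σ := fun v hv => by
    rw [hgen]; exact Submodule.subset_span ⟨v, hv, rfl⟩
  have hsmul : ∀ (c : ℝ), 0 ≤ c → ∀ x ∈ σ, c • x ∈ σ := fun c hc x hx =>
    σ.smul_mem hc hx
  obtain ⟨m, -, hm⟩ := exists_dotProduct_pos s 0 (by
    rintro c hc ⟨w, hw, hcw⟩ r heq
    rw [toReal_zero, smul_zero] at heq
    refine hs (c w • toReal w) (hsmul _ hcw.le _ (hmem w hw)) ?_ ?_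
    · rw [Ne, smul_eq_zero, not_or]
      exact ⟨hcw.ne', fun h => hne w hw (toReal_injective (by rw [h, toReal_zero]))⟩
    · have : -(c w • toReal w) = ∑ u ∈ s.erase w, c u • toReal u := by
        rw [← Finset.add_sum_erase _ _ hw] at heq
        exact neg_eq_of_add_eq_zero_right heq
      rw [this]
      exact σ.sum_mem fun u hu => hsmul _ (hc u) _ (hmem u (Finset.mem_of_mem_erase hu)))
  refine ⟨m, by rw [hgen]; exact mem_chartMonoid_hull.2 fun w hw => (hm w hw).le, fun x hx h0 => ?_⟩
  rw [hgen] at hx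
  obtain ⟨c, hc, rfl⟩ := mem_hull_image_finset.1 hx
  rw [dotProduct_sum, Finset.sum_eq_zero_iff_of_nonneg] at h0
  · refine Finset.sum_eq_zero fun w hw => ?_
    have h1 := h0 w hw
    have h2 : (0 : ℝ) < ((m ⬝ᵥ w : ℤ) : ℝ) := by exact_mod_cast hm w hw
    rw [dotProduct_smul, toReal_dotProduct, smul_eq_mul, mul_eq_zero] at h1
    rw [h1.resolve_right h2.ne', zero_smul]
  · intro w hw
    rw [dotProduct_smul, toReal_dotProduct, smul_eq_mul]
    exact mul_nonneg (hc w) (by exact_mod_cast (hm w hw).le)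

section VeryAmple

attribute [local instance] MvPolynomial.gradedAlgebra

/-! ### The polytope of a very ample divisor -/

theorem polytope_nsmul (D : Δ.TDivisor) {k : ℕ} (hk : 0 < k) :
    polytope (k • D) = (fun x => (k : ℝ) • x) '' polytope D := by
  have hk' : (0 : ℝ) < k := by exact_mod_cast hk
  ext y
  constructor
  · intro hy
    refine ⟨(k : ℝ)⁻¹ • y, fun v => ?_, by simp [smul_smul, hk'.ne']⟩
    have h := hy v
    rw [smul_dotProduct, smul_eq_mul, ← div_eq_inv_mul, le_div_iff₀ hk']
    have e : (((k • D) v : ℤ) : ℝ) = k * (D v : ℝ) := by simp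
    rw [e] at h
    linarith
  · rintro ⟨x, hx, rfl⟩ v
    have h := hx v
    have e : (((k • D) v : ℤ) : ℝ) = k * (D v : ℝ) := by simp
    rw [e, smul_dotProduct, smul_eq_mul]
    nlinarith

theorem convex_polytope (D : Δ.TDivisor) : Convex ℝ (polytope D) := by
  intro x hx y hy a b ha hb hab v
  have h1 := hx v
  have h2 := hy v
  rw [add_dotProduct, smul_dotProduct, smul_dotProduct, smul_eq_mul, smul_eq_mul]
  have h3 := mul_le_mul_of_nonneg_left h1 ha
  have h4 := mul_le_mul_of_nonneg_left h2 hb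
  calc -(D v : ℝ) = a * -(D v : ℝ) + b * -(D v : ℝ) := by rw [← add_mul, hab, one_mul]
    _ ≤ _ := add_le_add h3 h4

/-- If the sections `χ^u` have no common zero on `U_σ`, where `𝒪(D)` is generated by `χ^m`, then
one of them generates `𝒪(D)` on `U_σ`: otherwise all `χ^{u - m}` vanish under the ring homomorphism
to `K` that is `1` at the invertible monomials and `0` at the others. -/
theorem exists_sub_mem_chartMonoid (K : Type u) [Field K] (D : Δ.TDivisor) (σ : Δ.Cone)
    {m : Fin n → ℤ} (hreg : ∀ u ∈ latticePoints D, u - m ∈ chartMonoid σ.1)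
    (hbpf : (HomogeneousIdeal.irrelevant
      (MvPolynomial.homogeneousSubmodule (latticePoints D) K)).toIdeal.map
        (chartGlobalSections K D σ m hreg) = ⊤) :
    ∃ u ∈ latticePoints D, m - u ∈ chartMonoid σ.1 := by
  classical
  by_contra! hcon
  let g : Multiplicative (chartMonoid σ.1) →* K :=
    { toFun := fun w => if -(w.toAdd.1) ∈ chartMonoid σ.1 then 1 else 0
      map_one' := by
        rw [if_pos]
        simp
      map_mul' := fun w w' => by
        have e : -((w * w').toAdd.1) = -w.toAdd.1 + -w'.toAdd.1 := by
          simp [add_comm]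
        by_cases h : -(w.toAdd.1) ∈ chartMonoid σ.1
        · by_cases h' : -(w'.toAdd.1) ∈ chartMonoid σ.1
          · rw [if_pos h, if_pos h', if_pos (by rw [e]; exact add_mem h h'), mul_one]
          · rw [if_neg h', mul_zero, if_neg]
            intro h2
            rw [e] at h2
            have := add_mem h2 w.toAdd.2
            exact h' (by convert this using 1; abel)
        · rw [if_neg h, zero_mul, if_neg]
          intro h2
          rw [e] at h2
          have := add_mem h2 w'.toAdd.2
          exact h (by convert this using 1; abel) }
  let G : ChartRing K σ.1 →ₐ[K] K := AddMonoidAlgebra.lift K K _ g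
  let F : MvPolynomial (latticePoints D) K →+* K :=
    G.toRingHom.comp (chartSections K D σ m hreg)
  have hF : F = MvPolynomial.constantCoeff := by
    apply MvPolynomial.ringHom_ext
    · intro c
      have : chartSections K D σ m hreg (MvPolynomial.C c) = algebraMap K _ c := by
        simp [chartSections]
      simp only [F, RingHom.comp_apply, this, MvPolynomial.constantCoeff_C]
      exact G.commutes c
    · intro u
      have : chartSections K D σ m hreg (MvPolynomial.X u) =
          AddMonoidAlgebra.single ⟨u.1 - m, hreg u.1 u.2⟩ 1 := by
        simp [chartSections]
      simp only [F, RingHom.comp_apply, this, MvPolynomial.constantCoeff_X]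
      change G _ = 0
      rw [AddMonoidAlgebra.lift_single, one_smul]
      refine if_neg fun h => hcon u.1 u.2 ?_
      simpa using h
  have h0 : (HomogeneousIdeal.irrelevant
      (MvPolynomial.homogeneousSubmodule (latticePoints D) K)).toIdeal ≤ RingHom.ker F := by
    intro f hf
    rw [HomogeneousIdeal.toIdeal_irrelevant, RingHom.mem_ker] at hf
    rw [RingHom.mem_ker, hF]
    rw [GradedRing.projZeroRingHom_apply] at hf
    have h2 : MvPolynomial.homogeneousComponent 0 f = 0 := by
      rw [← MvPolynomial.decomposition.decompose'_apply]
      exact hf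
    rw [MvPolynomial.homogeneousComponent_zero] at h2
    simpa [MvPolynomial.constantCoeff_eq] using h2
  have h1 : (1 : Γ(Spec (CommRingCat.of (ChartRing K σ.1)), ⊤)) ∈
      RingHom.ker (G.toRingHom.comp
        (Scheme.ΓSpecIso (CommRingCat.of (ChartRing K σ.1))).hom.hom) := by
    have h2 : (⊤ : Ideal Γ(Spec (CommRingCat.of (ChartRing K σ.1)), ⊤)) ≤
        RingHom.ker (G.toRingHom.comp
          (Scheme.ΓSpecIso (CommRingCat.of (ChartRing K σ.1))).hom.hom) := by
      rw [← hbpf, Ideal.map_le_iff_le_comap]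
      intro f hf
      have h3 := h0 hf
      rw [RingHom.mem_ker] at h3
      rw [Ideal.mem_comap, RingHom.mem_ker, RingHom.comp_apply, chartGlobalSections,
        RingHom.comp_apply]
      have h4 (y : ChartRing K σ.1) : (Scheme.ΓSpecIso (CommRingCat.of (ChartRing K σ.1))).hom.hom
          ((Scheme.ΓSpecIso (CommRingCat.of (ChartRing K σ.1))).inv.hom y) = y := by
        rw [← CommRingCat.comp_apply, Iso.inv_hom_id]; rfl
      rw [h4]
      exact h3
    exact h2 trivial
  rw [RingHom.mem_ker, map_one] at h1
  exact one_ne_zero h1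

/-- In each direction `x` the minimum of the linear form `x` over the polytope of a very ample
divisor is attained at a lattice point. -/
theorem IsVeryAmple.exists_latticePoint_le {K : Type u} [Field K] (hΔ : Δ.IsComplete)
    {D : Δ.TDivisor} (hD : IsVeryAmple K D) (x : Fin n → ℝ) :
    ∃ u ∈ latticePoints D, ∀ y ∈ polytope D, toReal u ⬝ᵥ x ≤ y ⬝ᵥ x := by
  obtain ⟨m, hm, hreg, hbpf, -⟩ := hD
  obtain ⟨τ, hτ, hx⟩ := hΔ x
  let σ : Δ.Cone := ⟨τ, hτ⟩
  have hx : x ∈ σ.1 := hx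
  obtain ⟨u, hu, hmu⟩ := exists_sub_mem_chartMonoid K D σ (hreg σ) (hbpf σ)
  refine ⟨u, hu, fun y hy => ?_⟩
  have h1 : toReal u ⬝ᵥ x ≤ toReal (m σ) ⬝ᵥ x := by
    have := hmu x hx
    rw [toReal_sub, sub_dotProduct] at this
    linarith
  refine h1.trans ?_
  obtain ⟨s, hs, hgen⟩ := Δ.exists_rays_generate σ
  have hmem : ∀ v ∈ s, toReal v ∈ σ.1 := fun v hv => by
    rw [hgen]; exact Submodule.subset_span ⟨v, hv, rfl⟩
  rw [hgen] at hx
  obtain ⟨c, hc, rfl⟩ := mem_hull_image_finset.1 hx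
  rw [dotProduct_sum, dotProduct_sum]
  refine Finset.sum_le_sum fun v hv => ?_
  rw [dotProduct_smul, dotProduct_smul]
  refine mul_le_mul_of_nonneg_left ?_ (hc v)
  rw [toReal_dotProduct, hm σ ⟨v, hs v hv⟩ (hmem v hv)]
  push_cast
  exact hy ⟨v, hs v hv⟩

/-- Lattice points that bound the coordinates from below and from above exist by
`IsVeryAmple.exists_latticePoint_le`. -/
theorem IsVeryAmple.finite_latticePoints {K : Type u} [Field K] (hΔ : Δ.IsComplete)
    {D : Δ.TDivisor} (hD : IsVeryAmple K D) : (latticePoints D).Finite := by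
  choose f hf hf' using fun x => hD.exists_latticePoint_le hΔ x
  refine (Set.finite_Icc (fun i => f (Pi.single i 1) i) (fun i => f (-Pi.single i 1) i)).subset ?_
  intro u hu
  constructor
  · intro i
    have := hf' (Pi.single i 1) _ hu
    simp only [dotProduct_single, mul_one, toReal] at this
    exact_mod_cast this
  · intro i
    have := hf' (-Pi.single i 1) _ hu
    simp only [dotProduct_neg, dotProduct_single, mul_one, toReal] at this
    have h : ((u i : ℤ) : ℝ) ≤ (f (-Pi.single i 1) i : ℝ) := by linarith
    exact_mod_cast h

/-- The polytope of a very ample divisor is a lattice polytope: it cannot be separated from the hull of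
its lattice points, because every linear form attains its minimum at one of them. -/
theorem IsVeryAmple.polytope_eq_convexHull {K : Type u} [Field K] (hΔ : Δ.IsComplete)
    {D : Δ.TDivisor} (hD : IsVeryAmple K D) :
    polytope D = convexHull ℝ (toReal '' latticePoints D) := by
  apply Set.Subset.antisymm
  · intro y hy
    by_contra hcon
    have hclosed : IsClosed (convexHull ℝ (toReal '' latticePoints D)) :=
      ((hD.finite_latticePoints hΔ).image _).isClosed_convexHull (𝕜 := ℝ)
    obtain ⟨f, a, hfa, hf⟩ := geometric_hahn_banach_point_closed (convex_convexHull ℝ _)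
      hclosed hcon
    obtain ⟨g, hg⟩ := exists_dotProduct_eq f.toLinearMap
    have hg' : ∀ x, f x = g ⬝ᵥ x := hg
    obtain ⟨u, hu, h⟩ := hD.exists_latticePoint_le hΔ g
    have h1 := h y hy
    have h2 := hf (toReal u) (subset_convexHull ℝ _ ⟨u, hu, rfl⟩)
    rw [hg'] at h2 hfa
    rw [dotProduct_comm _ g, dotProduct_comm _ g] at h1
    linarith
  · refine convexHull_min ?_ (convex_polytope D)
    rintro _ ⟨u, hu, rfl⟩
    exact hu

/-- Some cone of a complete fan is full-dimensional. -/
theorem Fan.IsComplete.exists_span_eq_top (hΔ : Δ.IsComplete) :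
    ∃ σ : Δ.Cone, Submodule.span ℝ (σ.1 : Set (Fin n → ℝ)) = ⊤ := by
  by_contra! hcon
  have hfin : (Set.range fun σ : Δ.Cone =>
      Submodule.span ℝ (σ.1 : Set (Fin n → ℝ))).Finite := by
    have := Δ.finite.to_subtype
    exact Set.finite_range _
  refine Subspace.biUnion_ne_univ_of_top_notMem (s := hfin.toFinset) (k := ℝ) ?_ ?_
  · rw [Set.Finite.mem_toFinset]
    rintro ⟨σ, hσ⟩
    exact hcon σ hσ
  · rw [Set.eq_univ_iff_forall]
    intro x
    obtain ⟨σ, hσ, hx⟩ := hΔ x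
    simp only [Set.Finite.mem_toFinset, Set.mem_range, Set.mem_iUnion]
    exact ⟨_, ⟨⟨σ, hσ⟩, rfl⟩, Submodule.subset_span hx⟩

instance mono_chartι (K : Type u) [Field K] (σ : Δ.Cone) : Mono (Δ.chartι K σ) := by
  have : Finite Δ.Cone := Δ.finite.to_subtype
  have : IsOpenImmersion (Limits.colimit.ι (Δ.chartDiagram K) σ) := inferInstance
  exact inferInstanceAs (Mono (Limits.colimit.ι (Δ.chartDiagram K) σ))

/-- The lattice points of the polytope of a very ample divisor generate the lattice affinely. On a
chart `U_σ` with `σ` of full dimension the local generator `m` of `𝒪(D)` is itself one of them. -/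
theorem IsVeryAmple.exists_closure_sub_eq_top {K : Type u} [Field K] (hΔ : Δ.IsComplete)
    {D : Δ.TDivisor} (hD : IsVeryAmple K D) :
    ∃ m ∈ latticePoints D, AddSubgroup.closure ((fun u => u - m) '' latticePoints D) = ⊤ := by
  obtain ⟨m, hm, hreg, hbpf, φ, hφ, hcl⟩ := hD
  obtain ⟨σ, hσ⟩ := hΔ.exists_span_eq_top
  obtain ⟨u, hu, hmu⟩ := exists_sub_mem_chartMonoid K D σ (hreg σ) (hbpf σ)
  have hum : u = m σ := by
    have h0 : ∀ x ∈ Submodule.span ℝ (σ.1 : Set (Fin n → ℝ)), toReal (m σ - u) ⬝ᵥ x = 0 := by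
      intro x hx
      induction hx using Submodule.span_induction with
      | mem x hx =>
        have h1 := hmu x hx
        have h2 := hreg σ u hu x hx
        rw [toReal_sub, sub_dotProduct] at h1 h2 ⊢
        linarith
      | zero => simp
      | add x y _ _ hx hy => rw [dotProduct_add, hx, hy, add_zero]
      | smul a x _ hx => rw [dotProduct_smul, hx, smul_zero]
    rw [hσ] at h0
    have h1 := dotProduct_self_eq_zero.1 (h0 (toReal (m σ - u)) trivial)
    rw [← toReal_zero] at h1
    exact (sub_eq_zero.1 (toReal_injective h1)).symm
  obtain ⟨m₀, hm₀, hm₀'⟩ := exists_supporting_zero (Δ.rational _ σ.2) (Δ.salient _ σ.2)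
  refine ⟨m σ, hum ▸ hu, closure_sub_eq_top_of_mono K D σ (hum ▸ hu) (hreg σ) (hbpf σ) ?_ hm₀ hm₀'⟩
  rw [← hφ σ]
  exact mono_comp _ _

end VeryAmple

/-! ### Lengths of quotients by monomial ideals -/

section MonomialIdeal

variable (K : Type*) [Field K] {M : Type*} [AddCommMonoid M]

/-- The ideal of the monoid algebra `K[M]` generated by the monomials with exponents in `T`. -/
noncomputable def monomialIdeal (T : Set M) : Ideal (AddMonoidAlgebra K M) :=
  Ideal.span ((fun s => AddMonoidAlgebra.single s (1 : K)) '' T)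

variable {K}

theorem single_mem_monomialIdeal {T : Set M} {s : M} (hs : s ∈ T) (c : K) :
    AddMonoidAlgebra.single s c ∈ monomialIdeal K T := by
  have h : AddMonoidAlgebra.single s c =
      AddMonoidAlgebra.single 0 c * AddMonoidAlgebra.single s (1 : K) := by
    rw [AddMonoidAlgebra.single_mul_single, zero_add, mul_one]
  rw [h]
  exact Ideal.mul_mem_left _ _ (Ideal.subset_span ⟨s, hs, rfl⟩)

theorem single_one_mem_monomialIdeal_iff {T : Set M} (hT : ∀ s ∈ T, ∀ r, s + r ∈ T) {s : M} :
    AddMonoidAlgebra.single s (1 : K) ∈ monomialIdeal K T ↔ s ∈ T := by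
  refine ⟨fun h => ?_, fun h => single_mem_monomialIdeal h 1⟩
  obtain ⟨m, hm, d, rfl⟩ := AddMonoidAlgebra.mem_ideal_span_of'_image.1 h s (by simp)
  rw [add_comm]
  exact hT m hm d

/-- The length of the quotient by a monomial ideal with finitely many monomials in its complement is
their number. A monomial of maximal degree in the complement generates a simple submodule of the
quotient, which gives an induction on the number of monomials. -/
theorem length_quotient_monomialIdeal (deg : M → ℤ) (hadd : ∀ s t, deg (s + t) = deg s + deg t)
    (hpos : ∀ s, s ≠ 0 → 0 < deg s) (T : Set M) (hT : ∀ s ∈ T, ∀ r, s + r ∈ T)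
    (hfin : Tᶜ.Finite) :
    Module.length (AddMonoidAlgebra K M) (AddMonoidAlgebra K M ⧸ monomialIdeal K T) =
      (Tᶜ.ncard : ℕ∞) := by
  classical
  induction hk : Tᶜ.ncard generalizing T with
  | zero =>
    rw [Set.ncard_eq_zero hfin, Set.compl_empty_iff] at hk
    have h1 : monomialIdeal K T = ⊤ := by
      rw [Ideal.eq_top_iff_one, AddMonoidAlgebra.one_def]
      exact single_mem_monomialIdeal (by rw [hk]; trivial) 1
    rw [h1, Nat.cast_zero, Module.length_eq_zero_iff]
    exact Submodule.Quotient.subsingleton_iff.2 rfl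
  | succ k ih =>
    have hne : Tᶜ.Nonempty := by
      rw [← Set.ncard_pos hfin]; omega
    obtain ⟨s, hs, hmax⟩ := Set.exists_max_image _ deg hfin hne
    have hs' : s ∉ T := hs
    have hsT : ∀ r, r ≠ 0 → s + r ∈ T := by
      intro r hr
      by_contra hcon
      have := hmax _ hcon
      rw [hadd] at this
      linarith [hpos r hr]
    set T' := insert s T with hT'
    have hup : ∀ t ∈ T', ∀ r, t + r ∈ T' := by
      rintro t (rfl | ht) r
      · by_cases hr : r = 0
        · rw [hr, add_zero]; exact Set.mem_insert _ _
        · exact Set.mem_insert_of_mem _ (hsT r hr)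
      · exact Set.mem_insert_of_mem _ (hT t ht r)
    have hcompl : T'ᶜ = Tᶜ \ {s} := by
      ext t
      simp [hT', not_or, and_comm]
    have hcard : T'ᶜ.ncard = k := by
      rw [hcompl, Set.ncard_sdiff_singleton_of_mem hs, hk]; rfl
    have ih' := ih T' hup (by rw [hcompl]; exact hfin.subset Set.sdiff_subset) hcard
    set J := monomialIdeal K T with hJ
    have hJJ' : J ≤ monomialIdeal K T' := Ideal.span_mono (Set.image_mono (Set.subset_insert _ _))
    let x : AddMonoidAlgebra K M ⧸ J := Submodule.Quotient.mk (AddMonoidAlgebra.single s 1)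
    let N : Submodule (AddMonoidAlgebra K M) (AddMonoidAlgebra K M ⧸ J) :=
      Submodule.span _ {x}
    have hN : Submodule.map J.mkQ (monomialIdeal K T') = N := by
      simp only [monomialIdeal, Ideal.span, hT', Set.image_insert_eq, Submodule.map_span]
      rw [Submodule.span_insert, sup_eq_left.2]
      · rfl
      · rw [Submodule.span_le]
        rintro _ ⟨_, ⟨t, ht, rfl⟩, rfl⟩
        have h0 : J.mkQ (AddMonoidAlgebra.single t (1 : K)) = 0 :=
          (Submodule.Quotient.mk_eq_zero _).2 (single_mem_monomialIdeal ht 1)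
        rw [h0]
        exact zero_mem _
    have hx0 : x ≠ 0 := fun h =>
      hs' ((single_one_mem_monomialIdeal_iff hT).1 ((Submodule.Quotient.mk_eq_zero _).1 h))
    -- the maximal ideal kills `x`, so that `K[M]` acts on it through `K`
    have hact : ∀ f : AddMonoidAlgebra K M, ∃ c : K,
        f • x = (AddMonoidAlgebra.single 0 c : AddMonoidAlgebra K M) • x := by
      intro f
      induction f using AddMonoidAlgebra.induction_linear with
      | zero => exact ⟨0, by simp⟩
      | add f g hf hg =>
        obtain ⟨a, ha⟩ := hf
        obtain ⟨b, hb⟩ := hg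
        exact ⟨a + b, by rw [add_smul, ha, hb, AddMonoidAlgebra.single_add, add_smul]⟩
      | single r c =>
        by_cases hr : r = 0
        · exact ⟨c, by rw [hr]⟩
        · refine ⟨0, ?_⟩
          rw [AddMonoidAlgebra.single_zero, zero_smul]
          refine (Submodule.Quotient.mk_eq_zero _).2 ?_
          change AddMonoidAlgebra.single r c * AddMonoidAlgebra.single s (1 : K) ∈ J
          rw [AddMonoidAlgebra.single_mul_single]
          exact single_mem_monomialIdeal (by rw [add_comm]; exact hsT r hr) _
    have hsimple : IsSimpleModule (AddMonoidAlgebra K M) N := by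
      rw [isSimpleModule_iff_toSpanSingleton_surjective]
      refine ⟨⟨⟨x, Submodule.mem_span_singleton_self x⟩, 0, fun h => hx0 (congrArg Subtype.val h)⟩,
        ?_⟩
      rintro ⟨y, hy⟩ hy0 ⟨z, hz⟩
      obtain ⟨f, rfl⟩ := Submodule.mem_span_singleton.1 hy
      obtain ⟨g, rfl⟩ := Submodule.mem_span_singleton.1 hz
      obtain ⟨c, hc⟩ := hact f
      have hc0 : c ≠ 0 := by
        rintro rfl
        apply hy0
        ext1
        change f • x = 0
        rw [hc, AddMonoidAlgebra.single_zero, zero_smul]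
      refine ⟨g * AddMonoidAlgebra.single 0 c⁻¹, ?_⟩
      ext1
      change (g * AddMonoidAlgebra.single 0 c⁻¹) • (f • x) = g • x
      rw [hc, ← mul_smul, mul_assoc, AddMonoidAlgebra.single_mul_single, inv_mul_cancel₀ hc0,
        add_zero, ← AddMonoidAlgebra.one_def, mul_one]
    have hlen := Module.length_eq_add_of_exact N.subtype N.mkQ N.injective_subtype
      N.mkQ_surjective (LinearMap.exact_subtype_mkQ N)
    have e : ((AddMonoidAlgebra K M ⧸ J) ⧸ N) ≃ₗ[AddMonoidAlgebra K M]
        (AddMonoidAlgebra K M ⧸ monomialIdeal K T') :=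
      (Submodule.quotEquivOfEq _ _ hN.symm).trans
        (Submodule.quotientQuotientEquivQuotient J (monomialIdeal K T') hJJ')
    rw [hlen, Module.length_eq_one, e.length_eq, ih', add_comm]
    norm_cast

/-- In characteristic `p` the Frobenius powers of a monomial ideal are monomial. -/
theorem frobeniusPower_monomialIdeal (p : ℕ) [Fact p.Prime] [CharP K p] (T : Set M) (e : ℕ) :
    frobeniusPower (monomialIdeal K T) (p ^ e) =
      monomialIdeal K {s | ∃ t ∈ T, ∃ r, s = p ^ e • t + r} := by
  have : CharP (AddMonoidAlgebra K M) p :=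
    charP_of_injective_algebraMap (algebraMap K (AddMonoidAlgebra K M)).injective p
  have hpow (t : M) : (AddMonoidAlgebra.single t (1 : K)) ^ p ^ e =
      AddMonoidAlgebra.single (p ^ e • t) 1 := by
    rw [AddMonoidAlgebra.single_pow, one_pow]
  apply le_antisymm
  · have h : monomialIdeal K T ≤ (monomialIdeal K
        {s | ∃ t ∈ T, ∃ r, s = p ^ e • t + r}).comap (iterateFrobenius _ p e) := by
      refine Ideal.span_le.2 ?_
      rintro _ ⟨t, ht, rfl⟩
      rw [SetLike.mem_coe, Ideal.mem_comap, iterateFrobenius_def, hpow]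
      refine single_mem_monomialIdeal (s := p ^ e • t) ?_ 1
      exact ⟨t, ht, 0, by rw [add_zero]⟩
    refine Ideal.span_le.2 ?_
    rintro _ ⟨f, hf, rfl⟩
    exact h hf
  · refine Ideal.span_le.2 ?_
    rintro _ ⟨_, ⟨t, ht, r, rfl⟩, rfl⟩
    have h : AddMonoidAlgebra.single (p ^ e • t + r) (1 : K) =
        AddMonoidAlgebra.single r 1 * (AddMonoidAlgebra.single t (1 : K)) ^ p ^ e := by
      rw [hpow, AddMonoidAlgebra.single_mul_single, one_mul, add_comm]
    change AddMonoidAlgebra.single (p ^ e • t + r) (1 : K) ∈ _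
    rw [h]
    exact Ideal.mul_mem_left _ _ (Ideal.subset_span
      (Set.mem_image_of_mem (fun x => x ^ p ^ e) (single_mem_monomialIdeal ht 1)))

end MonomialIdeal

/-! ### The monoid of a set of lattice points at height one -/

/-- The monoid generated by the `(u, 1)`, `u ∈ A`; for `A = P_D ∩ M` it is the monoid of the
homogeneous coordinate ring. -/
def pointMonoid (A : Set (Fin n → ℤ)) : AddSubmonoid ((Fin n → ℤ) × ℤ) :=
  AddSubmonoid.closure ((fun u => (u, (1 : ℤ))) '' A)

theorem mk_one_mem_pointMonoid {A : Set (Fin n → ℤ)} {u : Fin n → ℤ} (hu : u ∈ A) :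
    (u, (1 : ℤ)) ∈ pointMonoid A := AddSubmonoid.subset_closure ⟨u, hu, rfl⟩

theorem mem_pointMonoid_iff {A : Finset (Fin n → ℤ)} {z : (Fin n → ℤ) × ℤ} :
    z ∈ pointMonoid (A : Set (Fin n → ℤ)) ↔
      ∃ f : (Fin n → ℤ) → ℕ, ∑ a ∈ A, f a • (a, (1 : ℤ)) = z := by
  classical
  constructor
  · intro h
    rw [pointMonoid, ← Finset.coe_image, AddSubmonoid.mem_closure_finset] at h
    obtain ⟨f, -, rfl⟩ := h
    refine ⟨fun a => f (a, 1), ?_⟩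
    rw [Finset.sum_image]
    intro a _ b _ hab
    exact congrArg Prod.fst hab
  · rintro ⟨f, rfl⟩
    exact sum_mem fun a ha => nsmul_mem (mk_one_mem_pointMonoid ha) _

theorem sum_nsmul_snd (A : Finset (Fin n → ℤ)) (f : (Fin n → ℤ) → ℕ) :
    (∑ a ∈ A, f a • (a, (1 : ℤ))).2 = ((∑ a ∈ A, f a : ℕ) : ℤ) := by
  simp [Prod.snd_sum]

theorem snd_pos_of_mem_pointMonoid {A : Set (Fin n → ℤ)} {z : (Fin n → ℤ) × ℤ}
    (hz : z ∈ pointMonoid A) (h0 : z ≠ 0) : 0 < z.2 := by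
  suffices h : z = 0 ∨ 0 < z.2 from h.resolve_left h0
  clear h0
  induction hz using AddSubmonoid.closure_induction with
  | mem x hx => obtain ⟨u, -, rfl⟩ := hx; exact Or.inr one_pos
  | zero => exact Or.inl rfl
  | add x y _ _ hx hy =>
    rcases hx with rfl | hx
    · simpa using hy
    · rcases hy with rfl | hy
      · simpa using Or.inr hx
      · exact Or.inr (add_pos hx hy)

theorem snd_nonneg_of_mem_pointMonoid {A : Set (Fin n → ℤ)} {z : (Fin n → ℤ) × ℤ}
    (hz : z ∈ pointMonoid A) : 0 ≤ z.2 := by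
  by_cases h : z = 0
  · rw [h]; rfl
  · exact (snd_pos_of_mem_pointMonoid hz h).le

theorem exists_sub_mem_pointMonoid {A : Set (Fin n → ℤ)} {z : (Fin n → ℤ) × ℤ}
    (hz : z ∈ pointMonoid A) (h0 : 0 < z.2) :
    ∃ u ∈ A, ∃ r ∈ pointMonoid A, z = (u, 1) + r := by
  suffices h : z = 0 ∨ ∃ u ∈ A, ∃ r ∈ pointMonoid A, z = (u, 1) + r by
    refine h.resolve_left ?_
    rintro rfl
    exact lt_irrefl _ h0
  clear h0
  induction hz using AddSubmonoid.closure_induction with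
  | mem x hx => obtain ⟨u, hu, rfl⟩ := hx; exact Or.inr ⟨u, hu, 0, zero_mem _, by simp⟩
  | zero => exact Or.inl rfl
  | add x y _ hy hx' hy' =>
    rcases hx' with rfl | ⟨u, hu, r, hr, rfl⟩
    · simpa using hy'
    · exact Or.inr ⟨u, hu, r + y, add_mem hr hy, by rw [add_assoc]⟩

theorem finite_pointMonoid_snd_lt (A : Finset (Fin n → ℤ)) (N : ℕ) :
    {z | z ∈ pointMonoid (A : Set (Fin n → ℤ)) ∧ z.2 < N}.Finite := by
  classical
  have hfin : ((fun f : A → Fin N => ∑ a, (f a : ℕ) • (a.1, (1 : ℤ))) '' Set.univ).Finite :=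
    Set.finite_univ.image _
  refine hfin.subset ?_
  rintro z ⟨hz, hN⟩
  obtain ⟨f, rfl⟩ := mem_pointMonoid_iff.1 hz
  rw [sum_nsmul_snd] at hN
  have hN' : ∑ a ∈ A, f a < N := by exact_mod_cast hN
  have hlt : ∀ a ∈ A, f a < N := fun a ha =>
    (Finset.single_le_sum (fun _ _ => Nat.zero_le _) ha).trans_lt hN'
  exact ⟨fun a => ⟨f a, hlt a a.2⟩, trivial, Finset.sum_coe_sort A (fun a => f a • (a, (1 : ℤ)))⟩

/-- In degree at least `q (#A + 1)` some generator occurs `q` times. The summand `1` makes the bound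
valid for empty `A`. -/
theorem exists_sub_nsmul_mem_pointMonoid (A : Finset (Fin n → ℤ)) {q : ℕ} (hq : 0 < q)
    {z : (Fin n → ℤ) × ℤ} (hz : z ∈ pointMonoid (A : Set (Fin n → ℤ)))
    (hdeg : ((q * (A.card + 1) : ℕ) : ℤ) ≤ z.2) :
    ∃ u ∈ A, z - q • (u, (1 : ℤ)) ∈ pointMonoid (A : Set (Fin n → ℤ)) := by
  classical
  obtain ⟨f, rfl⟩ := mem_pointMonoid_iff.1 hz
  rw [sum_nsmul_snd] at hdeg
  have hdeg' : q * (A.card + 1) ≤ ∑ a ∈ A, f a := by exact_mod_cast hdeg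
  obtain ⟨u, hu, hfu⟩ : ∃ u ∈ A, q ≤ f u := by
    by_contra! hcon
    have h : ∑ a ∈ A, f a ≤ A.card • q := Finset.sum_le_card_nsmul _ _ _ fun a ha => (hcon a ha).le
    rw [smul_eq_mul] at h
    nlinarith
  refine ⟨u, hu, mem_pointMonoid_iff.2 ⟨fun a => if a = u then f u - q else f a, ?_⟩⟩
  rw [← Finset.add_sum_erase _ _ hu, ← Finset.add_sum_erase A _ hu]
  simp only [if_true]
  have h1 : ∑ a ∈ A.erase u, (if a = u then f u - q else f a) • (a, (1 : ℤ)) =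
      ∑ a ∈ A.erase u, f a • (a, (1 : ℤ)) :=
    Finset.sum_congr rfl fun a ha => by rw [if_neg (Finset.ne_of_mem_erase ha)]
  rw [h1]
  have h2 : f u • (u, (1 : ℤ)) = (f u - q) • (u, (1 : ℤ)) + q • (u, (1 : ℤ)) := by
    rw [← add_smul, Nat.sub_add_cancel hfu]
  rw [h2]
  abel

theorem maxIdeal_eq_monomialIdeal (K : Type u) [Field K] (D : Δ.TDivisor) :
    maxIdeal K D = monomialIdeal K {s : coordMonoid D | 0 < s.1.2} := by
  rw [maxIdeal, monomialIdeal]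
  congr 1
  ext f
  simp only [Set.mem_ofPred_eq, Set.mem_image, eq_comm]

/-- The powers of the graded maximal ideal are spanned by the monomials of large degree, since the
monoid is generated in degree one. -/
theorem maxIdeal_pow (K : Type u) [Field K] (D : Δ.TDivisor) (j : ℕ) :
    maxIdeal K D ^ j = monomialIdeal K {s : coordMonoid D | (j : ℤ) ≤ s.1.2} := by
  apply le_antisymm
  · induction j with
    | zero =>
      have h : monomialIdeal K {s : coordMonoid D | ((0 : ℕ) : ℤ) ≤ s.1.2} = ⊤ := by
        rw [Ideal.eq_top_iff_one, AddMonoidAlgebra.one_def]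
        exact single_mem_monomialIdeal (by simp) 1
      rw [h]
      exact le_top
    | succ j ih =>
      rw [pow_succ]
      refine (Ideal.mul_mono_left ih).trans ?_
      rw [maxIdeal_eq_monomialIdeal]
      simp only [monomialIdeal, Ideal.span_mul_span']
      refine Ideal.span_le.2 ?_
      rintro _ ⟨_, ⟨s, hs, rfl⟩, _, ⟨t, ht, rfl⟩, rfl⟩
      simp only [AddMonoidAlgebra.single_mul_single, mul_one]
      refine Ideal.subset_span ⟨s + t, ?_, rfl⟩
      have hs' : (j : ℤ) ≤ s.1.2 := hs
      have ht' : 0 < t.1.2 := ht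
      change ((j + 1 : ℕ) : ℤ) ≤ s.1.2 + t.1.2
      push_cast
      omega
  -- a monomial of degree `j` is a product of `j` monomials of degree one
  · have key : ∀ z (hz : z ∈ coordMonoid D),
        AddMonoidAlgebra.single (⟨z, hz⟩ : coordMonoid D) (1 : K) ∈
          maxIdeal K D ^ z.2.toNat := by
      intro z hz
      induction hz using AddSubmonoid.closure_induction with
      | mem x hx =>
        obtain ⟨u, hu, rfl⟩ := hx
        have : (1 : ℤ).toNat = 1 := rfl
        rw [this, pow_one]
        exact Ideal.subset_span ⟨_, one_pos, rfl⟩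
      | zero => simp
      | add x y hx hy hx' hy' =>
        have h1 : 0 ≤ x.2 := snd_nonneg_of_mem_pointMonoid hx
        have h2 : 0 ≤ y.2 := snd_nonneg_of_mem_pointMonoid hy
        rw [Prod.snd_add, Int.toNat_add h1 h2, pow_add]
        have h3 := Ideal.mul_mem_mul hx' hy'
        rwa [AddMonoidAlgebra.single_mul_single, mul_one] at h3
    refine Ideal.span_le.2 ?_
    rintro _ ⟨⟨z, hz⟩, hj, rfl⟩
    refine Ideal.pow_le_pow_right ?_ (key z hz)
    have hj' : (j : ℤ) ≤ z.2 := hj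
    omega

/-- The lengths that define the Hilbert-Samuel multiplicity count the monomials of small degree. -/
theorem length_quotient_maxIdeal_pow (K : Type u) [Field K] (D : Δ.TDivisor)
    (hfin : (latticePoints D).Finite) (j : ℕ) :
    (Module.length (CoordRing K D) (CoordRing K D ⧸ maxIdeal K D ^ j)).toNat =
      {z | z ∈ pointMonoid (latticePoints D) ∧ z.2 < j}.ncard := by
  have himg : Subtype.val '' {s : coordMonoid D | (j : ℤ) ≤ s.1.2}ᶜ =
      {z | z ∈ pointMonoid (latticePoints D) ∧ z.2 < j} := by
    ext z
    constructor
    · rintro ⟨s, hs, rfl⟩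
      exact ⟨s.2, not_le.1 hs⟩
    · rintro ⟨hz, hj⟩
      exact ⟨⟨z, hz⟩, not_le.2 hj, rfl⟩
  have hfin' := finite_pointMonoid_snd_lt hfin.toFinset j
  rw [hfin.coe_toFinset, ← himg] at hfin'
  rw [maxIdeal_pow, length_quotient_monomialIdeal (fun s : coordMonoid D => s.1.2)
    (fun s t => rfl) (fun s hs => snd_pos_of_mem_pointMonoid s.2 fun h => hs (Subtype.ext h))
    _ _ (hfin'.of_finite_image Subtype.val_injective.injOn), ENat.toNat_natCast, ← himg,
    Set.ncard_image_of_injective _ Subtype.val_injective]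
  intro s hs r
  have hs' : (j : ℤ) ≤ s.1.2 := hs
  have hr : 0 ≤ r.1.2 := snd_nonneg_of_mem_pointMonoid r.2
  change (j : ℤ) ≤ s.1.2 + r.1.2
  omega

/-- The lengths that define the Hilbert-Kunz multiplicity count the monomials outside the translates
of the monoid by the `q`-fold generators. -/
theorem length_quotient_frobeniusPower (K : Type u) [Field K] (p : ℕ) [Fact p.Prime] [CharP K p]
    (D : Δ.TDivisor) (hfin : (latticePoints D).Finite) (e : ℕ) :
    (Module.length (CoordRing K D)
      (CoordRing K D ⧸ frobeniusPower (maxIdeal K D) (p ^ e))).toNat =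
      {z | z ∈ pointMonoid (latticePoints D) ∧ ∀ u ∈ latticePoints D,
        z - (p ^ e) • (u, (1 : ℤ)) ∉ pointMonoid (latticePoints D)}.ncard := by
  have hq : 0 < p ^ e := pow_pos (Fact.out : p.Prime).pos e
  set T : Set (coordMonoid D) :=
    {s | ∃ t ∈ {s : coordMonoid D | 0 < s.1.2}, ∃ r, s = p ^ e • t + r} with hT
  have hTiff : ∀ s : coordMonoid D, s ∈ T ↔ ∃ u ∈ latticePoints D,
      s.1 - (p ^ e) • (u, (1 : ℤ)) ∈ pointMonoid (latticePoints D) := by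
    intro s
    constructor
    · rintro ⟨t, ht, r, rfl⟩
      obtain ⟨u, hu, t', ht', htt'⟩ := exists_sub_mem_pointMonoid t.2 ht
      refine ⟨u, hu, ?_⟩
      have h : (p ^ e • t + r : coordMonoid D).1 - (p ^ e) • (u, (1 : ℤ)) = p ^ e • t' + r.1 := by
        rw [AddSubmonoid.coe_add, AddSubmonoidClass.coe_nsmul, htt', smul_add]
        abel
      rw [h]
      exact add_mem (nsmul_mem ht' _) r.2
    · rintro ⟨u, hu, h⟩
      refine ⟨⟨(u, 1), mk_one_mem_pointMonoid hu⟩, (one_pos : (0 : ℤ) < 1), ⟨_, h⟩, ?_⟩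
      ext1
      rw [AddSubmonoid.coe_add, AddSubmonoidClass.coe_nsmul, add_sub_cancel]
  have himg : Subtype.val '' Tᶜ =
      {z | z ∈ pointMonoid (latticePoints D) ∧ ∀ u ∈ latticePoints D,
        z - (p ^ e) • (u, (1 : ℤ)) ∉ pointMonoid (latticePoints D)} := by
    ext z
    constructor
    · rintro ⟨s, hs, rfl⟩
      refine ⟨s.2, fun u hu h => hs ((hTiff s).2 ⟨u, hu, h⟩)⟩
    · rintro ⟨hz, h⟩
      refine ⟨⟨z, hz⟩, fun hs => ?_, rfl⟩
      obtain ⟨u, hu, h'⟩ := (hTiff _).1 hs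
      exact h u hu h'
  have hfin' : (Subtype.val '' Tᶜ).Finite := by
    have h1 := finite_pointMonoid_snd_lt hfin.toFinset (p ^ e * (hfin.toFinset.card + 1))
    refine h1.subset ?_
    rw [himg]
    rintro z ⟨hz, h⟩
    rw [Set.mem_ofPred_eq, hfin.coe_toFinset]
    refine ⟨hz, ?_⟩
    by_contra! hcon
    obtain ⟨u, hu, h2⟩ := exists_sub_nsmul_mem_pointMonoid hfin.toFinset hq
      (by rwa [hfin.coe_toFinset]) hcon
    rw [hfin.coe_toFinset] at h2
    exact h u (hfin.mem_toFinset.1 hu) h2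
  rw [maxIdeal_eq_monomialIdeal, frobeniusPower_monomialIdeal,
    length_quotient_monomialIdeal (fun s : coordMonoid D => s.1.2)
    (fun s t => rfl) (fun s hs => snd_pos_of_mem_pointMonoid s.2 fun h => hs (Subtype.ext h))
    _ _ (hfin'.of_finite_image Subtype.val_injective.injOn), ENat.toNat_natCast, ← himg,
    Set.ncard_image_of_injective _ Subtype.val_injective]
  rintro s ⟨t, ht, r, rfl⟩ r'
  exact ⟨t, ht, r + r', by rw [add_assoc]⟩

open MeasureTheory
open scoped Pointwise ENNReal

/-! ### The cone over a polytope and its lattice points -/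

/-- The cone over `P × {1}` in `ℝⁿ × ℝ`: the slice at height `t ≥ 0` is `tP`. -/
def coneOver (P : Set (Fin n → ℝ)) : Set ((Fin n → ℝ) × ℝ) := {x | 0 ≤ x.2 ∧ x.1 ∈ x.2 • P}

/-- The inclusion `ℤⁿ × ℤ ⊆ ℝⁿ × ℝ`. -/
def toRealPair (z : (Fin n → ℤ) × ℤ) : (Fin n → ℝ) × ℝ := (toReal z.1, (z.2 : ℝ))

theorem toRealPair_add (z w : (Fin n → ℤ) × ℤ) :
    toRealPair (z + w) = toRealPair z + toRealPair w := by
  simp [toRealPair, toReal_add]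

theorem toRealPair_sub (z w : (Fin n → ℤ) × ℤ) :
    toRealPair (z - w) = toRealPair z - toRealPair w := by
  simp [toRealPair, toReal_sub]

theorem toRealPair_nsmul (k : ℕ) (z : (Fin n → ℤ) × ℤ) :
    toRealPair (k • z) = (k : ℝ) • toRealPair z := by
  ext <;> simp [toRealPair, toReal]

theorem toRealPair_sum {ι : Type*} (s : Finset ι) (f : ι → (Fin n → ℤ) × ℤ) :
    toRealPair (∑ i ∈ s, f i) = ∑ i ∈ s, toRealPair (f i) :=
  map_sum (AddMonoidHom.mk' toRealPair toRealPair_add) f s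

theorem isClosed_coneOver {P : Set (Fin n → ℝ)} (hP : IsCompact P) : IsClosed (coneOver P) := by
  have : CompactSpace P := isCompact_iff_compactSpace.1 hP
  have h : coneOver P = Prod.fst ''
      {y : ((Fin n → ℝ) × ℝ) × P | 0 ≤ y.1.2 ∧ y.1.2 • y.2.1 = y.1.1} := by
    ext x
    constructor
    · rintro ⟨h0, p, hp, hx⟩
      exact ⟨(x, ⟨p, hp⟩), ⟨h0, hx⟩, rfl⟩
    · rintro ⟨⟨x', p⟩, ⟨h0, hx⟩, rfl⟩
      exact ⟨h0, p.1, p.2, hx⟩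
  rw [h]
  apply isClosedMap_fst_of_compactSpace
  have h1 : IsClosed {y : ((Fin n → ℝ) × ℝ) × P | 0 ≤ y.1.2} :=
    isClosed_le continuous_const (by fun_prop)
  have h2 : IsClosed {y : ((Fin n → ℝ) × ℝ) × P | y.1.2 • y.2.1 = y.1.1} :=
    isClosed_eq (by fun_prop) (by fun_prop)
  exact h1.inter h2

theorem add_mem_coneOver {P : Set (Fin n → ℝ)} (hP : Convex ℝ P) {x y : (Fin n → ℝ) × ℝ}
    (hx : x ∈ coneOver P) (hy : y ∈ coneOver P) : x + y ∈ coneOver P := by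
  refine ⟨add_nonneg hx.1 hy.1, ?_⟩
  rw [Prod.snd_add, hP.add_smul hx.1 hy.1]
  exact Set.add_mem_add hx.2 hy.2

theorem smul_mem_coneOver {P : Set (Fin n → ℝ)} {x : (Fin n → ℝ) × ℝ}
    (hx : x ∈ coneOver P) {r : ℝ} (hr : 0 ≤ r) : r • x ∈ coneOver P := by
  refine ⟨mul_nonneg hr hx.1, ?_⟩
  obtain ⟨p, hp, h⟩ := hx.2
  refine ⟨p, hp, ?_⟩
  simp only [Prod.smul_fst, Prod.smul_snd, smul_eq_mul, mul_smul] at h ⊢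
  rw [h]

theorem smul_mem_coneOver_iff {P : Set (Fin n → ℝ)} {x : (Fin n → ℝ) × ℝ} {r : ℝ} (hr : 0 < r) :
    r • x ∈ coneOver P ↔ x ∈ coneOver P := by
  refine ⟨fun h => ?_, fun h => smul_mem_coneOver h hr.le⟩
  have := smul_mem_coneOver h (inv_nonneg.2 hr.le)
  rwa [smul_smul, inv_mul_cancel₀ hr.ne', one_smul] at this

theorem convex_coneOver {P : Set (Fin n → ℝ)} (hP : Convex ℝ P) : Convex ℝ (coneOver P) :=
  fun _ hx _ hy _ _ ha hb _ =>
    add_mem_coneOver hP (smul_mem_coneOver hx ha) (smul_mem_coneOver hy hb)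

theorem sum_mem_coneOver {P : Set (Fin n → ℝ)} (hP : Convex ℝ P) (hne : P.Nonempty) {ι : Type*}
    (s : Finset ι) (f : ι → (Fin n → ℝ) × ℝ) (hf : ∀ i ∈ s, f i ∈ coneOver P) :
    ∑ i ∈ s, f i ∈ coneOver P := by
  classical
  induction s using Finset.induction_on with
  | empty =>
    refine ⟨le_rfl, ?_⟩
    rw [Finset.sum_empty]
    change (0 : Fin n → ℝ) ∈ (0 : ℝ) • P
    rw [Set.zero_smul_set hne]
    rfl
  | insert i s hi ih =>
    rw [Finset.sum_insert hi]
    exact add_mem_coneOver hP (hf i (Finset.mem_insert_self _ _))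
      (ih fun j hj => hf j (Finset.mem_insert_of_mem hj))

theorem mk_one_mem_coneOver {P : Set (Fin n → ℝ)} {u : Fin n → ℤ} (hu : toReal u ∈ P) :
    toRealPair (u, 1) ∈ coneOver P := by
  refine ⟨by simp [toRealPair], ?_⟩
  simpa [toRealPair] using hu

theorem toRealPair_mem_coneOver {A : Finset (Fin n → ℤ)} (hA : A.Nonempty)
    {z : (Fin n → ℤ) × ℤ} (hz : z ∈ pointMonoid (A : Set (Fin n → ℤ))) :
    toRealPair z ∈ coneOver (convexHull ℝ (toReal '' (A : Set (Fin n → ℤ)))) := by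
  obtain ⟨f, rfl⟩ := mem_pointMonoid_iff.1 hz
  rw [toRealPair_sum]
  refine sum_mem_coneOver (convex_convexHull ℝ _) ?_ _ _ fun a ha => ?_
  · exact (hA.to_set.image _).convexHull
  · rw [toRealPair_nsmul]
    exact smul_mem_coneOver (mk_one_mem_coneOver
      (subset_convexHull ℝ _ (Set.mem_image_of_mem _ ha))) (Nat.cast_nonneg _)

/-- The points of `t · conv(A)` are the combinations of `A` with nonnegative coefficients of sum
`t`. -/
theorem exists_sum_eq_of_mem_smul_convexHull {A : Finset (Fin n → ℤ)} {t : ℝ} (ht : 0 ≤ t)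
    {y : Fin n → ℝ} (hy : y ∈ t • convexHull ℝ (toReal '' (A : Set (Fin n → ℤ)))) :
    ∃ c : (Fin n → ℤ) → ℝ, (∀ a, 0 ≤ c a) ∧ ∑ a ∈ A, c a = t ∧ ∑ a ∈ A, c a • toReal a = y := by
  classical
  obtain ⟨p, hp, rfl⟩ := hy
  rw [← Finset.coe_image, Finset.mem_convexHull'] at hp
  obtain ⟨c, hc, hc1, rfl⟩ := hp
  rw [Finset.sum_image toReal_injective.injOn] at hc1
  simp only
  rw [Finset.sum_image toReal_injective.injOn, Finset.smul_sum]
  refine ⟨fun a => t * |c (toReal a)|, fun a => by positivity, ?_, ?_⟩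
  · rw [← Finset.mul_sum, Finset.sum_congr rfl fun a ha =>
      abs_of_nonneg (hc _ (Finset.mem_image_of_mem _ ha)), hc1, mul_one]
  · refine Finset.sum_congr rfl fun a ha => ?_
    simp only [abs_of_nonneg (hc _ (Finset.mem_image_of_mem _ ha)), mul_smul]

/-- The monoid of a set of lattice points that generates the group `ℤⁿ × ℤ` contains a translate of
its saturation. A lattice point of the cone is an element of the monoid plus a lattice point of the
zonotope spanned by the generators; there are finitely many of the latter, and each of them is a
difference of two elements of the monoid. -/
theorem exists_conductor {A : Finset (Fin n → ℤ)}
    (hgen : AddSubgroup.closure ((fun u => (u, (1 : ℤ))) '' (A : Set (Fin n → ℤ))) = ⊤) :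
    ∃ c : (Fin n → ℤ) × ℤ, ∀ z, toRealPair z ∈
      coneOver (convexHull ℝ (toReal '' (A : Set (Fin n → ℤ)))) →
        c + z ∈ pointMonoid (A : Set (Fin n → ℤ)) := by
  classical
  have hdiff : ∀ z : (Fin n → ℤ) × ℤ, ∃ s ∈ pointMonoid (A : Set (Fin n → ℤ)),
      s + z ∈ pointMonoid (A : Set (Fin n → ℤ)) := by
    intro z
    have hz : z ∈ AddSubgroup.closure ((fun u => (u, (1 : ℤ))) '' (A : Set (Fin n → ℤ))) := by
      rw [hgen]; trivial
    induction hz using AddSubgroup.closure_induction with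
    | mem x hx =>
      exact ⟨0, zero_mem _, by rw [zero_add]; exact AddSubmonoid.subset_closure hx⟩
    | zero => exact ⟨0, zero_mem _, by rw [zero_add]; exact zero_mem _⟩
    | add x y _ _ hx hy =>
      obtain ⟨s, hs, hsx⟩ := hx
      obtain ⟨t, ht, hty⟩ := hy
      exact ⟨s + t, add_mem hs ht, by rw [add_add_add_comm]; exact add_mem hsx hty⟩
    | neg x _ hx =>
      obtain ⟨s, hs, hsx⟩ := hx
      exact ⟨s + x, hsx, by rwa [add_neg_cancel_right]⟩
  choose s hs hsz using hdiff
  -- the lattice points of the zonotope spanned by the generators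
  set B : Set ((Fin n → ℤ) × ℤ) := {z | ∃ t : (Fin n → ℤ) → ℝ, (∀ a, 0 ≤ t a ∧ t a ≤ 1) ∧
    toRealPair z = ∑ a ∈ A, t a • toRealPair (a, 1)} with hB
  have hfin : B.Finite := by
    have hbd : ∀ (t : (Fin n → ℤ) → ℝ), (∀ a, 0 ≤ t a ∧ t a ≤ 1) → ∀ g : (Fin n → ℤ) → ℤ,
        |∑ a ∈ A, t a * (g a : ℝ)| ≤ ((∑ a ∈ A, |g a| : ℤ) : ℝ) := by
      intro t ht g
      push_cast
      refine (Finset.abs_sum_le_sum_abs _ _).trans (Finset.sum_le_sum fun a _ => ?_)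
      rw [abs_mul, abs_of_nonneg (ht a).1]
      exact mul_le_of_le_one_left (abs_nonneg _) (ht a).2
    refine (Set.finite_Icc ((fun i => -∑ a ∈ A, |a i|, -∑ a ∈ A, |1|) : (Fin n → ℤ) × ℤ)
      (fun i => ∑ a ∈ A, |a i|, ∑ a ∈ A, |1|)).subset ?_
    rintro z ⟨t, ht, hz⟩
    have h1 : ∀ i, |z.1 i| ≤ ∑ a ∈ A, |a i| := by
      intro i
      have h := hbd t ht (fun a => a i)
      have e : ∑ a ∈ A, t a * ((a i : ℤ) : ℝ) = (z.1 i : ℝ) := by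
        have := congrFun (congrArg Prod.fst hz) i
        simp only [toRealPair, toReal, Prod.fst_sum, Finset.sum_apply, Prod.smul_fst,
          Pi.smul_apply, smul_eq_mul] at this
        exact this.symm
      rw [e] at h
      exact_mod_cast h
    have h2 : |z.2| ≤ ∑ a ∈ A, |1| := by
      have h := hbd t ht (fun a => 1)
      have e : ∑ a ∈ A, t a * ((1 : ℤ) : ℝ) = (z.2 : ℝ) := by
        have := congrArg Prod.snd hz
        simp only [toRealPair, Prod.snd_sum, Prod.smul_snd, smul_eq_mul] at this
        exact this.symm
      rw [e] at h
      exact_mod_cast h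
    exact ⟨⟨fun i => (abs_le.1 (h1 i)).1, (abs_le.1 h2).1⟩,
      ⟨fun i => (abs_le.1 (h1 i)).2, (abs_le.1 h2).2⟩⟩
  refine ⟨∑ b ∈ hfin.toFinset, s b, fun z hz => ?_⟩
  obtain ⟨c, hc, hct, hcz⟩ := exists_sum_eq_of_mem_smul_convexHull hz.1 hz.2
  have hz' : toRealPair z = ∑ a ∈ A, c a • toRealPair (a, 1) := by
    ext1
    · simp only [Prod.fst_sum, Prod.smul_fst]
      exact hcz.symm
    · simp only [Prod.snd_sum, Prod.smul_snd, toRealPair, smul_eq_mul, Int.cast_one, mul_one]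
      exact hct.symm
  set r := ∑ a ∈ A, ⌊c a⌋₊ • (a, (1 : ℤ)) with hr
  have hrS : r ∈ pointMonoid (A : Set (Fin n → ℤ)) := mem_pointMonoid_iff.2 ⟨_, rfl⟩
  have hb : z - r ∈ B := by
    refine ⟨fun a => c a - ⌊c a⌋₊, fun a => ⟨sub_nonneg.2 (Nat.floor_le (hc a)), ?_⟩, ?_⟩
    · have := Nat.lt_floor_add_one (c a)
      linarith
    · rw [toRealPair_sub, hz', hr, toRealPair_sum, ← Finset.sum_sub_distrib]
      refine Finset.sum_congr rfl fun a _ => ?_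
      rw [toRealPair_nsmul, sub_smul]
  have hb' : z - r ∈ hfin.toFinset := hfin.mem_toFinset.2 hb
  have e : ∑ b ∈ hfin.toFinset, s b + z =
      (s (z - r) + (z - r)) + ∑ b ∈ hfin.toFinset.erase (z - r), s b + r := by
    rw [← Finset.add_sum_erase _ _ hb']
    abel
  rw [e]
  exact add_mem (add_mem (hsz _) (sum_mem fun b _ => hs b)) hrS

/-- Membership of `z q` in the monoid is eventually decided by the limit `x` of `z q / q`, unless `x`
is on the boundary of the cone: a fixed translation of the saturation is negligible after scaling. -/
theorem eventually_mem_pointMonoid_iff {A : Finset (Fin n → ℤ)} (hA : A.Nonempty)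
    (hgen : AddSubgroup.closure ((fun u => (u, (1 : ℤ))) '' (A : Set (Fin n → ℤ))) = ⊤)
    {z : ℕ → (Fin n → ℤ) × ℤ} {x : (Fin n → ℝ) × ℝ}
    (hz : Tendsto (fun q : ℕ => (q : ℝ)⁻¹ • toRealPair (z q)) atTop (𝓝 x))
    (hx : x ∉ frontier (coneOver (convexHull ℝ (toReal '' (A : Set (Fin n → ℤ)))))) :
    ∀ᶠ q in atTop, z q ∈ pointMonoid (A : Set (Fin n → ℤ)) ↔
      x ∈ coneOver (convexHull ℝ (toReal '' (A : Set (Fin n → ℤ)))) := by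
  set C := coneOver (convexHull ℝ (toReal '' (A : Set (Fin n → ℤ)))) with hC
  have hcl : IsClosed C :=
    isClosed_coneOver ((A.finite_toSet.image _).isCompact_convexHull (𝕜 := ℝ))
  by_cases hxC : x ∈ C
  · have hint : x ∈ interior C := by
      by_contra h
      exact hx ⟨subset_closure hxC, h⟩
    obtain ⟨c, hc⟩ := exists_conductor hgen
    have h0 : Tendsto (fun q : ℕ => (q : ℝ)⁻¹ • toRealPair c) atTop (𝓝 0) := by
      have := (tendsto_inv_atTop_nhds_zero_nat (𝕜 := ℝ)).smul_const (toRealPair c)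
      rwa [zero_smul] at this
    have h1 := hz.sub h0
    rw [sub_zero] at h1
    filter_upwards [h1.eventually (isOpen_interior.mem_nhds hint), eventually_gt_atTop 0]
      with q hq hq0
    refine iff_of_true ?_ hxC
    have h2 : (q : ℝ)⁻¹ • toRealPair (z q - c) ∈ C := by
      rw [toRealPair_sub, smul_sub]
      exact interior_subset hq
    rw [hC, smul_mem_coneOver_iff (by positivity)] at h2
    have h3 := hc _ h2
    rwa [add_sub_cancel] at h3
  · filter_upwards [hz.eventually (hcl.isOpen_compl.mem_nhds hxC)] with q hq
    refine iff_of_false (fun h => hq ?_) hxC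
    exact smul_mem_coneOver (toRealPair_mem_coneOver hA h) (by positivity)

/-! ### Counting lattice points by volumes -/

/-- Integer part in `ℝⁿ × ℝ`. -/
noncomputable def floorPair (x : (Fin n → ℝ) × ℝ) : (Fin n → ℤ) × ℤ := (floorVec x.1, ⌊x.2⌋)

theorem measurable_floorVec : Measurable (floorVec : (Fin n → ℝ) → Fin n → ℤ) :=
  measurable_pi_lambda _ fun i => Int.measurable_floor.comp (measurable_pi_apply i)

theorem measurable_floorPair : Measurable (floorPair : (Fin n → ℝ) × ℝ → (Fin n → ℤ) × ℤ) :=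
  (measurable_floorVec.comp measurable_fst).prodMk (Int.measurable_floor.comp measurable_snd)

theorem floor_mul_preimage {q : ℝ} (hq : 0 < q) (z : ℤ) :
    {x : ℝ | ⌊q * x⌋ = z} = Set.Ico ((z : ℝ) / q) (((z : ℝ) + 1) / q) := by
  ext x
  rw [Set.mem_Ico, div_le_iff₀ hq, lt_div_iff₀ hq, mul_comm x]
  exact Int.floor_eq_iff

theorem volume_floorVec_smul_eq {q : ℝ} (hq : 0 < q) (v : Fin n → ℤ) :
    volume {x : Fin n → ℝ | floorVec (q • x) = v} = ENNReal.ofReal q⁻¹ ^ n := by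
  have h : {x : Fin n → ℝ | floorVec (q • x) = v} =
      Set.pi Set.univ fun i => Set.Ico ((v i : ℝ) / q) (((v i : ℝ) + 1) / q) := by
    ext x
    simp only [← floor_mul_preimage hq]
    simp [funext_iff, floorVec, Set.mem_pi]
  rw [h, Real.volume_pi_Ico]
  simp [← sub_div]

theorem volume_floorPair_smul_eq {q : ℝ} (hq : 0 < q) (z : (Fin n → ℤ) × ℤ) :
    volume {x : (Fin n → ℝ) × ℝ | floorPair (q • x) = z} = ENNReal.ofReal q⁻¹ ^ (n + 1) := by
  have h : {x : (Fin n → ℝ) × ℝ | floorPair (q • x) = z} =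
      {x : Fin n → ℝ | floorVec (q • x) = z.1} ×ˢ {x : ℝ | ⌊q * x⌋ = z.2} := by
    ext x
    simp [floorPair, Prod.ext_iff]
  rw [h, Measure.volume_eq_prod, Measure.prod_prod, volume_floorVec_smul_eq hq,
    floor_mul_preimage hq, Real.volume_Ico, pow_succ]
  congr 2
  field_simp
  ring

theorem norm_sub_floorPair_le {q : ℝ} (hq : 0 < q) (x : (Fin n → ℝ) × ℝ) :
    ‖x - q⁻¹ • toRealPair (floorPair (q • x))‖ ≤ q⁻¹ := by
  have h (y : ℝ) : ‖y - q⁻¹ * (⌊q * y⌋ : ℝ)‖ ≤ q⁻¹ := by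
    have e : y - q⁻¹ * (⌊q * y⌋ : ℝ) = q⁻¹ * Int.fract (q * y) := by
      rw [Int.fract]; field_simp
    rw [e, Real.norm_of_nonneg (mul_nonneg (by positivity) (Int.fract_nonneg _))]
    exact mul_le_of_le_one_right (by positivity) (Int.fract_lt_one _).le
  rw [Prod.norm_def]
  refine max_le ?_ ?_
  · rw [pi_norm_le_iff_of_nonneg (by positivity)]
    intro i
    simpa [toRealPair, toReal, floorPair, floorVec] using h (x.1 i)
  · simpa [toRealPair, floorPair] using h x.2

theorem tendsto_floorPair (x : (Fin n → ℝ) × ℝ) :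
    Tendsto (fun q : ℕ => (q : ℝ)⁻¹ • toRealPair (floorPair ((q : ℝ) • x))) atTop (𝓝 x) := by
  have h1 := tendsto_floorVec x.1
  have h2 := tendsto_floor_mul_div x.2
  have h3 := h1.prodMk_nhds h2
  refine h3.congr fun q => ?_
  ext1
  · rfl
  · simp [toRealPair, floorPair, div_eq_inv_mul]

theorem volume_floorPair_mem {q : ℝ} (hq : 0 < q) {T : Set ((Fin n → ℤ) × ℤ)} (hT : T.Finite) :
    volume {x : (Fin n → ℝ) × ℝ | floorPair (q • x) ∈ T} =
      T.ncard * ENNReal.ofReal q⁻¹ ^ (n + 1) := by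
  have h := sum_measure_preimage_singleton (μ := volume) hT.toFinset
    (f := fun x : (Fin n → ℝ) × ℝ => floorPair (q • x)) (fun z _ =>
      (measurable_floorPair.comp (measurable_const_smul q)) (measurableSet_singleton z))
  have h1 : ∀ z ∈ hT.toFinset, volume ((fun x : (Fin n → ℝ) × ℝ => floorPair (q • x)) ⁻¹' {z}) =
      ENNReal.ofReal q⁻¹ ^ (n + 1) := fun z _ => volume_floorPair_smul_eq hq z
  rw [Finset.sum_congr rfl h1, Finset.sum_const,
    hT.coe_toFinset, nsmul_eq_mul, ← Set.ncard_eq_toFinset_card T hT] at h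
  exact h.symm

/-- If membership of `⌊qx⌋` in the finite sets `T q` is eventually membership of `x` in `W`, then the
numbers of elements of `T q` are asymptotically given by the volume of `W`: the union of the cubes of
side `1 / q` at the points of `T q / q` converges to `W` boundedly. -/
theorem tendsto_ncard_div_pow {T : ℕ → Set ((Fin n → ℤ) × ℤ)} (hT : ∀ q, (T q).Finite)
    {W : Set ((Fin n → ℝ) × ℝ)} (hW : MeasurableSet W) {B : Set ((Fin n → ℝ) × ℝ)}
    (hB : Bornology.IsBounded B)
    (hTB : ∀ᶠ q : ℕ in atTop, ∀ z ∈ T q, (q : ℝ)⁻¹ • toRealPair z ∈ B)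
    (hTW : ∀ᵐ x : (Fin n → ℝ) × ℝ, ∀ᶠ q : ℕ in atTop,
      floorPair ((q : ℝ) • x) ∈ T q ↔ x ∈ W) :
    Tendsto (fun q => ((T q).ncard : ℝ) / (q : ℝ) ^ (n + 1)) atTop (𝓝 (volume.real W)) := by
  obtain ⟨R, hR⟩ := hB.subset_closedBall 0
  have hfin : volume (Metric.closedBall (0 : (Fin n → ℝ) × ℝ) (R + 1)) ≠ ∞ :=
    (isCompact_closedBall _ _).measure_lt_top.ne
  have hsub : ∀ᶠ q : ℕ in atTop, {x : (Fin n → ℝ) × ℝ | floorPair ((q : ℝ) • x) ∈ T q} ⊆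
      Metric.closedBall 0 (R + 1) := by
    filter_upwards [hTB, eventually_gt_atTop 0] with q hq hq0 x hx
    have hq0' : (1 : ℝ) ≤ q := by exact_mod_cast hq0
    have h1 := norm_sub_floorPair_le (by linarith : (0 : ℝ) < q) x
    have h2 := hR (hq _ hx)
    rw [mem_closedBall_zero_iff] at h2 ⊢
    have h3 : (q : ℝ)⁻¹ ≤ 1 := inv_le_one_of_one_le₀ hq0'
    have h4 := norm_le_norm_sub_add x ((q : ℝ)⁻¹ • toRealPair (floorPair ((q : ℝ) • x)))
    linarith
  have h := tendsto_measure_of_ae_tendsto_indicator (μ := volume) atTop hW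
    (fun q : ℕ => (measurable_floorPair.comp (measurable_const_smul (q : ℝ)))
      (Set.to_countable (T q)).measurableSet)
    Metric.isClosed_closedBall.measurableSet hfin hsub hTW
  have hWfin : volume W ≠ ∞ := by
    refine (lt_of_le_of_lt (le_of_tendsto h ?_) (lt_top_iff_ne_top.2 hfin)).ne
    filter_upwards [hsub] with q hq
    exact measure_mono hq
  have h' := (ENNReal.tendsto_toReal hWfin).comp h
  refine h'.congr' ?_
  filter_upwards [eventually_gt_atTop 0] with q hq
  have hq' : (0 : ℝ) < q := by exact_mod_cast hq
  change (volume {x : (Fin n → ℝ) × ℝ | floorPair ((q : ℝ) • x) ∈ T q}).toReal = _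
  rw [volume_floorPair_mem hq' (hT q), ENNReal.toReal_mul, ENNReal.toReal_pow,
    ENNReal.toReal_ofReal (by positivity), ENNReal.toReal_natCast, inv_pow, div_eq_mul_inv]

theorem isBounded_coneOver_snd_le {P : Set (Fin n → ℝ)} (hP : Bornology.IsBounded P) (N : ℝ) :
    Bornology.IsBounded (coneOver P ∩ {x | x.2 ≤ N}) := by
  obtain ⟨R, hR⟩ := hP.subset_closedBall 0
  refine (Metric.isBounded_iff_subset_closedBall 0).2 ⟨max (N * R) N, ?_⟩
  rintro x ⟨⟨h0, p, hp, hx⟩, hN⟩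
  have hN' : x.2 ≤ N := hN
  have h1 : ‖p‖ ≤ R := mem_closedBall_zero_iff.1 (hR hp)
  rw [mem_closedBall_zero_iff, Prod.norm_def]
  refine max_le_max ?_ ?_
  · simp only at hx
    rw [← hx, norm_smul, Real.norm_of_nonneg h0]
    exact mul_le_mul hN' h1 (norm_nonneg _) (h0.trans hN')
  · rwa [Real.norm_of_nonneg h0]

instance isAddHaarMeasure_volume_pi_prod :
    (volume : Measure ((Fin n → ℝ) × ℝ)).IsAddHaarMeasure := by
  rw [Measure.volume_eq_prod]
  infer_instance

theorem volume_frontier_coneOver {P : Set (Fin n → ℝ)} (hP : Convex ℝ P) :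
    volume (frontier (coneOver P)) = 0 :=
  (convex_coneOver hP).addHaar_frontier volume

section Limits

variable {A : Finset (Fin n → ℤ)} (hA : A.Nonempty)
  (hgen : AddSubgroup.closure ((fun u => (u, (1 : ℤ))) '' (A : Set (Fin n → ℤ))) = ⊤)

include hA hgen

/-- The number of monomials of degree less than `j` is asymptotically the volume of the part of the
cone below height one. -/
theorem tendsto_ncard_pointMonoid_snd_lt :
    Tendsto (fun j : ℕ => (({z | z ∈ pointMonoid (A : Set (Fin n → ℤ)) ∧ z.2 < j}.ncard : ℕ) : ℝ) /
      (j : ℝ) ^ (n + 1)) atTop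
      (𝓝 (volume.real (coneOver (convexHull ℝ (toReal '' (A : Set (Fin n → ℤ)))) ∩
        {x | x.2 < 1}))) := by
  set P := convexHull ℝ (toReal '' (A : Set (Fin n → ℤ))) with hPdef
  have hP : IsCompact P := (A.finite_toSet.image _).isCompact_convexHull (𝕜 := ℝ)
  have hlt : MeasurableSet {x : (Fin n → ℝ) × ℝ | x.2 < 1} :=
    (isOpen_lt continuous_snd continuous_const).measurableSet
  refine tendsto_ncard_div_pow (fun j => finite_pointMonoid_snd_lt A j)
    ((isClosed_coneOver hP).measurableSet.inter hlt) (isBounded_coneOver_snd_le hP.isBounded 1) ?_ ?_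
  · filter_upwards [eventually_gt_atTop 0] with q hq z hz
    have hq' : (0 : ℝ) < q := by exact_mod_cast hq
    refine ⟨smul_mem_coneOver (toRealPair_mem_coneOver hA hz.1) (by positivity), ?_⟩
    have h : (z.2 : ℝ) < q := by exact_mod_cast hz.2
    change (q : ℝ)⁻¹ * (z.2 : ℝ) ≤ 1
    rw [inv_mul_le_iff₀ hq']
    linarith
  · have h1 : ∀ᵐ x : (Fin n → ℝ) × ℝ, x ∉ frontier (coneOver P) :=
      measure_eq_zero_iff_ae_notMem.1 (volume_frontier_coneOver (convex_convexHull ℝ _))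
    filter_upwards [h1] with x hx
    filter_upwards [eventually_mem_pointMonoid_iff hA hgen (tendsto_floorPair x) hx,
      eventually_gt_atTop 0] with q hq hq0
    have hq' : (0 : ℝ) < q := by exact_mod_cast hq0
    refine and_congr hq ?_
    change ⌊(q : ℝ) * x.2⌋ < (q : ℤ) ↔ x.2 < 1
    rw [Int.floor_lt, Int.cast_natCast, mul_lt_iff_lt_one_right hq']

/-- The number of monomials outside the ideal of the `q`-th powers of the generators is
asymptotically the volume of the part of the cone that is not covered by its translates by the
generators. -/
theorem tendsto_ncard_pointMonoid_compl :
    Tendsto (fun q : ℕ => (({z | z ∈ pointMonoid (A : Set (Fin n → ℤ)) ∧ ∀ u ∈ (A : Set _),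
        z - q • (u, (1 : ℤ)) ∉ pointMonoid (A : Set (Fin n → ℤ))}.ncard : ℕ) : ℝ) /
      (q : ℝ) ^ (n + 1)) atTop
      (𝓝 (volume.real {x | x ∈ coneOver (convexHull ℝ (toReal '' (A : Set (Fin n → ℤ)))) ∧
        ∀ u ∈ A, x - toRealPair (u, 1) ∉
          coneOver (convexHull ℝ (toReal '' (A : Set (Fin n → ℤ))))})) := by
  set P := convexHull ℝ (toReal '' (A : Set (Fin n → ℤ))) with hPdef
  have hP : IsCompact P := (A.finite_toSet.image _).isCompact_convexHull (𝕜 := ℝ)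
  have hC := (isClosed_coneOver hP).measurableSet
  have hdeg : ∀ q : ℕ, 0 < q → ∀ z, (z ∈ pointMonoid (A : Set (Fin n → ℤ)) ∧ ∀ u ∈ (A : Set _),
      z - q • (u, (1 : ℤ)) ∉ pointMonoid (A : Set (Fin n → ℤ))) →
      z.2 < ((q * (A.card + 1) : ℕ) : ℤ) := by
    rintro q hq z ⟨hz, h⟩
    by_contra! hcon
    obtain ⟨u, hu, h2⟩ := exists_sub_nsmul_mem_pointMonoid A hq hz hcon
    exact h u hu h2
  refine tendsto_ncard_div_pow ?_ ?_ (isBounded_coneOver_snd_le hP.isBounded (A.card + 1)) ?_ ?_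
  · intro q
    rcases Nat.eq_zero_or_pos q with rfl | hq
    -- for `q = 0` each translate is the whole monoid
    · obtain ⟨u, hu⟩ := hA
      convert Set.finite_empty
      ext z
      simp only [Set.mem_ofPred_eq, Set.mem_empty_iff_false, iff_false, not_and, not_forall]
      intro hz
      exact ⟨u, hu, by simpa using hz⟩
    · exact (finite_pointMonoid_snd_lt A (q * (A.card + 1))).subset
        fun z hz => ⟨hz.1, hdeg q hq z hz⟩
  · refine hC.inter ?_
    have e : {x | ∀ u ∈ A, x - toRealPair (u, 1) ∉ coneOver P} =
        ⋂ u ∈ A, (fun x => x - toRealPair (u, 1)) ⁻¹' (coneOver P)ᶜ := by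
      ext x; simp
    change MeasurableSet {x | ∀ u ∈ A, x - toRealPair (u, 1) ∉ coneOver P}
    rw [e]
    exact A.measurableSet_biInter fun u _ => (measurable_id.sub_const _) hC.compl
  · filter_upwards [eventually_gt_atTop 0] with q hq z hz
    have hq' : (0 : ℝ) < q := by exact_mod_cast hq
    refine ⟨smul_mem_coneOver (toRealPair_mem_coneOver hA hz.1) (by positivity), ?_⟩
    have h : (z.2 : ℝ) < ((q * (A.card + 1) : ℕ) : ℝ) := by exact_mod_cast hdeg q hq z hz
    push_cast at h
    change (q : ℝ)⁻¹ * (z.2 : ℝ) ≤ A.card + 1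
    rw [inv_mul_le_iff₀ hq']
    exact h.le
  · have h1 : ∀ᵐ x : (Fin n → ℝ) × ℝ, x ∉ frontier (coneOver P) :=
      measure_eq_zero_iff_ae_notMem.1 (volume_frontier_coneOver (convex_convexHull ℝ _))
    have h2 : ∀ u ∈ A, ∀ᵐ x : (Fin n → ℝ) × ℝ, x - toRealPair (u, 1) ∉ frontier (coneOver P) :=
      fun u _ => (measurePreserving_sub_right volume
        (toRealPair (u, 1))).quasiMeasurePreserving.ae h1
    have h2' := (ae_ball_iff (A.countable_toSet)).2 h2
    filter_upwards [h1, h2'] with x hx hx'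
    have h3 : ∀ u ∈ A, ∀ᶠ q : ℕ in atTop,
        (floorPair ((q : ℝ) • x) - q • (u, (1 : ℤ)) ∈ pointMonoid (A : Set (Fin n → ℤ)) ↔
          x - toRealPair (u, 1) ∈ coneOver P) := by
      intro u hu
      refine eventually_mem_pointMonoid_iff hA hgen ?_ (hx' u hu)
      refine ((tendsto_floorPair x).sub_const (toRealPair (u, 1))).congr' ?_
      filter_upwards [eventually_gt_atTop 0] with q hq
      have hq' : (q : ℝ) ≠ 0 := by positivity
      rw [toRealPair_sub, toRealPair_nsmul, smul_sub, smul_smul, inv_mul_cancel₀ hq', one_smul]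
    filter_upwards [eventually_mem_pointMonoid_iff hA hgen (tendsto_floorPair x) hx,
      (Finset.eventually_all A).2 h3] with q hq hq'
    exact and_congr hq (forall₂_congr fun u hu => not_congr (hq' u hu))

end Limits

/-! ### The limit over the multiples of the divisor -/

theorem mem_coneOver_iff_of_pos {P : Set (Fin n → ℝ)} {y : Fin n → ℝ} {t : ℝ} (ht : 0 < t) :
    (y, t) ∈ coneOver P ↔ t⁻¹ • y ∈ P := by
  rw [← Set.mem_smul_set_iff_inv_smul_mem₀ ht.ne']
  exact and_iff_right ht.le

theorem mem_coneOver_smul_iff {P : Set (Fin n → ℝ)} {k : ℝ} (hk : 0 < k) {x : (Fin n → ℝ) × ℝ} :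
    x ∈ coneOver (k • P) ↔ (x.1, k * x.2) ∈ coneOver P := by
  refine and_congr (mul_nonneg_iff_of_pos_left hk).symm ?_
  rw [smul_smul, mul_comm]

/-- The part of `ℝⁿ × [0, ∞)` where `(k + s)P` is not covered by the translates of `sP` by the
lattice points of `kP`. Its volume governs the difference of the Hilbert-Kunz and the normalized
Hilbert-Samuel multiplicity of `kD`. -/
def excessRegion (P : Set (Fin n → ℝ)) (k : ℕ) : Set ((Fin n → ℝ) × ℝ) :=
  {x | 0 ≤ x.2 ∧ (x.1, k + x.2) ∈ coneOver P ∧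
    ∀ u : Fin n → ℤ, toRealPair (u, k) ∈ coneOver P → (x.1 - toReal u, x.2) ∉ coneOver P}

/-- The points `(z, s)` of `[0, 1)ⁿ × [0, ∞)` for which `z` is not covered by the lattice translates
of `sP`. -/
def uncoveredRegion (P : Set (Fin n → ℝ)) : Set ((Fin n → ℝ) × ℝ) :=
  {x | floorVec x.1 = 0 ∧ 0 ≤ x.2 ∧ ∀ v : Fin n → ℤ, (x.1 - toReal v, x.2) ∉ coneOver P}

theorem measurableSet_excessRegion {P : Set (Fin n → ℝ)} (hP : IsCompact P) (k : ℕ) :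
    MeasurableSet (excessRegion P k) := by
  have hC := (isClosed_coneOver hP).measurableSet
  refine (measurableSet_le measurable_const measurable_snd).inter (MeasurableSet.inter ?_ ?_)
  · exact (measurable_fst.prodMk (measurable_const.add measurable_snd)) hC
  · refine MeasurableSet.congr (s := ⋂ u : Fin n → ℤ, {x | toRealPair (u, (k : ℤ)) ∈ coneOver P →
      (x.1 - toReal u, x.2) ∉ coneOver P}) ?_ ?_
    · refine MeasurableSet.iInter fun u => ?_
      by_cases h : toRealPair (u, (k : ℤ)) ∈ coneOver P
      · simp only [h, true_imp_iff]
        exact ((measurable_fst.sub_const _).prodMk measurable_snd) hC.compl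
      · simp [h]
    · ext x
      rw [Set.mem_iInter]
      rfl

theorem measurableSet_uncoveredRegion {P : Set (Fin n → ℝ)} (hP : IsCompact P) :
    MeasurableSet (uncoveredRegion P) := by
  have hC := (isClosed_coneOver hP).measurableSet
  refine MeasurableSet.inter ((measurable_floorVec.comp measurable_fst)
    (measurableSet_singleton 0)) ((measurableSet_le measurable_const measurable_snd).inter ?_)
  refine MeasurableSet.congr (s := ⋂ u : Fin n → ℤ,
    {x | (x.1 - toReal u, x.2) ∉ coneOver P}) ?_ ?_
  · exact MeasurableSet.iInter fun u =>
      ((measurable_fst.sub_const _).prodMk measurable_snd) hC.compl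
  · ext x
    rw [Set.mem_iInter]
    rfl

/-- Averaging over the lattice: for `(x, z)` uniform with `z` in the unit cube, `⌊kx⌋ + z` is
uniform. -/
theorem volume_floorVec_add_mem {k : ℝ} (hk : 0 < k) {E : Set ((Fin n → ℝ) × ℝ)}
    (hE : MeasurableSet E) :
    volume {w : (Fin n → ℝ) × ((Fin n → ℝ) × ℝ) | floorVec w.2.1 = 0 ∧
      (toReal (floorVec (k • w.1)) + w.2.1, w.2.2) ∈ E} = ENNReal.ofReal k⁻¹ ^ n * volume E := by
  have hfloor : ∀ v : Fin n → ℤ, MeasurableSet {x : Fin n → ℝ | floorVec (k • x) = v} := fun v =>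
    (measurable_floorVec.comp (measurable_const_smul k)) (measurableSet_singleton v)
  let E' : (Fin n → ℤ) → Set ((Fin n → ℝ) × ℝ) := fun v => E ∩ {x | floorVec x.1 = v}
  have hE' : ∀ v, MeasurableSet (E' v) := fun v =>
    hE.inter ((measurable_floorVec.comp measurable_fst) (measurableSet_singleton v))
  let τ : (Fin n → ℤ) → Set ((Fin n → ℝ) × ℝ) := fun v =>
    (fun x => ((toReal v, 0) : (Fin n → ℝ) × ℝ) + x) ⁻¹' E' v
  have hτ : ∀ v, MeasurableSet (τ v) := fun v => (measurable_const_add _) (hE' v)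
  have hτ' : ∀ v x, x ∈ τ v ↔ floorVec x.1 = 0 ∧ (toReal v + x.1, x.2) ∈ E := by
    intro v x
    have h : floorVec (toReal v + x.1) = v ↔ floorVec x.1 = 0 := by
      simp [funext_iff, floorVec, toReal]
    have h' : ((toReal v, 0) : (Fin n → ℝ) × ℝ) + x = (toReal v + x.1, x.2) := by
      ext1 <;> simp
    change (((toReal v, 0) : (Fin n → ℝ) × ℝ) + x ∈ E ∧
      floorVec (((toReal v, 0) : (Fin n → ℝ) × ℝ) + x).1 = v) ↔ _
    rw [h', h, and_comm]
  have hU : {w : (Fin n → ℝ) × ((Fin n → ℝ) × ℝ) | floorVec w.2.1 = 0 ∧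
      (toReal (floorVec (k • w.1)) + w.2.1, w.2.2) ∈ E} =
      ⋃ v, {x : Fin n → ℝ | floorVec (k • x) = v} ×ˢ τ v := by
    ext w
    simp only [Set.mem_iUnion, Set.mem_prod, hτ', Set.mem_ofPred_eq]
    exact ⟨fun h => ⟨_, rfl, h⟩, fun ⟨v, hv, h⟩ => by rw [hv]; exact h⟩
  have hEU : E = ⋃ v, E' v := by
    ext x
    simp [E']
  rw [hU, measure_iUnion _ fun v => (hfloor v).prod (hτ v)]
  · have h1 : ∀ v, volume ({x : Fin n → ℝ | floorVec (k • x) = v} ×ˢ τ v) =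
        ENNReal.ofReal k⁻¹ ^ n * volume (E' v) := by
      intro v
      rw [Measure.volume_eq_prod, Measure.prod_prod, volume_floorVec_smul_eq hk]
      congr 1
      exact measure_preimage_add volume _ _
    simp_rw [h1]
    rw [ENNReal.tsum_mul_left]
    congr 1
    conv_rhs => rw [hEU]
    rw [measure_iUnion _ hE']
    intro v w hvw
    refine Set.disjoint_left.2 fun x hx hx' => hvw ?_
    exact hx.2.symm.trans hx'.2
  · intro v w hvw
    refine Set.disjoint_left.2 fun x hx hx' => hvw ?_
    exact hx.1.symm.trans hx'.1

/-- A sum of natural numbers can be lowered to any smaller value by lowering its terms. -/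
theorem exists_le_sum_eq {ι : Type*} (s : Finset ι) (g : ι → ℕ) (k : ℕ) (hk : k ≤ ∑ i ∈ s, g i) :
    ∃ f : ι → ℕ, (∀ i, f i ≤ g i) ∧ ∑ i ∈ s, f i = k := by
  classical
  induction k with
  | zero => exact ⟨0, fun i => Nat.zero_le _, by simp⟩
  | succ k ih =>
    obtain ⟨f, hf, hfk⟩ := ih (by omega)
    obtain ⟨i, hi, hlt⟩ : ∃ i ∈ s, f i < g i := by
      by_contra! h
      have := Finset.sum_le_sum h
      omega
    refine ⟨Function.update f i (f i + 1), fun j => ?_, ?_⟩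
    · by_cases h : j = i
      · subst h; simpa using hlt
      · simpa [h] using hf j
    · rw [← Finset.add_sum_erase _ _ hi, Function.update_self,
        Finset.sum_congr rfl fun j hj => Function.update_of_ne (Finset.ne_of_mem_erase hj) _ _]
      rw [← Finset.add_sum_erase _ _ hi] at hfk
      omega

/-- Rounding down the coefficients of a convex representation shows that `(k + s)P` is covered by
the translates of `sP` by lattice points of `kP` as soon as `s` is at least the number of
generators. -/
theorem snd_lt_card_of_mem_excessRegion {A : Finset (Fin n → ℤ)} (hA : A.Nonempty) {k : ℕ}
    {x : (Fin n → ℝ) × ℝ}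
    (hx : x ∈ excessRegion (convexHull ℝ (toReal '' (A : Set (Fin n → ℤ)))) k) :
    x.2 < A.card := by
  obtain ⟨h0, hC, hu⟩ := hx
  by_contra! hcon
  have hconv := convex_convexHull ℝ (toReal '' (A : Set (Fin n → ℤ)))
  have hne : (convexHull ℝ (toReal '' (A : Set (Fin n → ℤ)))).Nonempty :=
    (hA.to_set.image _).convexHull
  have hmem : ∀ a ∈ A, toRealPair (a, 1) ∈
      coneOver (convexHull ℝ (toReal '' (A : Set (Fin n → ℤ)))) := fun a ha =>
    mk_one_mem_coneOver (subset_convexHull ℝ _ (Set.mem_image_of_mem _ ha))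
  obtain ⟨c, hc, hct, hcy⟩ := exists_sum_eq_of_mem_smul_convexHull hC.1 hC.2
  simp only at hct hcy
  have hk : k ≤ ∑ a ∈ A, ⌊c a⌋₊ := by
    have h1 : ∑ a ∈ A, c a ≤ ∑ a ∈ A, ((⌊c a⌋₊ : ℝ) + 1) :=
      Finset.sum_le_sum fun a _ => (Nat.lt_floor_add_one _).le
    rw [hct, Finset.sum_add_distrib, Finset.sum_const, nsmul_eq_mul, mul_one] at h1
    have h2 : (k : ℝ) ≤ ((∑ a ∈ A, ⌊c a⌋₊ : ℕ) : ℝ) := by push_cast; linarith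
    exact_mod_cast h2
  obtain ⟨f, hf, hfk⟩ := exists_le_sum_eq A _ k hk
  have hfk' : ∑ a ∈ A, (f a : ℝ) = k := by exact_mod_cast hfk
  have e1 : toRealPair (∑ a ∈ A, f a • a, (k : ℤ)) = ∑ a ∈ A, (f a : ℝ) • toRealPair (a, 1) := by
    have h : ((∑ a ∈ A, f a • a, (k : ℤ)) : (Fin n → ℤ) × ℤ) = ∑ a ∈ A, f a • (a, (1 : ℤ)) := by
      ext1
      · simp [Prod.fst_sum]
      · rw [sum_nsmul_snd, hfk]
    rw [h, toRealPair_sum]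
    exact Finset.sum_congr rfl fun a _ => toRealPair_nsmul _ _
  refine hu (∑ a ∈ A, f a • a) ?_ ?_
  · rw [e1]
    exact sum_mem_coneOver hconv hne _ _ fun a ha =>
      smul_mem_coneOver (hmem a ha) (Nat.cast_nonneg _)
  · have e2 : (x.1 - toReal (∑ a ∈ A, f a • a), x.2) =
        ∑ a ∈ A, (c a - f a) • toRealPair (a, 1) := by
      simp only [sub_smul, Finset.sum_sub_distrib]
      rw [← e1]
      ext1
      · simp only [Prod.fst_sub, Prod.fst_sum, Prod.smul_fst, toRealPair]
        rw [hcy]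
      · simp only [Prod.snd_sub, Prod.snd_sum, Prod.smul_snd, toRealPair, Int.cast_one,
          smul_eq_mul, mul_one, Int.cast_natCast, hct]
        ring
    rw [e2]
    refine sum_mem_coneOver hconv hne _ _ fun a ha => smul_mem_coneOver (hmem a ha) ?_
    rw [sub_nonneg]
    exact (Nat.cast_le.2 (hf a)).trans (Nat.floor_le (hc a))

theorem norm_sub_floorVec_le {q : ℝ} (hq : 0 < q) (x : Fin n → ℝ) :
    ‖x - q⁻¹ • toReal (floorVec (q • x))‖ ≤ q⁻¹ :=
  (norm_fst_le _).trans (norm_sub_floorPair_le hq (x, 0))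

/-- The volume of the excess region of `kP` is asymptotically `kⁿ` times the volume of `P` times the
volume of the uncovered region. By averaging it is `kⁿ` times the volume of the set of `(x, z, s)`
with `(⌊kx⌋ + z, s)` in the excess region. These sets converge to `P ×ˢ uncoveredRegion P`: for `x`
interior to `P` each lattice translate that can cover `z` is eventually available. -/
theorem tendsto_volume_excessRegion {A : Finset (Fin n → ℤ)} (hA : A.Nonempty)
    {P : Set (Fin n → ℝ)} (hPA : P = convexHull ℝ (toReal '' (A : Set (Fin n → ℤ)))) :
    volume (P ×ˢ uncoveredRegion P) ≠ ∞ ∧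
    Tendsto (fun k : ℕ => volume.real (excessRegion P k) / (k : ℝ) ^ n) atTop
      (𝓝 (volume.real P * volume.real (uncoveredRegion P))) := by
  have hP : IsCompact P := by
    rw [hPA]; exact (A.finite_toSet.image _).isCompact_convexHull (𝕜 := ℝ)
  have hconv : Convex ℝ P := by rw [hPA]; exact convex_convexHull ℝ _
  obtain ⟨R, hR⟩ := (isBounded_coneOver_snd_le hP.isBounded (1 + A.card)).subset_closedBall 0
  let F : ℕ → Set ((Fin n → ℝ) × ((Fin n → ℝ) × ℝ)) := fun k => {w | floorVec w.2.1 = 0 ∧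
      (toReal (floorVec ((k : ℝ) • w.1)) + w.2.1, w.2.2) ∈ excessRegion P k}
  have htr : Measurable (toReal : (Fin n → ℤ) → Fin n → ℝ) := measurable_of_countable _
  have hFm : ∀ k, MeasurableSet (F k) := by
    intro k
    refine MeasurableSet.inter ((measurable_floorVec.comp (measurable_fst.comp measurable_snd))
      (measurableSet_singleton 0)) ?_
    have hm : Measurable fun w : (Fin n → ℝ) × ((Fin n → ℝ) × ℝ) =>
        (toReal (floorVec ((k : ℝ) • w.1)) + w.2.1, w.2.2) :=
      ((htr.comp (measurable_floorVec.comp (measurable_fst.const_smul (k : ℝ)))).add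
        (measurable_fst.comp measurable_snd)).prodMk (measurable_snd.comp measurable_snd)
    exact hm (measurableSet_excessRegion hP k)
  have hFsub : ∀ᶠ k : ℕ in atTop, F k ⊆
      Metric.closedBall 0 (R + 2) ×ˢ (Metric.closedBall 0 1 ×ˢ Metric.closedBall 0 (A.card : ℝ)) := by
    filter_upwards [eventually_gt_atTop 0] with k hk w hw
    have hk' : (0 : ℝ) < k := by exact_mod_cast hk
    have hk1 : (1 : ℝ) ≤ k := by exact_mod_cast hk
    obtain ⟨hz, hE⟩ := hw
    have hs0 : 0 ≤ w.2.2 := hE.1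
    have hs : w.2.2 < A.card := by
      subst hPA
      have h := snd_lt_card_of_mem_excessRegion hA hE
      exact h
    have hz1 : ‖w.2.1‖ ≤ 1 := by
      have := norm_sub_floorVec_le one_pos w.2.1
      simpa [hz] using this
    refine ⟨?_, mem_closedBall_zero_iff.2 hz1, ?_⟩
    · have h1 : (k : ℝ)⁻¹ • (toReal (floorVec ((k : ℝ) • w.1)) + w.2.1, (k : ℝ) + w.2.2) ∈
          coneOver P ∩ {x | x.2 ≤ 1 + A.card} := by
        refine ⟨smul_mem_coneOver hE.2.1 (by positivity), ?_⟩
        change (k : ℝ)⁻¹ * (k + w.2.2) ≤ 1 + A.card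
        rw [inv_mul_le_iff₀ hk']
        nlinarith
      have h2 := (norm_fst_le _).trans (mem_closedBall_zero_iff.1 (hR h1))
      have h2' : ‖(k : ℝ)⁻¹ • toReal (floorVec ((k : ℝ) • w.1)) + (k : ℝ)⁻¹ • w.2.1‖ ≤ R := by
        rw [← smul_add]
        exact h2
      have h3 := norm_sub_floorVec_le hk' w.1
      have h4 : (k : ℝ)⁻¹ ≤ 1 := inv_le_one_of_one_le₀ hk1
      have h5 : ‖(k : ℝ)⁻¹ • w.2.1‖ ≤ 1 := by
        rw [norm_smul, Real.norm_of_nonneg (by positivity)]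
        exact mul_le_one₀ h4 (norm_nonneg _) hz1
      have e : w.1 = (w.1 - (k : ℝ)⁻¹ • toReal (floorVec ((k : ℝ) • w.1))) +
          ((k : ℝ)⁻¹ • toReal (floorVec ((k : ℝ) • w.1)) + (k : ℝ)⁻¹ • w.2.1) -
          (k : ℝ)⁻¹ • w.2.1 := by abel
      rw [mem_closedBall_zero_iff, e]
      refine (norm_sub_le _ _).trans ?_
      have h6 := norm_add_le (w.1 - (k : ℝ)⁻¹ • toReal (floorVec ((k : ℝ) • w.1)))
        ((k : ℝ)⁻¹ • toReal (floorVec ((k : ℝ) • w.1)) + (k : ℝ)⁻¹ • w.2.1)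
      linarith
    · rw [mem_closedBall_zero_iff, Real.norm_of_nonneg hs0]
      exact hs.le
  have hBfin : volume ((Metric.closedBall 0 (R + 2) ×ˢ
      (Metric.closedBall 0 1 ×ˢ Metric.closedBall 0 (A.card : ℝ)) :
        Set ((Fin n → ℝ) × ((Fin n → ℝ) × ℝ)))) ≠ ∞ :=
    ((isCompact_closedBall _ _).prod
      ((isCompact_closedBall _ _).prod (isCompact_closedBall _ _))).measure_lt_top.ne
  have hlim : ∀ᵐ w : (Fin n → ℝ) × ((Fin n → ℝ) × ℝ), ∀ᶠ k : ℕ in atTop,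
      w ∈ F k ↔ w ∈ P ×ˢ uncoveredRegion P := by
    have h0 : ∀ᵐ x : Fin n → ℝ, x ∉ frontier P :=
      measure_eq_zero_iff_ae_notMem.1 (hconv.addHaar_frontier volume)
    have h1 : ∀ᵐ w : (Fin n → ℝ) × ((Fin n → ℝ) × ℝ), w.1 ∉ frontier P :=
      Measure.quasiMeasurePreserving_fst.ae h0
    filter_upwards [h1] with w hw
    obtain ⟨x, z, s⟩ := w
    simp only at hw
    by_cases hz : floorVec z = 0
    swap
    · exact Eventually.of_forall fun k => iff_of_false (fun h => hz h.1) (fun h => hz h.2.1)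
    by_cases hs : 0 ≤ s
    swap
    · exact Eventually.of_forall fun k => iff_of_false (fun h => hs h.2.1) (fun h => hs h.2.2.1)
    -- `(⌊kx⌋ + y) / (k + r)` tends to `x`
    have hconv' : ∀ (y : Fin n → ℝ) (r : ℝ), Tendsto (fun k : ℕ =>
        ((k : ℝ) + r)⁻¹ • (toReal (floorVec ((k : ℝ) • x)) + y)) atTop (𝓝 x) := by
      intro y r
      have h2 : Tendsto (fun k : ℕ => (k : ℝ) / ((k : ℝ) + r)) atTop (𝓝 1) :=
        tendsto_natCast_div_add_atTop r
      have h3 : Tendsto (fun k : ℕ => (k : ℝ)⁻¹ • y) atTop (𝓝 0) := by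
        have := (tendsto_inv_atTop_nhds_zero_nat (𝕜 := ℝ)).smul_const y
        rwa [zero_smul] at this
      have h4 := h2.smul ((tendsto_floorVec x).add h3)
      rw [add_zero, one_smul] at h4
      refine h4.congr' ?_
      filter_upwards [eventually_gt_atTop 0] with k hk
      have hk' : (k : ℝ) ≠ 0 := by positivity
      rw [← smul_add, smul_smul, div_eq_mul_inv, mul_right_comm, mul_inv_cancel₀ hk', one_mul]
    have hpos : ∀ᶠ k : ℕ in atTop, (0 : ℝ) < k := by
      filter_upwards [eventually_gt_atTop 0] with k hk
      exact_mod_cast hk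
    by_cases hx : x ∈ P
    · have hint : x ∈ interior P := by
        by_contra h
        exact hw ⟨subset_closure hx, h⟩
      have hopen := isOpen_interior.mem_nhds hint
      by_cases hcov : ∃ v : Fin n → ℤ, (z - toReal v, s) ∈ coneOver P
      -- if `v + sP` covers `z`, then `⌊kx⌋ + v` is eventually a lattice point of `kP`
      · obtain ⟨v, hv⟩ := hcov
        filter_upwards [(hconv' (toReal v) 0).eventually hopen, hpos] with k hk hk0
        refine iff_of_false (fun h => ?_) (fun h => h.2.2.2 v hv)
        refine h.2.2.2 (floorVec ((k : ℝ) • x) + v) ?_ ?_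
        · change (toReal (floorVec ((k : ℝ) • x) + v), ((k : ℤ) : ℝ)) ∈ coneOver P
          rw [Int.cast_natCast, mem_coneOver_iff_of_pos hk0, toReal_add]
          rw [add_zero] at hk
          exact interior_subset hk
        · rw [toReal_add, add_sub_add_left_eq_sub]
          exact hv
      · push Not at hcov
        filter_upwards [(hconv' z s).eventually hopen, hpos] with k hk hk0
        refine iff_of_true ⟨hz, hs, ?_, fun u _ => ?_⟩ ⟨hx, hz, hs, hcov⟩
        · rw [mem_coneOver_iff_of_pos (by positivity)]
          exact interior_subset hk
        · have h := hcov (u - floorVec ((k : ℝ) • x))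
          rw [toReal_sub] at h
          convert h using 3
          simp only
          abel
    · filter_upwards [(hconv' z s).eventually (hP.isClosed.isOpen_compl.mem_nhds hx), hpos]
        with k hk hk0
      refine iff_of_false (fun h => hk ?_) (fun h => hx h.1)
      have h2 := h.2.2.1
      rwa [mem_coneOver_iff_of_pos (by simp only; positivity)] at h2
  have hprod : MeasurableSet (P ×ˢ uncoveredRegion P) :=
    hP.isClosed.measurableSet.prod (measurableSet_uncoveredRegion hP)
  have key := tendsto_measure_of_ae_tendsto_indicator (μ := volume) atTop hprod hFm
    (Metric.isClosed_closedBall.prod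
      (Metric.isClosed_closedBall.prod Metric.isClosed_closedBall)).measurableSet hBfin hFsub hlim
  have hfin : volume (P ×ˢ uncoveredRegion P) ≠ ∞ := by
    refine (lt_of_le_of_lt (le_of_tendsto key ?_) (lt_top_iff_ne_top.2 hBfin)).ne
    filter_upwards [hFsub] with k hk
    exact measure_mono hk
  have key' := (ENNReal.tendsto_toReal hfin).comp key
  have e1 : (volume (P ×ˢ uncoveredRegion P)).toReal =
      volume.real P * volume.real (uncoveredRegion P) := by
    rw [Measure.volume_eq_prod, Measure.prod_prod, ENNReal.toReal_mul]
    rfl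
  rw [e1] at key'
  refine ⟨hfin, key'.congr' ?_⟩
  filter_upwards [eventually_gt_atTop 0] with k hk
  have hk' : (0 : ℝ) < k := by exact_mod_cast hk
  change (volume (F k)).toReal = _
  rw [volume_floorVec_add_mem hk' (measurableSet_excessRegion hP k), ENNReal.toReal_mul,
    ENNReal.toReal_pow, ENNReal.toReal_ofReal (by positivity), inv_pow, div_eq_inv_mul]
  rfl

/-! ### Lattice translates of a set and their overlaps -/

/-- The half-open unit cube `[0, 1)ⁿ`. -/
def unitCell (n : ℕ) : Set (Fin n → ℝ) := {z | floorVec z = 0}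

/-- The union of the lattice translates of `B`. -/
def latticeCover (B : Set (Fin n → ℝ)) : Set (Fin n → ℝ) := {z | ∃ v : Fin n → ℤ, z - toReal v ∈ B}

/-- The intersection of the translates of `B` by `v` and by `w`. -/
def latticeOverlap (B : Set (Fin n → ℝ)) (v w : Fin n → ℤ) : Set (Fin n → ℝ) :=
  {z | z - toReal v ∈ B ∧ z - toReal w ∈ B}

theorem measurableSet_unitCell : MeasurableSet (unitCell n) :=
  measurable_floorVec (measurableSet_singleton 0)

theorem volume_unitCell : volume (unitCell n) = 1 := by
  have h := volume_floorVec_smul_eq (n := n) one_pos 0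
  simpa [unitCell] using h

theorem measurableSet_translate {B : Set (Fin n → ℝ)} (hB : MeasurableSet B) (v : Fin n → ℤ) :
    MeasurableSet {z | z - toReal v ∈ B} := (measurable_id.sub_const _) hB

theorem latticeCover_eq_iUnion (B : Set (Fin n → ℝ)) :
    latticeCover B = ⋃ v : Fin n → ℤ, {z | z - toReal v ∈ B} := by
  ext z; simp [latticeCover]

theorem measurableSet_latticeCover {B : Set (Fin n → ℝ)} (hB : MeasurableSet B) :
    MeasurableSet (latticeCover B) := by
  rw [latticeCover_eq_iUnion]
  exact MeasurableSet.iUnion fun v => measurableSet_translate hB v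

/-- The volume of a set is the total volume of the parts of its lattice translates in the unit cube,
since the translates of the unit cube partition the space. -/
theorem volume_eq_tsum {X : Set (Fin n → ℝ)} (hX : MeasurableSet X) :
    volume X = ∑' v : Fin n → ℤ, volume (unitCell n ∩ {z | z - toReal v ∈ X}) := by
  have hE : ∀ v : Fin n → ℤ, MeasurableSet (X ∩ {z | floorVec z = -v}) := fun v =>
    hX.inter (measurable_floorVec (measurableSet_singleton (-v)))
  have hU : X = ⋃ v : Fin n → ℤ, X ∩ {z | floorVec z = -v} := by
    ext z
    simp only [Set.mem_iUnion]
    exact ⟨fun h => ⟨-floorVec z, h, (neg_neg _).symm⟩, fun ⟨_, h, _⟩ => h⟩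
  conv_lhs => rw [hU]
  rw [measure_iUnion _ hE]
  · refine tsum_congr fun v => ?_
    rw [← (measurePreserving_sub_right volume (toReal v)).measure_preimage
      (hE v).nullMeasurableSet]
    congr 1
    ext z
    have h : floorVec (z - toReal v) = -v ↔ floorVec z = 0 := by
      simp only [funext_iff, floorVec, toReal, Pi.sub_apply, Int.floor_sub_intCast, Pi.neg_apply,
        Pi.zero_apply]
      exact forall_congr' fun i => by omega
    exact (and_congr_right fun _ => h).trans and_comm
  · intro v w hvw
    refine Set.disjoint_left.2 fun x hx hx' => hvw ?_
    exact neg_injective (hx.2.symm.trans hx'.2)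

theorem volume_unitCell_inter_latticeCover_le {B : Set (Fin n → ℝ)} (hB : MeasurableSet B) :
    volume (unitCell n ∩ latticeCover B) ≤ volume B := by
  rw [volume_eq_tsum hB, latticeCover_eq_iUnion, Set.inter_iUnion]
  exact measure_iUnion_le _

/-- The lattice translates of `B` cover as much of the unit cube as they can if and only if they
overlap in null sets. -/
theorem volume_unitCell_inter_latticeCover_eq_iff {B : Set (Fin n → ℝ)} (hB : MeasurableSet B)
    (hfin : volume B ≠ ∞) :
    volume (unitCell n ∩ latticeCover B) = volume B ↔
      ∀ v w : Fin n → ℤ, v ≠ w → volume (latticeOverlap B v w) = 0 := by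
  classical
  set X : (Fin n → ℤ) → Set (Fin n → ℝ) := fun v => unitCell n ∩ {z | z - toReal v ∈ B} with hX
  have hXm : ∀ v, MeasurableSet (X v) := fun v =>
    measurableSet_unitCell.inter (measurableSet_translate hB v)
  have hcov : unitCell n ∩ latticeCover B = ⋃ v, X v := by
    rw [latticeCover_eq_iUnion, Set.inter_iUnion]
  constructor
  · intro heq v w hvw
    -- an overlap inside the unit cube is counted twice
    have key : ∀ v w : Fin n → ℤ, v ≠ w → volume (X v ∩ X w) = 0 := by
      intro v w hvw
      set Y : Set (Fin n → ℝ) := ⋃ u, (if u = v then ∅ else X u) with hY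
      have hYm : MeasurableSet Y := MeasurableSet.iUnion fun u => by
        split_ifs
        · exact MeasurableSet.empty
        · exact hXm u
      have h1 : ⋃ u, X u = X v ∪ Y := by
        ext z
        simp only [hY, Set.mem_iUnion, Set.mem_union]
        constructor
        · rintro ⟨u, hu⟩
          by_cases h : u = v
          · exact Or.inl (h ▸ hu)
          · exact Or.inr ⟨u, by rwa [if_neg h]⟩
        · rintro (h | ⟨u, hu⟩)
          · exact ⟨v, h⟩
          · by_cases h : u = v
            · rw [if_pos h] at hu; exact hu.elim
            · rw [if_neg h] at hu; exact ⟨u, hu⟩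
      have h2 : volume (X v ∪ Y) + volume (X v ∩ Y) ≤ volume B := by
        rw [measure_union_add_inter _ hYm, volume_eq_tsum hB,
          ENNReal.tsum_eq_add_tsum_ite v]
        refine add_le_add le_rfl ((measure_iUnion_le _).trans (ENNReal.tsum_le_tsum fun u => ?_))
        split_ifs
        · simp
        · exact le_rfl
      rw [← h1, ← hcov, heq] at h2
      have h3 : volume (X v ∩ Y) = 0 := by
        have h4 : volume B + volume (X v ∩ Y) ≤ volume B + 0 := by rwa [add_zero]
        exact le_antisymm ((ENNReal.add_le_add_iff_left hfin).1 h4) (zero_le)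
      refine measure_mono_null ?_ h3
      refine Set.inter_subset_inter_right _ fun z hz => Set.mem_iUnion.2 ⟨w, ?_⟩
      rwa [if_neg hvw.symm]
    have hOm : MeasurableSet (latticeOverlap B v w) :=
      (measurableSet_translate hB v).inter (measurableSet_translate hB w)
    rw [volume_eq_tsum hOm, ENNReal.tsum_eq_zero]
    intro r
    refine measure_mono_null ?_ (key (v + r) (w + r) fun h => hvw (add_right_cancel h))
    rintro z ⟨hz, h1, h2⟩
    refine ⟨⟨hz, ?_⟩, hz, ?_⟩
    · change z - toReal (v + r) ∈ B
      rw [toReal_add, add_comm, ← sub_sub]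
      exact h1
    · change z - toReal (w + r) ∈ B
      rw [toReal_add, add_comm, ← sub_sub]
      exact h2
  · intro h
    rw [volume_eq_tsum hB, hcov]
    refine measure_iUnion₀ (fun v w hvw => ?_) fun v => (hXm v).nullMeasurableSet
    refine measure_mono_null ?_ (h v w hvw)
    exact fun z hz => ⟨hz.1.2, hz.2.2⟩

theorem convex_latticeOverlap {B : Set (Fin n → ℝ)} (hB : Convex ℝ B) (v w : Fin n → ℤ) :
    Convex ℝ (latticeOverlap B v w) := by
  have h (u : Fin n → ℤ) : {z | z - toReal u ∈ B} = toReal u +ᵥ B := by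
    ext z
    rw [Set.mem_vadd_set_iff_neg_vadd_mem, vadd_eq_add, neg_add_eq_sub]
    rfl
  have e : latticeOverlap B v w = (toReal v +ᵥ B) ∩ (toReal w +ᵥ B) := by
    rw [← h, ← h]; rfl
  rw [e]
  exact (hB.vadd _).inter (hB.vadd _)

/-- A convex set is a null set if and only if its affine hull has smaller dimension. -/
theorem finrank_vectorSpan_lt_iff (hn : 0 < n) {O : Set (Fin n → ℝ)} (hO : Convex ℝ O) :
    Module.finrank ℝ (vectorSpan ℝ O) < n ↔ volume O = 0 := by
  rcases O.eq_empty_or_nonempty with rfl | hne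
  · rw [vectorSpan_empty, finrank_bot]
    exact iff_of_true hn measure_empty
  constructor
  · intro h
    have h1 : affineSpan ℝ O ≠ ⊤ := by
      intro h2
      have h3 : vectorSpan ℝ O = ⊤ := by
        rw [← direction_affineSpan, h2, AffineSubspace.direction_top]
      rw [h3, finrank_top, Module.finrank_fin_fun] at h
      exact lt_irrefl _ h
    exact measure_mono_null (subset_affineSpan ℝ O) (Measure.addHaar_affineSubspace volume _ h1)
  · intro h
    have h1 : interior O = ∅ :=
      (isOpen_interior.measure_eq_zero_iff volume).1 (measure_mono_null interior_subset h)
    have h2 : affineSpan ℝ O ≠ ⊤ := fun h2 => by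
      have := hO.interior_nonempty_iff_affineSpan_eq_top.2 h2
      rw [h1] at this
      exact Set.not_nonempty_empty this
    have h3 : vectorSpan ℝ O ≠ ⊤ := fun h3 =>
      h2 ((AffineSubspace.affineSpan_eq_top_iff_vectorSpan_eq_top_of_nonempty ℝ _ _ hne).2 h3)
    have h4 := Submodule.finrank_lt h3
    rwa [Module.finrank_fin_fun] at h4

theorem image_add_smul_eq {P : Set (Fin n → ℝ)} (t : ℝ) (v : Fin n → ℤ) :
    (fun x => toReal v + t • x) '' P = {z | z - toReal v ∈ t • P} := by
  ext z
  constructor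
  · rintro ⟨x, hx, rfl⟩
    exact ⟨x, hx, by simp⟩
  · rintro ⟨x, hx, h⟩
    refine ⟨x, hx, ?_⟩
    simp only at h ⊢
    rw [h]
    abel

/-- In the definition of a tiling, overlaps of smaller dimension are the same as overlaps of volume
zero. -/
theorem tilesSpace_iff (hn : 0 < n) {P : Set (Fin n → ℝ)} (hP : Convex ℝ P) :
    TilesSpace P ↔ ∃ t : ℝ, 0 < t ∧ latticeCover (t • P) = Set.univ ∧
      ∀ v w : Fin n → ℤ, v ≠ w → volume (latticeOverlap (t • P) v w) = 0 := by
  unfold TilesSpace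
  refine exists_congr fun t => and_congr_right fun _ => and_congr ?_ ?_
  · rw [latticeCover_eq_iUnion]
    simp only [image_add_smul_eq]
  · refine forall₂_congr fun v w => imp_congr_right fun _ => ?_
    rw [image_add_smul_eq, image_add_smul_eq]
    exact finrank_vectorSpan_lt_iff hn (convex_latticeOverlap (hP.smul t) v w)

theorem isClosed_latticeCover {B : Set (Fin n → ℝ)} (hB : IsCompact B) :
    IsClosed (latticeCover B) := by
  have h1 : IsClosed (Set.range (toReal : (Fin n → ℤ) → Fin n → ℝ)) := by
    have e : Set.range (toReal : (Fin n → ℤ) → Fin n → ℝ) =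
        Set.pi Set.univ fun _ => Set.range ((↑) : ℤ → ℝ) := by
      ext z
      simp only [Set.mem_range, Set.mem_pi, Set.mem_univ, true_imp_iff]
      constructor
      · rintro ⟨v, rfl⟩ i
        exact ⟨v i, rfl⟩
      · intro h
        choose v hv using h
        exact ⟨v, funext hv⟩
    rw [e]
    exact isClosed_set_pi fun _ _ => Int.isClosedEmbedding_coe_real.isClosed_range
  have e : latticeCover B = Set.range (toReal : (Fin n → ℤ) → Fin n → ℝ) + B := by
    ext z
    constructor
    · rintro ⟨v, hv⟩
      exact ⟨_, ⟨v, rfl⟩, _, hv, by simp⟩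
    · rintro ⟨_, ⟨v, rfl⟩, b, hb, rfl⟩
      exact ⟨v, by simpa using hb⟩
  rw [e]
  exact h1.add_right_of_isCompact hB

/-- A closed union of lattice translates that covers almost all of the unit cube is everything. -/
theorem latticeCover_eq_univ {B : Set (Fin n → ℝ)} (hB : IsCompact B)
    (h : volume (unitCell n ∩ latticeCover B) = 1) : latticeCover B = Set.univ := by
  have hcl := isClosed_latticeCover hB
  have h0 : volume (unitCell n \ latticeCover B) = 0 := by
    have h1 := measure_inter_add_sdiff (μ := volume) (unitCell n) hcl.measurableSet
    rw [h, volume_unitCell] at h1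
    have h2 : (1 : ℝ≥0∞) + volume (unitCell n \ latticeCover B) ≤ 1 + 0 := by rw [h1, add_zero]
    exact le_antisymm ((ENNReal.add_le_add_iff_left ENNReal.one_ne_top).1 h2) (zero_le)
  have h1 : volume (latticeCover B)ᶜ = 0 := by
    rw [volume_eq_tsum hcl.measurableSet.compl, ENNReal.tsum_eq_zero]
    intro v
    refine measure_mono_null ?_ h0
    rintro z ⟨hz, hzv⟩
    refine ⟨hz, fun ⟨w, hw⟩ => hzv ⟨w - v, ?_⟩⟩
    rwa [toReal_sub, sub_sub_sub_cancel_right]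
  rw [← Set.compl_empty_iff]
  exact (hcl.isOpen_compl.measure_eq_zero_iff volume).1 h1

/-! ### The volume of the uncovered region -/

theorem volume_smul_eq {P : Set (Fin n → ℝ)} (hP : IsCompact P) {s : ℝ} (hs : 0 ≤ s) :
    volume (s • P) = ENNReal.ofReal (s ^ n * volume.real P) := by
  rw [Measure.addHaar_smul, Module.finrank_fin_fun, abs_of_nonneg (pow_nonneg hs n),
    ENNReal.ofReal_mul (pow_nonneg hs n), ofReal_measureReal hP.measure_lt_top.ne]

/-- The larger multiples of a convex set contain translates of the smaller ones. -/
theorem add_smul_mem_smul {P : Set (Fin n → ℝ)} (hP : Convex ℝ P) {p : Fin n → ℝ} (hp : p ∈ P)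
    {s t : ℝ} (hs : 0 ≤ s) (hst : s ≤ t) {y : Fin n → ℝ} (hy : y ∈ s • P) :
    y + (t - s) • p ∈ t • P := by
  have h : t • P = s • P + (t - s) • P := by
    rw [← hP.add_smul hs (sub_nonneg.2 hst), add_sub_cancel]
  rw [h]
  exact Set.add_mem_add hy (Set.smul_mem_smul_set hp)

theorem slice_uncoveredRegion {P : Set (Fin n → ℝ)} {s : ℝ} (hs : 0 ≤ s) :
    (fun z => (z, s)) ⁻¹' uncoveredRegion P = unitCell n \ latticeCover (s • P) := by
  ext z
  constructor
  · rintro ⟨h1, -, h2⟩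
    exact ⟨h1, fun ⟨v, hv⟩ => h2 v ⟨hs, hv⟩⟩
  · rintro ⟨h1, h2⟩
    exact ⟨h1, hs, fun v hv => h2 ⟨v, hv.2⟩⟩

theorem volume_inter_add_slice {P : Set (Fin n → ℝ)} (hP : IsCompact P) {s : ℝ} (hs : 0 ≤ s) :
    volume (unitCell n ∩ latticeCover (s • P)) +
      volume ((fun z => (z, s)) ⁻¹' uncoveredRegion P) = 1 := by
  rw [slice_uncoveredRegion hs, ← volume_unitCell (n := n)]
  exact measure_inter_add_sdiff _ (measurableSet_latticeCover (hP.smul s).isClosed.measurableSet)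

theorem lintegral_indicator_one_sub_pow {l V : ℝ} (hl : 0 < l) (hV : 0 ≤ V) (hlV : l ^ n * V = 1) :
    ∫⁻ s, (Set.Icc 0 l).indicator (fun s => ENNReal.ofReal (1 - s ^ n * V)) s =
      ENNReal.ofReal (l * n / (n + 1)) := by
  rw [lintegral_indicator measurableSet_Icc, ← ofReal_integral_eq_lintegral_ofReal]
  · rw [integral_Icc_eq_integral_Ioc, ← intervalIntegral.integral_of_le hl.le,
      intervalIntegral.integral_sub (by simp) (by
        exact (Continuous.intervalIntegrable (by fun_prop) _ _)),
      intervalIntegral.integral_mul_const, integral_pow]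
    congr 1
    have hn : (n : ℝ) + 1 ≠ 0 := by positivity
    rw [pow_succ l n]
    simp only [intervalIntegral.integral_const, sub_zero, smul_eq_mul, mul_one, zero_pow
      (Nat.succ_ne_zero n)]
    field_simp
    linear_combination (-1 : ℝ) * hlV
  · exact (Continuous.continuousOn (by fun_prop)).integrableOn_compact isCompact_Icc
  · refine (ae_restrict_iff' measurableSet_Icc).2 (Eventually.of_forall fun s hs => ?_)
    have h1 : s ^ n ≤ l ^ n := pow_le_pow_left₀ hs.1 hs.2 n
    have h2 := mul_le_mul_of_nonneg_right h1 hV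
    change (0 : ℝ) ≤ 1 - s ^ n * V
    linarith

/-- If the lattice translates of `sP` overlap in null sets for `s < l` arbitrarily close to `l`, then
so do those of `lP`: an interior point of an overlap for `l` is also one for all nearby `s`. -/
theorem volume_latticeOverlap_eq_zero_of_frequently {P : Set (Fin n → ℝ)} (hP : Convex ℝ P)
    {l : ℝ} (hl : 0 < l) {v w : Fin n → ℤ}
    (h : ∃ᶠ s in 𝓝 l, volume (latticeOverlap (s • P) v w) = 0) :
    volume (latticeOverlap (l • P) v w) = 0 := by
  by_contra hne
  have hint : (interior (latticeOverlap (l • P) v w)).Nonempty := by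
    by_contra hemp
    rw [Set.not_nonempty_iff_eq_empty] at hemp
    refine hne (measure_mono_null (fun x hx => ?_)
      ((convex_latticeOverlap (hP.smul l) v w).addHaar_frontier volume))
    exact ⟨subset_closure hx, by rw [hemp]; exact Set.notMem_empty x⟩
  obtain ⟨x, hx⟩ := hint
  have hmem : ∀ u : Fin n → ℤ, (∀ z ∈ latticeOverlap (l • P) v w, z - toReal u ∈ l • P) →
      ∀ᶠ s in 𝓝 l, x - toReal u ∈ s • interior P := by
    intro u hu
    have h1 : x - toReal u ∈ interior (l • P) := by
      refine mem_interior.2 ⟨(fun z => z + toReal u) ⁻¹' interior (latticeOverlap (l • P) v w),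
        fun z hz => ?_, isOpen_interior.preimage (by fun_prop), ?_⟩
      · have h2 := hu _ (interior_subset hz)
        rwa [add_sub_cancel_right] at h2
      · rw [Set.mem_preimage, sub_add_cancel]
        exact hx
    rw [interior_smul₀ hl.ne', Set.mem_smul_set_iff_inv_smul_mem₀ hl.ne'] at h1
    have h3 : Tendsto (fun s : ℝ => s⁻¹ • (x - toReal u)) (𝓝 l) (𝓝 (l⁻¹ • (x - toReal u))) :=
      (tendsto_inv₀ hl.ne').smul_const _
    filter_upwards [h3.eventually (isOpen_interior.mem_nhds h1), lt_mem_nhds hl] with s hs hs0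
    rwa [Set.mem_smul_set_iff_inv_smul_mem₀ hs0.ne']
  obtain ⟨s, hs, hsv, hsw, hs0⟩ := (h.and_eventually ((hmem v fun z hz => hz.1).and
    ((hmem w fun z hz => hz.2).and (lt_mem_nhds hl)))).exists
  have hs0' : s ≠ 0 := ne_of_gt hs0
  have hopen : IsOpen {z | z - toReal v ∈ s • interior P ∧ z - toReal w ∈ s • interior P} := by
    have h4 : IsOpen (s • interior P) := isOpen_interior.smul₀ hs0'
    exact (h4.preimage (by fun_prop)).inter (h4.preimage (by fun_prop))
  have hsub : {z | z - toReal v ∈ s • interior P ∧ z - toReal w ∈ s • interior P} ⊆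
      latticeOverlap (s • P) v w := fun z hz =>
    ⟨Set.smul_set_mono interior_subset hz.1, Set.smul_set_mono interior_subset hz.2⟩
  have h5 := (hopen.measure_eq_zero_iff volume).1 (measure_mono_null hsub hs)
  have h6 : x ∈ {z | z - toReal v ∈ s • interior P ∧ z - toReal w ∈ s • interior P} := ⟨hsv, hsw⟩
  rw [h5] at h6
  exact h6

/-- The translates of `sP` cover at most the volume `sⁿ vol(P)` of the unit cube; this bounds the
volume of the uncovered region from below. Here `l` is the factor for which `lP` has volume one.
Equality holds exactly for tilings, in which case the tiling is by translates of `lP`. -/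
theorem le_volume_uncoveredRegion (hn : 0 < n) {P : Set (Fin n → ℝ)} (hP : IsCompact P)
    (hconv : Convex ℝ P) (hfin : volume (uncoveredRegion P) ≠ ∞) {l : ℝ} (hl : 0 < l)
    (hlV : l ^ n * volume.real P = 1) :
    ENNReal.ofReal (l * n / (n + 1)) ≤ volume (uncoveredRegion P) ∧
      (volume (uncoveredRegion P) = ENNReal.ofReal (l * n / (n + 1)) ↔ TilesSpace P) := by
  have hV : 0 ≤ volume.real P := measureReal_nonneg
  set h : ℝ → ℝ≥0∞ := (Set.Icc 0 l).indicator fun s => ENNReal.ofReal (1 - s ^ n * volume.real P)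
    with hh
  set g : ℝ → ℝ≥0∞ := fun s => volume ((fun z => (z, s)) ⁻¹' uncoveredRegion P) with hg
  have hGm := measurableSet_uncoveredRegion hP
  have hgint : volume (uncoveredRegion P) = ∫⁻ s, g s := by
    rw [Measure.volume_eq_prod, Measure.prod_apply_symm hGm]
  have hgm : Measurable g := measurable_measure_prodMk_right hGm
  have hhint : ∫⁻ s, h s = ENNReal.ofReal (l * n / (n + 1)) :=
    lintegral_indicator_one_sub_pow hl hV hlV
  have hsplit : ∀ s, 0 ≤ s → s ≤ l → ENNReal.ofReal (s ^ n * volume.real P) +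
      ENNReal.ofReal (1 - s ^ n * volume.real P) = 1 := by
    intro s hs hsl
    have h1 := mul_le_mul_of_nonneg_right (pow_le_pow_left₀ hs hsl n) hV
    rw [← ENNReal.ofReal_add (by positivity) (by linarith), add_sub_cancel, ENNReal.ofReal_one]
  have hle : ∀ s, 0 ≤ s → volume (unitCell n ∩ latticeCover (s • P)) ≤
      ENNReal.ofReal (s ^ n * volume.real P) := fun s hs => by
    rw [← volume_smul_eq hP hs]
    exact volume_unitCell_inter_latticeCover_le (hP.smul s).isClosed.measurableSet
  have hhg : ∀ s, h s ≤ g s := by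
    intro s
    by_cases hs : s ∈ Set.Icc 0 l
    · rw [hh, Set.indicator_of_mem hs]
      have h1 := volume_inter_add_slice hP hs.1
      have h2 : ENNReal.ofReal (s ^ n * volume.real P) +
          ENNReal.ofReal (1 - s ^ n * volume.real P) ≤
          ENNReal.ofReal (s ^ n * volume.real P) + g s := by
        rw [hsplit s hs.1 hs.2, ← h1]
        exact add_le_add (hle s hs.1) le_rfl
      exact (ENNReal.add_le_add_iff_left ENNReal.ofReal_ne_top).1 h2
    · rw [hh, Set.indicator_of_notMem hs]
      exact zero_le
  have hoverlap : ∀ s, 0 ≤ s → (volume (unitCell n ∩ latticeCover (s • P)) =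
      ENNReal.ofReal (s ^ n * volume.real P) ↔
        ∀ v w : Fin n → ℤ, v ≠ w → volume (latticeOverlap (s • P) v w) = 0) := fun s hs => by
    rw [← volume_smul_eq hP hs]
    exact volume_unitCell_inter_latticeCover_eq_iff (hP.smul s).isClosed.measurableSet
      (hP.smul s).measure_lt_top.ne
  refine ⟨?_, ?_, ?_⟩
  · rw [hgint, ← hhint]
    exact lintegral_mono hhg
  · intro heq
    rw [tilesSpace_iff hn hconv]
    have hae : h =ᵐ[volume] g := by
      refine ae_eq_of_ae_le_of_lintegral_le (Eventually.of_forall hhg) ?_ hgm.aemeasurable ?_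
      · rw [hhint]; exact ENNReal.ofReal_ne_top
      · rw [← hgint, hhint, heq]
    have hnull : ∀ v w : Fin n → ℤ, v ≠ w → volume (latticeOverlap (l • P) v w) = 0 := by
      intro v w hvw
      refine volume_latticeOverlap_eq_zero_of_frequently hconv hl ?_
      -- the two integrands agree somewhere in each left neighbourhood of `l`
      rw [Filter.frequently_iff]
      intro U hU
      obtain ⟨a, ha, haU⟩ := exists_Ioc_subset_of_mem_nhds hU ⟨0, hl⟩
      obtain ⟨s, hs, hsg⟩ : ∃ s ∈ Set.Ioo (max a 0) l, h s = g s := by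
        by_contra! hcon
        have h1 : volume (Set.Ioo (max a 0) l) = 0 :=
          measure_mono_null (fun s hs => hcon s hs) hae
        rw [Real.volume_Ioo, ENNReal.ofReal_eq_zero] at h1
        have : max a 0 < l := max_lt ha hl
        linarith
      have hs0 : 0 < s := (le_max_right _ _).trans_lt hs.1
      refine ⟨s, haU ⟨(le_max_left _ _).trans_lt hs.1, hs.2.le⟩, ?_⟩
      refine (hoverlap s hs0.le).1 ?_ v w hvw
      rw [hh, Set.indicator_of_mem (show s ∈ Set.Icc 0 l from ⟨hs0.le, hs.2.le⟩)] at hsg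
      have h1 := volume_inter_add_slice hP hs0.le
      change _ + g s = 1 at h1
      rw [← hsg, ← hsplit s hs0.le hs.2.le] at h1
      exact (ENNReal.add_left_inj ENNReal.ofReal_ne_top).1 h1
    refine ⟨l, hl, latticeCover_eq_univ (hP.smul l) ?_, hnull⟩
    rw [(hoverlap l hl.le).2 hnull, hlV, ENNReal.ofReal_one]
  · intro htile
    obtain ⟨t, ht, hcov, hnull⟩ := (tilesSpace_iff hn hconv).1 htile
    have htV : t ^ n * volume.real P = 1 := by
      have h1 := (hoverlap t ht.le).2 hnull
      rw [hcov, Set.inter_univ, volume_unitCell, eq_comm, ENNReal.ofReal_eq_one] at h1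
      exact h1
    have htl : t = l := by
      have hV0 : volume.real P ≠ 0 := by
        intro h0
        rw [h0, mul_zero] at htV
        exact zero_ne_one htV
      exact (pow_left_inj₀ ht.le hl.le hn.ne').1 (mul_right_cancel₀ hV0 (htV.trans hlV.symm))
    subst htl
    obtain ⟨p, hp⟩ : P.Nonempty := by
      rw [Set.nonempty_iff_ne_empty]
      rintro rfl
      simp at htV
    rw [hgint, ← hhint]
    refine lintegral_congr fun s => ?_
    rcases lt_or_ge s 0 with hs | hs
    · rw [hh, Set.indicator_of_notMem fun h => not_le.2 hs h.1]
      have : (fun z => (z, s)) ⁻¹' uncoveredRegion P = ∅ := by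
        ext z
        exact iff_of_false (fun h => not_le.2 hs h.2.1) (Set.notMem_empty z)
      rw [hg]
      simp only [this, measure_empty]
    rcases le_or_gt s t with hst | hst
    · rw [hh, Set.indicator_of_mem (show s ∈ Set.Icc 0 t from ⟨hs, hst⟩)]
      -- `sP` has a translate inside `tP`, so its lattice translates overlap in null sets as well
      have h1 : volume (unitCell n ∩ latticeCover (s • P)) =
          ENNReal.ofReal (s ^ n * volume.real P) := by
        refine (hoverlap s hs).2 fun v w hvw => ?_
        have h2 := hnull v w hvw
        rw [← measure_preimage_add_right volume ((t - s) • p)] at h2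
        have hsub : latticeOverlap (s • P) v w ⊆
            (fun z => z + (t - s) • p) ⁻¹' latticeOverlap (t • P) v w := by
          intro z hz
          refine ⟨?_, ?_⟩
          · rw [add_sub_right_comm]
            exact add_smul_mem_smul hconv hp hs hst hz.1
          · rw [add_sub_right_comm]
            exact add_smul_mem_smul hconv hp hs hst hz.2
        exact measure_mono_null hsub h2
      have h3 := volume_inter_add_slice hP hs
      rw [h1, ← hsplit s hs hst] at h3
      exact (ENNReal.add_right_inj ENNReal.ofReal_ne_top).1 h3
    · rw [hh, Set.indicator_of_notMem fun h => not_le.2 hst h.2]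
      -- `sP` contains a translate of `tP`, so its lattice translates cover the space as well
      have h1 : latticeCover (s • P) = Set.univ := by
        rw [Set.eq_univ_iff_forall]
        intro z
        have h2 : z - (s - t) • p ∈ latticeCover (t • P) := by rw [hcov]; trivial
        obtain ⟨v, hv⟩ := h2
        refine ⟨v, ?_⟩
        have h3 := add_smul_mem_smul hconv hp ht.le hst.le hv
        rwa [sub_right_comm, sub_add_cancel] at h3
      rw [hg]
      simp only [slice_uncoveredRegion hs, h1, Set.sdiff_univ, measure_empty]

/-! ### Volumes of the cone and of the excess region -/

theorem volume_preimage_mul_snd {k : ℝ} (hk : 0 < k) {E : Set ((Fin n → ℝ) × ℝ)}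
    (hE : MeasurableSet E) :
    volume {x : (Fin n → ℝ) × ℝ | (x.1, k * x.2) ∈ E} = ENNReal.ofReal k⁻¹ * volume E := by
  have hm : MeasurableSet {x : (Fin n → ℝ) × ℝ | (x.1, k * x.2) ∈ E} :=
    (measurable_fst.prodMk (measurable_snd.const_mul k)) hE
  rw [Measure.volume_eq_prod, Measure.prod_apply hm, Measure.prod_apply hE,
    ← lintegral_const_mul _ (measurable_measure_prodMk_left hE)]
  refine lintegral_congr fun y => ?_
  have h := Real.volume_preimage_mul_left hk.ne' (Prod.mk y ⁻¹' E)
  rw [abs_of_pos (inv_pos.2 hk)] at h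
  exact h

/-- The volume of the part of the cone below height one. -/
theorem volume_coneOver_snd_lt_one {P : Set (Fin n → ℝ)} (hP : IsCompact P) :
    volume.real (coneOver P ∩ {x | x.2 < 1}) = volume.real P / (n + 1) := by
  have hm : MeasurableSet (coneOver P ∩ {x | x.2 < 1}) :=
    (isClosed_coneOver hP).measurableSet.inter (measurableSet_lt measurable_snd measurable_const)
  have h1 : volume (coneOver P ∩ {x | x.2 < 1}) =
      ∫⁻ s, (Set.Ico 0 1).indicator (fun s => ENNReal.ofReal (s ^ n * volume.real P)) s := by
    rw [Measure.volume_eq_prod, Measure.prod_apply_symm hm]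
    refine lintegral_congr fun s => ?_
    by_cases hs : s ∈ Set.Ico (0 : ℝ) 1
    · rw [Set.indicator_of_mem hs, ← volume_smul_eq hP hs.1]
      congr 1
      ext y
      exact ⟨fun h => h.1.2, fun h => ⟨⟨hs.1, h⟩, hs.2⟩⟩
    · rw [Set.indicator_of_notMem hs]
      convert measure_empty (μ := (volume : Measure (Fin n → ℝ)))
      ext y
      exact iff_of_false (fun h => hs ⟨h.1.1, h.2⟩) (Set.notMem_empty y)
  rw [Measure.real, h1, lintegral_indicator measurableSet_Ico,
    ← ofReal_integral_eq_lintegral_ofReal, ENNReal.toReal_ofReal]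
  · rw [integral_Ico_eq_integral_Ioo, ← integral_Ioc_eq_integral_Ioo,
      ← intervalIntegral.integral_of_le zero_le_one, intervalIntegral.integral_mul_const,
      integral_pow]
    simp
    ring
  · refine setIntegral_nonneg measurableSet_Ico fun s hs => ?_
    exact mul_nonneg (pow_nonneg hs.1 n) measureReal_nonneg
  · exact ((Continuous.continuousOn (by fun_prop)).integrableOn_compact isCompact_Icc).mono_set
      Set.Ico_subset_Icc_self
  · refine (ae_restrict_iff' measurableSet_Ico).2 (Eventually.of_forall fun s hs => ?_)
    exact mul_nonneg (pow_nonneg hs.1 n) measureReal_nonneg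

/-- The part of the cone over `kP` that is not covered by its translates by the lattice points of
`kP` at height one consists of the part below height one and, up to an affine change of the last
coordinate, of the excess region. -/
theorem volume_coneOver_compl {A : Finset (Fin n → ℤ)} (hA : A.Nonempty)
    {P : Set (Fin n → ℝ)} (hPA : P = convexHull ℝ (toReal '' (A : Set (Fin n → ℤ)))) {k : ℕ}
    (hk : 0 < k) (B : Finset (Fin n → ℤ)) (hB : ∀ u, u ∈ B ↔ toReal u ∈ (k : ℝ) • P) :
    volume.real {x | x ∈ coneOver ((k : ℝ) • P) ∧
        ∀ u ∈ B, x - toRealPair (u, 1) ∉ coneOver ((k : ℝ) • P)} -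
      volume.real (coneOver ((k : ℝ) • P) ∩ {x | x.2 < 1}) =
    (k : ℝ)⁻¹ * volume.real (excessRegion P k) := by
  have hP : IsCompact P := by
    rw [hPA]; exact (A.finite_toSet.image _).isCompact_convexHull (𝕜 := ℝ)
  have hk' : (0 : ℝ) < k := by exact_mod_cast hk
  have hC := (isClosed_coneOver hP).measurableSet
  have hB' : ∀ u, u ∈ B ↔ toRealPair (u, (k : ℤ)) ∈ coneOver P := fun u => by
    rw [hB]
    refine ⟨fun h => ⟨?_, ?_⟩, fun h => ?_⟩
    · simp [toRealPair]
    · simpa [toRealPair] using h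
    · simpa [toRealPair] using h.2
  set L : Set ((Fin n → ℝ) × ℝ) := coneOver P ∩ {x | x.2 < k} with hL
  set H : Set ((Fin n → ℝ) × ℝ) := (fun x => x - (0, (k : ℝ))) ⁻¹' excessRegion P k with hH
  have hLm : MeasurableSet L := hC.inter (measurableSet_lt measurable_snd measurable_const)
  have hHm : MeasurableSet H := (measurable_id.sub_const _) (measurableSet_excessRegion hP k)
  have hHvol : volume H = volume (excessRegion P k) :=
    (measurePreserving_sub_right volume _).measure_preimage
      (measurableSet_excessRegion hP k).nullMeasurableSet
  have hbdd : ∀ N : ℝ, volume (coneOver P ∩ {x | x.2 ≤ N}) ≠ ∞ := fun N =>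
    (isBounded_coneOver_snd_le hP.isBounded N).measure_lt_top.ne
  have hLfin : volume L ≠ ∞ := by
    refine ((measure_mono ?_).trans_lt (lt_top_iff_ne_top.2 (hbdd k))).ne
    intro x hx
    have h1 : x.2 < k := hx.2
    exact ⟨hx.1, h1.le⟩
  have hHfin : volume H ≠ ∞ := by
    refine ((measure_mono ?_).trans_lt (lt_top_iff_ne_top.2 (hbdd (k + A.card)))).ne
    intro x hx
    have h1 : (x - (0, (k : ℝ))).2 < (A.card : ℝ) := by
      have hx' : x - (0, (k : ℝ)) ∈ excessRegion P k := hx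
      rw [hPA] at hx'
      exact snd_lt_card_of_mem_excessRegion hA hx'
    have h2 : ((x - (0, (k : ℝ))).1, (k : ℝ) + (x - (0, (k : ℝ))).2) ∈ coneOver P := hx.2.1
    simp only [Prod.snd_sub, Prod.fst_sub, sub_zero, add_sub_cancel] at h1 h2
    refine ⟨h2, ?_⟩
    change x.2 ≤ k + A.card
    linarith
  have hdisj : Disjoint L H := by
    refine Set.disjoint_left.2 fun x hx hx' => ?_
    have h1 : 0 ≤ (x - (0, (k : ℝ))).2 := hx'.1
    have h2 : x.2 < k := hx.2
    simp only [Prod.snd_sub] at h1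
    linarith
  have e1 : coneOver ((k : ℝ) • P) ∩ {x | x.2 < 1} = {x | (x.1, (k : ℝ) * x.2) ∈ L} := by
    ext x
    refine and_congr (mem_coneOver_smul_iff hk') ?_
    change x.2 < 1 ↔ (k : ℝ) * x.2 < k
    rw [mul_lt_iff_lt_one_right hk']
  have e2 : {x | x ∈ coneOver ((k : ℝ) • P) ∧
      ∀ u ∈ B, x - toRealPair (u, 1) ∉ coneOver ((k : ℝ) • P)} =
      {x | (x.1, (k : ℝ) * x.2) ∈ L ∪ H} := by
    ext x
    have h3 : ∀ u : Fin n → ℤ, x - toRealPair (u, 1) ∈ coneOver ((k : ℝ) • P) ↔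
        (x.1 - toReal u, (k : ℝ) * x.2 - k) ∈ coneOver P := fun u => by
      rw [mem_coneOver_smul_iff hk']
      simp [toRealPair, mul_sub]
    have h4 : (x.1, (k : ℝ) * x.2) ∈ H ↔ 0 ≤ (k : ℝ) * x.2 - k ∧
        (x.1, (k : ℝ) * x.2) ∈ coneOver P ∧ ∀ u : Fin n → ℤ,
          toRealPair (u, k) ∈ coneOver P → (x.1 - toReal u, (k : ℝ) * x.2 - k) ∉ coneOver P := by
      change ((x.1, (k : ℝ) * x.2) - ((0 : Fin n → ℝ), (k : ℝ))) ∈ excessRegion P k ↔ _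
      simp only [Prod.mk_sub_mk, sub_zero]
      change (_ ∧ (x.1, (k : ℝ) + ((k : ℝ) * x.2 - k)) ∈ coneOver P ∧ _) ↔ _
      rw [add_sub_cancel]
    rw [Set.mem_ofPred_eq, Set.mem_ofPred_eq, Set.mem_union, h4, mem_coneOver_smul_iff hk']
    simp only [h3, hB']
    constructor
    · rintro ⟨h5, h6⟩
      rcases lt_or_ge ((k : ℝ) * x.2) k with h7 | h7
      · exact Or.inl ⟨h5, h7⟩
      · exact Or.inr ⟨sub_nonneg.2 h7, h5, h6⟩
    · rintro (⟨h5, h6⟩ | ⟨h5, h6, h7⟩)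
      · refine ⟨h5, fun u _ h7 => ?_⟩
        have h8 : (k : ℝ) * x.2 < k := h6
        have h9 : 0 ≤ (k : ℝ) * x.2 - k := h7.1
        linarith
      · exact ⟨h6, h7⟩
  have hki : (0 : ℝ) ≤ (k : ℝ)⁻¹ := by positivity
  rw [e1, e2, Measure.real, Measure.real, Measure.real, volume_preimage_mul_snd hk' hLm,
    volume_preimage_mul_snd hk' (hLm.union hHm), measure_union hdisj hHm, ENNReal.toReal_mul,
    ENNReal.toReal_mul, ENNReal.toReal_add hLfin hHfin, hHvol, ENNReal.toReal_ofReal hki]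
  ring

/-! ### Multiplicities of the multiples of a very ample divisor -/

theorem mem_latticePoints_nsmul_iff {D : Δ.TDivisor} {k : ℕ} (hk : 0 < k) {u : Fin n → ℤ} :
    u ∈ latticePoints (k • D) ↔ toReal u ∈ (k : ℝ) • polytope D := by
  change toReal u ∈ polytope (k • D) ↔ _
  rw [polytope_nsmul D hk]
  rfl

theorem nsmul_mem_latticePoints {D : Δ.TDivisor} {k : ℕ} (hk : 0 < k) {u : Fin n → ℤ}
    (hu : u ∈ latticePoints D) : k • u ∈ latticePoints (k • D) := by
  rw [mem_latticePoints_nsmul_iff hk, toReal_nsmul]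
  exact Set.smul_mem_smul_set hu

theorem finite_setOf_toReal_mem {P : Set (Fin n → ℝ)} (hP : Bornology.IsBounded P) :
    {u : Fin n → ℤ | toReal u ∈ P}.Finite := by
  obtain ⟨r, hr⟩ := hP.subset_closedBall 0
  refine (Set.finite_Icc (fun _ => -⌈r⌉) (fun _ => ⌈r⌉)).subset fun u hu => ?_
  have h : ∀ i, |(u i : ℝ)| ≤ ⌈r⌉ := fun i =>
    ((norm_le_pi_norm (toReal u) i).trans (by simpa using hr hu)).trans (Int.le_ceil r)
  exact ⟨fun i => by exact_mod_cast (abs_le.1 (h i)).1, fun i => by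
    exact_mod_cast (abs_le.1 (h i)).2⟩

variable {K : Type u} [Field K] {D : Δ.TDivisor}

theorem IsVeryAmple.isCompact_polytope (hΔ : Δ.IsComplete) (hD : IsVeryAmple K D) :
    IsCompact (polytope D) := by
  rw [hD.polytope_eq_convexHull hΔ]
  exact ((hD.finite_latticePoints hΔ).image _).isCompact_convexHull (𝕜 := ℝ)

theorem IsVeryAmple.finite_latticePoints_nsmul (hΔ : Δ.IsComplete) (hD : IsVeryAmple K D)
    {k : ℕ} (hk : 0 < k) : (latticePoints (k • D)).Finite := by
  refine (finite_setOf_toReal_mem ((hD.isCompact_polytope hΔ).smul (k : ℝ)).isBounded).subset ?_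
  exact fun u hu => (mem_latticePoints_nsmul_iff hk).1 hu

theorem IsVeryAmple.smul_polytope_eq_convexHull (hΔ : Δ.IsComplete) (hD : IsVeryAmple K D)
    {k : ℕ} (hk : 0 < k) :
    (k : ℝ) • polytope D = convexHull ℝ (toReal '' latticePoints (k • D)) := by
  apply Set.Subset.antisymm
  · rw [hD.polytope_eq_convexHull hΔ, ← convexHull_smul]
    refine convexHull_mono ?_
    rintro _ ⟨_, ⟨u, hu, rfl⟩, rfl⟩
    exact ⟨k • u, nsmul_mem_latticePoints hk hu, toReal_nsmul k u⟩
  · refine convexHull_min ?_ ((convex_polytope D).smul _)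
    rintro _ ⟨u, hu, rfl⟩
    exact (mem_latticePoints_nsmul_iff hk).1 hu

/-- The points `(u, 1)` with `u` a lattice point of `P_{kD}` generate the group `ℤⁿ × ℤ`, as `P_{kD}`
contains the translate of `P_D` by `k - 1` times any lattice point of `P_D`. -/
theorem IsVeryAmple.closure_latticePoints_nsmul (hΔ : Δ.IsComplete) (hD : IsVeryAmple K D)
    {k : ℕ} (hk : 0 < k) :
    AddSubgroup.closure ((fun u => (u, (1 : ℤ))) '' latticePoints (k • D)) = ⊤ := by
  obtain ⟨m, hm, hgen⟩ := hD.exists_closure_sub_eq_top hΔ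
  set H := AddSubgroup.closure ((fun u => (u, (1 : ℤ))) '' latticePoints (k • D)) with hH
  have hkm : (k • m, (1 : ℤ)) ∈ H :=
    AddSubgroup.subset_closure ⟨_, nsmul_mem_latticePoints hk hm, rfl⟩
  have hmem : ∀ u ∈ latticePoints D, (u - m, (0 : ℤ)) ∈ H := fun u hu => by
    have h : k • m + (u - m) ∈ latticePoints (k • D) := by
      have hk1 : (0 : ℝ) ≤ (k : ℝ) - 1 := by
        have : (1 : ℝ) ≤ k := by exact_mod_cast hk
        linarith
      rw [mem_latticePoints_nsmul_iff hk, toReal_add, toReal_nsmul, toReal_sub]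
      have e : (k : ℝ) • toReal m + (toReal u - toReal m) =
          (1 : ℝ) • toReal u + ((k : ℝ) - 1) • toReal m := by module
      rw [e]
      exact add_smul_mem_smul (convex_polytope D) hm zero_le_one (by linarith)
        (Set.smul_mem_smul_set hu)
    have h2 : (k • m + (u - m), (1 : ℤ)) ∈ H := AddSubgroup.subset_closure ⟨_, h, rfl⟩
    have h3 := H.sub_mem h2 hkm
    simpa using h3
  have hle : AddSubgroup.closure ((fun u => u - m) '' latticePoints D) ≤
      H.comap (AddMonoidHom.inl (Fin n → ℤ) ℤ) := by
    rw [AddSubgroup.closure_le]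
    rintro _ ⟨u, hu, rfl⟩
    exact hmem u hu
  rw [hgen] at hle
  rw [eq_top_iff]
  rintro ⟨w, t⟩ -
  have h1 : (w - t • k • m, (0 : ℤ)) ∈ H := hle (AddSubgroup.mem_top (w - t • k • m))
  have h2 := H.add_mem h1 (H.zsmul_mem hkm t)
  simpa using h2

/-- Points whose differences generate the lattice are not contained in a hyperplane. -/
theorem volume_convexHull_ne_zero {A : Set (Fin n → ℤ)} {m : Fin n → ℤ} (hm : m ∈ A)
    (hgen : AddSubgroup.closure ((fun u => u - m) '' A) = ⊤) :
    volume (convexHull ℝ (toReal '' A)) ≠ 0 := by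
  have hspan : vectorSpan ℝ (toReal '' A) = ⊤ := by
    have hle : ∀ w : Fin n → ℤ, toReal w ∈ vectorSpan ℝ (toReal '' A) := fun w => by
      have hw : w ∈ AddSubgroup.closure ((fun u => u - m) '' A) := by
        rw [hgen]; exact AddSubgroup.mem_top w
      induction hw using AddSubgroup.closure_induction with
      | mem x hx =>
        obtain ⟨u, hu, rfl⟩ := hx
        rw [toReal_sub]
        exact vsub_mem_vectorSpan ℝ ⟨u, hu, rfl⟩ ⟨m, hm, rfl⟩
      | zero => rw [toReal_zero]; exact Submodule.zero_mem _
      | add x y _ _ hx hy => rw [toReal_add]; exact Submodule.add_mem _ hx hy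
      | neg x _ hx =>
        have h := toReal_sub 0 x
        rw [zero_sub, toReal_zero, zero_sub] at h
        rw [h]; exact Submodule.neg_mem _ hx
    rw [eq_top_iff, ← (Pi.basisFun ℝ (Fin n)).span_eq, Submodule.span_le]
    rintro _ ⟨i, rfl⟩
    have h := hle (Pi.single i 1)
    have e : toReal (Pi.single i 1) = Pi.basisFun ℝ (Fin n) i := by
      ext j
      by_cases hj : j = i
      · subst hj; simp [toReal]
      · simp [toReal, hj]
    rwa [e] at h
  have haff : affineSpan ℝ (toReal '' A) = ⊤ :=
    (AffineSubspace.affineSpan_eq_top_iff_vectorSpan_eq_top_of_nonempty ℝ _ _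
      ⟨_, Set.mem_image_of_mem _ hm⟩).2 hspan
  exact (isOpen_interior.measure_pos volume
    (interior_convexHull_nonempty_iff_affineSpan_eq_top.2 haff)).trans_le
      (measure_mono interior_subset) |>.ne'

theorem IsVeryAmple.volume_polytope_pos (hΔ : Δ.IsComplete) (hD : IsVeryAmple K D) :
    0 < volume.real (polytope D) := by
  obtain ⟨m, hm, hgen⟩ := hD.exists_closure_sub_eq_top hΔ
  refine ENNReal.toReal_pos ?_ (hD.isCompact_polytope hΔ).measure_lt_top.ne
  rw [hD.polytope_eq_convexHull hΔ]
  exact volume_convexHull_ne_zero hm hgen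

theorem IsVeryAmple.tendsto_hkSeq (hΔ : Δ.IsComplete) (hD : IsVeryAmple K D) (p : ℕ)
    [Fact p.Prime] [CharP K p] {k : ℕ} (hk : 0 < k) :
    Tendsto (hkSeq p (n + 1) (maxIdeal K (k • D))) atTop
      (𝓝 (volume.real {x | x ∈ coneOver ((k : ℝ) • polytope D) ∧
        ∀ u ∈ (hD.finite_latticePoints_nsmul hΔ hk).toFinset,
          x - toRealPair (u, 1) ∉ coneOver ((k : ℝ) • polytope D)})) := by
  have hfin := hD.finite_latticePoints_nsmul hΔ hk
  obtain ⟨m, hm, -⟩ := hD.exists_closure_sub_eq_top hΔ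
  have hcoe : (hfin.toFinset : Set (Fin n → ℤ)) = latticePoints (k • D) := hfin.coe_toFinset
  have hlim := tendsto_ncard_pointMonoid_compl (A := hfin.toFinset)
    ⟨k • m, hfin.mem_toFinset.2 (nsmul_mem_latticePoints hk hm)⟩
    (by rw [hcoe]; exact hD.closure_latticePoints_nsmul hΔ hk)
  rw [hcoe, ← hD.smul_polytope_eq_convexHull hΔ hk] at hlim
  refine (hlim.comp (tendsto_pow_atTop_atTop_of_one_lt (Fact.out : p.Prime).one_lt)).congr
    fun e => ?_
  simp only [Function.comp_apply, hkSeq]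
  rw [length_quotient_frobeniusPower K p _ hfin e, Nat.cast_pow]

theorem IsVeryAmple.tendsto_hsSeq (hΔ : Δ.IsComplete) (hD : IsVeryAmple K D) {k : ℕ} (hk : 0 < k) :
    Tendsto (hsSeq (n + 1) (maxIdeal K (k • D))) atTop
      (𝓝 ((n + 1).factorial *
        volume.real (coneOver ((k : ℝ) • polytope D) ∩ {x | x.2 < 1}))) := by
  have hfin := hD.finite_latticePoints_nsmul hΔ hk
  obtain ⟨m, hm, -⟩ := hD.exists_closure_sub_eq_top hΔ
  have hcoe : (hfin.toFinset : Set (Fin n → ℤ)) = latticePoints (k • D) := hfin.coe_toFinset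
  have hlim := tendsto_ncard_pointMonoid_snd_lt (A := hfin.toFinset)
    ⟨k • m, hfin.mem_toFinset.2 (nsmul_mem_latticePoints hk hm)⟩
    (by rw [hcoe]; exact hD.closure_latticePoints_nsmul hΔ hk)
  rw [hcoe, ← hD.smul_polytope_eq_convexHull hΔ hk] at hlim
  refine (hlim.const_mul ((n + 1).factorial : ℝ)).congr fun j => ?_
  simp only [hsSeq]
  rw [length_quotient_maxIdeal_pow K _ hfin j, mul_div_assoc]

/-- The degree of a very ample divisor is the normalized volume of its polytope. -/
theorem IsVeryAmple.e0_eq (hΔ : Δ.IsComplete) (hD : IsVeryAmple K D) :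
    e0 K D = n.factorial * volume.real (polytope D) := by
  have h := (hD.tendsto_hsSeq hΔ zero_lt_one).limUnder_eq
  have e : e0 K D = limUnder atTop (hsSeq (n + 1) (maxIdeal K (1 • D))) := by
    rw [one_smul]; rfl
  rw [e, h, Nat.cast_one, one_smul, volume_coneOver_snd_lt_one (hD.isCompact_polytope hΔ),
    Nat.factorial_succ]
  push_cast
  field_simp

/-- The difference of the Hilbert-Kunz multiplicity and the normalized Hilbert-Samuel multiplicity of
`kD` is a volume. -/
theorem IsVeryAmple.eHK_sub_e0_div (hΔ : Δ.IsComplete) (hD : IsVeryAmple K D) (p : ℕ)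
    [Fact p.Prime] [CharP K p] {k : ℕ} (hk : 0 < k) :
    eHK K p (k • D) - e0 K (k • D) / (n + 1).factorial =
      (k : ℝ)⁻¹ * volume.real (excessRegion (polytope D) k) := by
  have hfin := hD.finite_latticePoints_nsmul hΔ hk
  have hfin1 := hD.finite_latticePoints hΔ
  obtain ⟨m, hm, -⟩ := hD.exists_closure_sub_eq_top hΔ
  rw [← volume_coneOver_compl (A := hfin1.toFinset) ⟨m, hfin1.mem_toFinset.2 hm⟩
    (by rw [hfin1.coe_toFinset]; exact hD.polytope_eq_convexHull hΔ) hk hfin.toFinset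
    (fun u => by rw [hfin.mem_toFinset]; exact mem_latticePoints_nsmul_iff hk)]
  have h1 : eHK K p (k • D) = _ := (hD.tendsto_hkSeq hΔ p hk).limUnder_eq
  have h2 : e0 K (k • D) = _ := (hD.tendsto_hsSeq hΔ hk).limUnder_eq
  rw [h1, h2, mul_div_cancel_left₀ _ (by positivity)]

/-- The normalization by the powers of `e_0` makes the bound independent of the volume. -/
theorem rpow_mul_volume_mul_eq (hn : 0 < n) {V F : ℝ} (hV : 0 < V) (hF : 0 ≤ F) (g : ℝ) :
    (F * V) ^ ((1 - (n : ℝ)) / n) * (V * (V ^ (-(1 : ℝ) / n) * g)) =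
      F ^ ((1 - (n : ℝ)) / n) * g := by
  have hn' : (n : ℝ) ≠ 0 := by positivity
  have h : V ^ ((1 - (n : ℝ)) / n) * V * V ^ (-(1 : ℝ) / n) = 1 := by
    rw [← Real.rpow_add_one hV.ne', ← Real.rpow_add hV]
    have e : (1 - (n : ℝ)) / n + 1 + -1 / n = 0 := by field_simp; ring
    rw [e, Real.rpow_zero]
  rw [Real.mul_rpow hF hV.le]
  linear_combination (F ^ ((1 - (n : ℝ)) / n) * g) * h

/-- The limit is `A = V G`, with `V` the volume of the polytope and `G` the volume of the uncovered
region. Both sides of the inequality are the same multiple of `G` and of its lower bound. -/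
theorem IsVeryAmple.tendsto_and_le_and_eq_iff (hn : 0 < n) (hΔ : Δ.IsComplete)
    (hD : IsVeryAmple K D) (p : ℕ) [Fact p.Prime] [CharP K p] :
    ∃ A : ℝ,
      Tendsto (fun k : ℕ =>
        (eHK K p (k • D) - e0 K (k • D) / ((n + 1).factorial : ℝ)) / (k : ℝ) ^ (n - 1))
        atTop (𝓝 A) ∧
      (n : ℝ) / (n + 1) * (n.factorial : ℝ) ^ ((1 - (n : ℝ)) / n) ≤
        e0 K D ^ ((1 - (n : ℝ)) / n) * A ∧
      (e0 K D ^ ((1 - (n : ℝ)) / n) * A =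
          (n : ℝ) / (n + 1) * (n.factorial : ℝ) ^ ((1 - (n : ℝ)) / n) ↔
        TilesSpace (polytope D)) := by
  have hfin := hD.finite_latticePoints hΔ
  obtain ⟨m, hm, -⟩ := hD.exists_closure_sub_eq_top hΔ
  have hV := hD.volume_polytope_pos hΔ
  obtain ⟨hprod, hlim⟩ := tendsto_volume_excessRegion (A := hfin.toFinset)
    ⟨m, hfin.mem_toFinset.2 hm⟩ (P := polytope D)
    (by rw [hfin.coe_toFinset]; exact hD.polytope_eq_convexHull hΔ)
  have hG : volume (uncoveredRegion (polytope D)) ≠ ∞ := by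
    rw [Measure.volume_eq_prod, Measure.prod_prod] at hprod
    intro h
    rw [h, ENNReal.mul_top] at hprod
    · exact hprod rfl
    · intro h0
      rw [measureReal_def, h0] at hV
      exact lt_irrefl _ hV
  set V := volume.real (polytope D) with hVdef
  set G := volume.real (uncoveredRegion (polytope D)) with hGdef
  -- the factor for which `l P` has volume one
  set l : ℝ := V ^ (-(1 : ℝ) / n) with hl
  have hlpos : 0 < l := Real.rpow_pos_of_pos hV _
  have hn' : (0 : ℝ) < n := by exact_mod_cast hn
  have hlV : l ^ n * V = 1 := by
    rw [hl, ← Real.rpow_natCast, ← Real.rpow_mul hV.le, div_mul_cancel₀ _ hn'.ne',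
      Real.rpow_neg_one, inv_mul_cancel₀ hV.ne']
  obtain ⟨hle, heq⟩ := le_volume_uncoveredRegion hn (hD.isCompact_polytope hΔ)
    (convex_polytope D) hG hlpos hlV
  have hbound : 0 ≤ l * n / (n + 1) := by positivity
  have hle' : l * n / (n + 1) ≤ G := by
    rw [hGdef, measureReal_def, ← ENNReal.ofReal_le_iff_le_toReal hG]
    exact hle
  have heq' : G = l * n / (n + 1) ↔ TilesSpace (polytope D) := by
    rw [← heq, hGdef, measureReal_def, ← ENNReal.toReal_eq_toReal_iff' hG ENNReal.ofReal_ne_top,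
      ENNReal.toReal_ofReal hbound]
  have hc : (0 : ℝ) < (n.factorial * V) ^ ((1 - (n : ℝ)) / n) * V := by positivity
  have key : (n : ℝ) / (n + 1) * (n.factorial : ℝ) ^ ((1 - (n : ℝ)) / n) =
      (n.factorial * V) ^ ((1 - (n : ℝ)) / n) * V * (l * n / (n + 1)) := by
    rw [mul_comm, ← rpow_mul_volume_mul_eq hn hV (by positivity)]
    ring
  refine ⟨V * G, hlim.congr' ?_, ?_, ?_⟩
  · filter_upwards [eventually_gt_atTop 0] with k hk
    have hk' : (k : ℝ) ≠ 0 := by positivity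
    rw [hD.eHK_sub_e0_div hΔ p hk]
    obtain ⟨N, rfl⟩ : ∃ N, n = N + 1 := ⟨n - 1, by omega⟩
    rw [Nat.add_sub_cancel, pow_succ]
    field_simp
  · rw [hD.e0_eq hΔ, key, ← mul_assoc]
    exact mul_le_mul_of_nonneg_left hle' hc.le
  · rw [hD.e0_eq hΔ, key, ← mul_assoc, mul_right_inj' hc.ne', heq']

end ToricPair

theorem theorem6p3 {K : Type u} [Field K] [IsAlgClosed K] (p : ℕ) [Fact p.Prime] [CharP K p]
    (d : ℕ) (hd : 2 ≤ d) (Δ : Fan (d - 1)) (hΔ : Δ.IsComplete)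
    (D : Δ.TDivisor) (hD : IsVeryAmple K D) :
    -- the limits that define `e_HK(X, kD)` and `e_0(X, kD)` exist
    (∀ k : ℕ, 1 ≤ k →
      Tendsto (hkSeq p d (maxIdeal K (k • D))) atTop (𝓝 (eHK K p (k • D))) ∧
      Tendsto (hsSeq d (maxIdeal K (k • D))) atTop (𝓝 (e0 K (k • D)))) ∧
    -- the limit over `k` exists, satisfies the inequality, and equality characterizes tiling
    ∃ A : ℝ,
      Tendsto (fun k : ℕ =>
        (eHK K p (k • D) - e0 K (k • D) / (d.factorial : ℝ)) / (k : ℝ) ^ (d - 2))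
        atTop (𝓝 A) ∧
      ((d : ℝ) - 1) / d * ((d - 1).factorial : ℝ) ^ ((2 - (d : ℝ)) / ((d : ℝ) - 1)) ≤
        e0 K D ^ ((2 - (d : ℝ)) / ((d : ℝ) - 1)) * A ∧
      (e0 K D ^ ((2 - (d : ℝ)) / ((d : ℝ) - 1)) * A =
          ((d : ℝ) - 1) / d * ((d - 1).factorial : ℝ) ^ ((2 - (d : ℝ)) / ((d : ℝ) - 1)) ↔
        TilesSpace (polytope D)) := by
  obtain ⟨n, rfl⟩ : ∃ n, d = n + 1 := ⟨d - 1, by omega⟩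
  refine ⟨fun k hk => ⟨?_, ?_⟩, ?_⟩
  · exact tendsto_nhds_limUnder ⟨_, hD.tendsto_hkSeq hΔ p hk⟩
  · exact tendsto_nhds_limUnder ⟨_, hD.tendsto_hsSeq hΔ hk⟩
  · have h := hD.tendsto_and_le_and_eq_iff (by omega) hΔ p
    have e1 : ((n + 1 : ℕ) : ℝ) - 1 = n := by push_cast; ring
    have e2 : 2 - ((n + 1 : ℕ) : ℝ) = 1 - n := by push_cast; ring
    rw [e1, e2, Nat.cast_succ]
    exact h
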